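/- Let $\Gamma\subset\mathbb R^2$ be a lattice spanned over $\mathbb Z$ by a basis $a_1,a_2$ of $\mathbb R^2$, with dual lattice $\Gamma^*=\{\lambda:\lambda\cdot a_j\in2\pi\mathbb Z,\ j=1,2\}$, and let $V_\Gamma:\mathbb R^2\to\mathbb R$ be $\Gamma$-periodic and $\Delta$-bounded on $L^2(\mathbb R^2)$ with relative bound zero. On $\mathcal H_{\mathrm f}=L^2(\mathbb R^2/\Gamma)$ let $H(k)=(-\mathrm i\nabla_y+k)^2+V_\Gamma$, $k\in\mathbb R^2$, with domain $W^{2,2}(\mathbb R^2/\Gamma)$, and let $E_0(k)\le E_1(k)\le\cdots$ be its eigenvalues, repeated according to multiplicity. Fix $s\ge1$ and write $E_+=E_s$, $E_-=E_{s-1}$. Assume: (i) there is a finite set $\{K_1,\dots,K_M\}\subset\mathbb R^2$ such that $E_+(k)=E_-(k)$ if and only if $k\in K_i+\Gamma^*$ for some $i$; (ii) for every $k_0\in\{K_1,\dots,K_M\}$ there are $m=m(k_0)\in\{1,2\}$ and constants $v_+,v_->0$ such that, for $|q|$ small, $E_\pm(k_0+q)-E_\pm(k_0)=\pm v_\pm|q|^m+\mathcal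 O(|q|^{m+1})$; (iii) $\inf\{|E_s(k)-E_i(k)|: k\in\mathbb R^2,\ i\ne s,s-1\}>0$; (iv) for every $k\notin\bigcup_i (K_i+\Gamma^*)$ the eigenvalues $E_+(k)$ and $E_-(k)$ of $H(k)$ are simple. Let $P_+(k)\in\mathcal B(\mathcal H_{\mathrm f})$ be the orthogonal projector onto the eigenspace of $H(k)$ for the eigenvalue $E_+(k)$. Let $k_0\in\{K_1,\dots,K_M\}$, $m=m(k_0)$, and let $r>0$ be such that $E_+(k)\neq E_-(k)$ for $0<|k-k_0|\le r$. Then: (a) $P_+$ is $C^\infty$ on $\{0<|k-k_0|<r\}$ and for every $N\in\mathbb N$ there is a constant $C_N>0$ such that, for every multi-index $I\in\{1,2\}^N$, $$\|\partial^N_I P_+(k_0+q)\|_{\mathcal B(\mathcal H_{\mathrm f})}\le \frac{C_N}{|q|^{Nm}}\qquad\text{for } 0<|q|<r.$$ (b) There is a $C^\infty$ function $u_+:\{0<|k-k_0|<r\}\to\mathcal H_{\mathrm f}$ with $\|u_+(k)\|=1$ and $P_+(k)u_+(k)=u_+(k)$ such that for every $N\in\mathbb N$ there is a constant $C'_N>0$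 such that, for every $I\in\{1,2\}^N$, $$\|\partial^N_I u_+(k_0+q)\|_{\mathcal H_{\mathrm f}}\le \frac{C'_N}{|q|^{Nm}}\qquad\text{for } 0<|q|<r.$$ -/

import Mathlib

open MeasureTheory
open scoped ContDiff NNReal ENNReal

noncomputable section

namespace Bloch

/-- The Euclidean plane (used for both positions and quasi-momenta). -/
abbrev Plane : Type := EuclideanSpace ℝ (Fin 2)

/-- The unit cell `Y` of the lattice `Γ = ℤ a₁ + ℤ a₂`. -/
abbrev cell (a : Module.Basis (Fin 2) ℝ Plane) : Set Plane := ZSpan.fundamentalDomain a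

/-- The fibre Hilbert space `L²(Y)`, i.e. `L²(ℝ²/Γ)`. -/
abbrev Fibre (a : Module.Basis (Fin 2) ℝ Plane) : Type :=
  Lp ℂ 2 (volume.restrict (cell a))

/-- The dual lattice `Γ*`: all `l` with `l · a_j ∈ 2πℤ` for `j = 1, 2`. -/
def dualLattice (a : Module.Basis (Fin 2) ℝ Plane) : AddSubgroup Plane where
  carrier := {l | ∀ j, ∃ n : ℤ, inner ℝ l (a j) = 2 * Real.pi * n}
  zero_mem' := fun j => ⟨0, by simp⟩
  add_mem' := by
    intro x y hx hy j
    obtain ⟨n, hn⟩ := hx j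
    obtain ⟨p, hp⟩ := hy j
    exact ⟨n + p, by rw [inner_add_left, hn, hp]; push_cast; ring⟩
  neg_mem' := by
    intro x hx j
    obtain ⟨n, hn⟩ := hx j
    exact ⟨-n, by rw [inner_neg_left, hn]; push_cast; ring⟩

/-- `V` is periodic with respect to `Γ`. -/
def IsPeriodic (a : Module.Basis (Fin 2) ℝ Plane) (V : Plane → ℝ) : Prop :=
  ∀ x : Plane, ∀ g ∈ Submodule.span ℤ (Set.range a), V (x + g) = V x

/-- `f = Δ w` in the sense of distributions on `ℝ²`. -/
def IsWeakLaplacian (w f : Plane → ℂ) : Prop :=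
  ∀ φ : Plane → ℝ, ContDiff ℝ ∞ φ → HasCompactSupport φ →
    ∫ x, (Laplacian.laplacian φ x) • w x = ∫ x, φ x • f x

/-- Multiplication by `V` is `Δ`-bounded on `L²(ℝ²)` with relative bound zero. The domain of `Δ`
consists of the `w ∈ L²` whose distributional Laplacian is in `L²`, that is, `W^{2,2}(ℝ²)`. -/
def IsLaplacianBoundedZero (V : Plane → ℝ) : Prop :=
  ∀ α : ℝ≥0, 0 < α → ∃ β : ℝ≥0, ∀ w f : Plane → ℂ,
    MemLp w 2 volume → MemLp f 2 volume → IsWeakLaplacian w f →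
      MemLp (fun x => V x • w x) 2 volume ∧
      eLpNorm (fun x => V x • w x) 2 volume ≤ α * eLpNorm f 2 volume + β * eLpNorm w 2 volume

instance (a : Module.Basis (Fin 2) ℝ Plane) : IsFiniteMeasure (volume.restrict (cell a)) :=
  isFiniteMeasure_restrict.mpr (ZSpan.fundamentalDomain_isBounded a).measure_lt_top.ne

theorem memLp_planeWave (a : Module.Basis (Fin 2) ℝ Plane) (l : Plane) :
    MemLp (fun y : Plane => Complex.exp (Complex.I * (inner ℝ l y : ℝ))) 2
      (volume.restrict (cell a)) := by
  refine MemLp.of_bound (Continuous.aestronglyMeasurable (by fun_prop)) 1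
    (Filter.Eventually.of_forall fun y => ?_)
  rw [mul_comm, Complex.norm_exp_ofReal_mul_I]

/-- The plane wave `y ↦ e^{i l·y}` as an element of `L²(Y)`. -/
def planeWave (a : Module.Basis (Fin 2) ℝ Plane) (l : Plane) : Fibre a :=
  (memLp_planeWave a l).toLp _

/-- The (unnormalised) Fourier coefficient `∫_Y e^{-i l·y} u(y) dy`. -/
def coeff (a : Module.Basis (Fin 2) ℝ Plane) (l : Plane) (u : Fibre a) : ℂ :=
  inner ℂ (planeWave a l) u

/-- The periodic Sobolev space `W^{2,2}(ℝ²/Γ)`, as a subspace of `L²(Y)`. -/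
def sobolevTwo (a : Module.Basis (Fin 2) ℝ Plane) : Submodule ℂ (Fibre a) where
  carrier := {u | Summable fun l : dualLattice a =>
    ((1 + ‖(l : Plane)‖ ^ 2) * ‖coeff a l u‖) ^ 2}
  zero_mem' := by simp [coeff, summable_zero]
  add_mem' := by
    intro u v hu hv
    refine Summable.of_nonneg_of_le (fun l => sq_nonneg _) (fun l => ?_)
      ((hu.mul_left 2).add (hv.mul_left 2))
    have h : ‖coeff a l (u + v)‖ ≤ ‖coeff a l u‖ + ‖coeff a l v‖ := by
      simp only [coeff, inner_add_right]
      exact norm_add_le _ _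
    have h2 : ‖coeff a l (u + v)‖ ^ 2 ≤ 2 * ‖coeff a l u‖ ^ 2 + 2 * ‖coeff a l v‖ ^ 2 := by
      nlinarith [sq_nonneg (‖coeff a l u‖ - ‖coeff a l v‖), norm_nonneg (coeff a l (u + v)),
        norm_nonneg (coeff a l u), norm_nonneg (coeff a l v)]
    have h3 := mul_le_mul_of_nonneg_left h2 (sq_nonneg (1 + ‖(l : Plane)‖ ^ 2))
    simp only [mul_pow]
    linarith
  smul_mem' := by
    intro c u hu
    refine (hu.mul_left (‖c‖ ^ 2)).congr fun l => ?_
    simp only [coeff, inner_smul_right, norm_mul]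
    ring

/-- The graph of the fibre Hamiltonian `H(k) = (-i∇ + k)² + V` on the domain `W^{2,2}(ℝ²/Γ)`:
`(u, f)` belongs to it iff `u` is in the domain and `H(k) u = f`, which is read on Fourier
coefficients (`w` is the product `V u`). -/
def fibreHamiltonian (a : Module.Basis (Fin 2) ℝ Plane) (V : Plane → ℝ) (k : Plane) :
    Submodule ℂ (Fibre a × Fibre a) where
  carrier := {p | p.1 ∈ sobolevTwo a ∧ ∃ w : Fibre a,
    (∀ᵐ y ∂(volume.restrict (cell a)), w y = V y • p.1 y) ∧
    ∀ l ∈ dualLattice a,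
      coeff a l p.2 = ((‖l + k‖ ^ 2 : ℝ) : ℂ) * coeff a l p.1 + coeff a l w}
  zero_mem' := by
    refine ⟨(sobolevTwo a).zero_mem, 0, ?_, fun l _ => by simp [coeff]⟩
    filter_upwards [Lp.coeFn_zero ℂ 2 (volume.restrict (cell a))] with y hy
    change (0 : Fibre a) y = V y • (0 : Fibre a) y
    rw [hy]
    simp
  add_mem' := by
    rintro p p' ⟨h1, w, hw, h2⟩ ⟨h1', w', hw', h2'⟩
    refine ⟨(sobolevTwo a).add_mem h1 h1', w + w', ?_, fun l hl => ?_⟩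
    · filter_upwards [hw, hw', Lp.coeFn_add w w', Lp.coeFn_add p.1 p'.1] with y e1 e2 e3 e4
      simp only [Prod.fst_add]
      rw [e3, e4, Pi.add_apply, Pi.add_apply, e1, e2, smul_add]
    · have e := h2 l hl
      have e' := h2' l hl
      simp only [coeff, Prod.fst_add, Prod.snd_add, inner_add_right] at e e' ⊢
      rw [e, e']
      ring
  smul_mem' := by
    rintro c p ⟨h1, w, hw, h2⟩
    refine ⟨(sobolevTwo a).smul_mem c h1, c • w, ?_, fun l hl => ?_⟩
    · filter_upwards [hw, Lp.coeFn_smul c w, Lp.coeFn_smul c p.1] with y e1 e3 e4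
      simp only [Prod.smul_fst]
      rw [e3, e4, Pi.smul_apply, Pi.smul_apply, e1, smul_comm]
    · have e := h2 l hl
      simp only [coeff, Prod.smul_fst, Prod.smul_snd, inner_smul_right] at e ⊢
      rw [e]
      ring

/-- The eigenspace `{u | H(k) u = e u}`. -/
def eigenspace (a : Module.Basis (Fin 2) ℝ Plane) (V : Plane → ℝ) (k : Plane) (e : ℝ) :
    Submodule ℂ (Fibre a) :=
  (fibreHamiltonian a V k).comap (LinearMap.prod LinearMap.id ((e : ℂ) • LinearMap.id))

/-- The span of all eigenvectors of `H(k)` with eigenvalue at most `e`. -/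
def lowEnergySpace (a : Module.Basis (Fin 2) ℝ Plane) (V : Plane → ℝ) (k : Plane) (e : ℝ) :
    Submodule ℂ (Fibre a) :=
  ⨆ e' : Set.Iic e, eigenspace a V k e'

/-- The Bloch band `E_n(k)`: the `n`-th eigenvalue of `H(k)` (`n = 0, 1, …`), in increasing order
and repeated according to multiplicity, i.e. the least `e` such that more than `n` linearly
independent eigenvectors have eigenvalue at most `e`. -/
def band (a : Module.Basis (Fin 2) ℝ Plane) (V : Plane → ℝ) (n : ℕ) (k : Plane) : ℝ :=
  sInf {e : ℝ | (n : Cardinal) < Module.rank ℂ (lowEnergySpace a V k e)}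

/-- The orthogonal projector of `L²(Y)` onto the eigenspace of `H(k)` for the eigenvalue `E_n(k)`
(eigenspaces of `H(k)` are closed, so that taking the closure changes nothing). -/
def eigenprojector (a : Module.Basis (Fin 2) ℝ Plane) (V : Plane → ℝ) (n : ℕ) (k : Plane) :
    Fibre a →L[ℂ] Fibre a :=
  (eigenspace a V k (band a V n k)).topologicalClosure.starProjection

/-- The hypotheses on the periodic Schrödinger operator `-Δ + V`, with the Bloch bands
`E_s = E_{n+1}` and `E_{s-1} = E_n`, which meet exactly at the points of the finite set `K`
(modulo `Γ*`); `m k₀` is the order of the intersection at `k₀ ∈ K`. -/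
structure IsSemimetal (a : Module.Basis (Fin 2) ℝ Plane) (V : Plane → ℝ) (n : ℕ)
    (K : Finset Plane) (m : Plane → ℕ) : Prop where
  aemeasurable : AEMeasurable V volume
  periodic : IsPeriodic a V
  bounded : IsLaplacianBoundedZero V
  /-- The two bands meet exactly at the points of `K`, modulo `Γ*`. -/
  intersection : ∀ k, band a V (n + 1) k = band a V n k ↔ ∃ k₀ ∈ K, k - k₀ ∈ dualLattice a
  order : ∀ k₀ ∈ K, m k₀ = 1 ∨ m k₀ = 2
  /-- Expansion of the two bands at every intersection point. -/
  expansion : ∀ k₀ ∈ K, ∃ r vp vm C : ℝ, 0 < r ∧ 0 < vp ∧ 0 < vm ∧ ∀ q : Plane, ‖q‖ < r →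
    |band a V (n + 1) (k₀ + q) - band a V (n + 1) k₀ - vp * ‖q‖ ^ m k₀|
      ≤ C * ‖q‖ ^ (m k₀ + 1) ∧
    |band a V n (k₀ + q) - band a V n k₀ + vm * ‖q‖ ^ m k₀| ≤ C * ‖q‖ ^ (m k₀ + 1)
  /-- Semi-gap condition. -/
  gap : ∃ g : ℝ, 0 < g ∧ ∀ k, ∀ i, i ≠ n + 1 → i ≠ n → g ≤ |band a V (n + 1) k - band a V i k|
  /-- Both eigenvalues are simple away from the intersection points. -/
  simple : ∀ k, (¬ ∃ k₀ ∈ K, k - k₀ ∈ dualLattice a) →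
    Module.finrank ℂ (eigenspace a V k (band a V (n + 1) k)) = 1 ∧
    Module.finrank ℂ (eigenspace a V k (band a V n k)) = 1

/-- The iterated partial derivative `∂_{I 0} ⋯ ∂_{I (N-1)} F (k)`. -/
def partialDeriv {X : Type*} [NormedAddCommGroup X] [NormedSpace ℝ X] {N : ℕ}
    (I : Fin N → Fin 2) (F : Plane → X) (k : Plane) : X :=
  iteratedFDeriv ℝ N F k fun j => EuclideanSpace.single (I j) (1 : ℝ)

/-- The punctured open disc `{k₀ + q | 0 < |q| < r}`. -/
def puncturedDisc (k₀ : Plane) (r : ℝ) : Set Plane := Metric.ball k₀ r \ {k₀}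

end Bloch

end

/-! The family `H(k)` is replaced by its resolvents `T k`, the inverses of `H(k) + μ`: compact,
self-adjoint, injective operators depending smoothly on `k` in operator norm, with eigenvalues
`(E_i(k) + μ)⁻¹` (`exists_isResolventFamily`). Min-max makes every band continuous. Where the two
bands differ, the upper eigenprojector is locally a contour integral of the resolvent of `T k` over
a fixed circle, hence smooth (`contDiffAt_eigenprojector`). At a crossing the same argument gives
only a smooth projector `S` onto both bands together (`exists_contDiffAt_crossing`).

The singularity at `k₀` is resolved by a blow-up. With `t₀` the common eigenvalue of `T k₀`, the
operator `B = (T - t₀) S` is smooth and, off `k₀`, equals `b P₊ + c P₋`, where `b / |q|^m` and `c /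
|q|^m` tend to limits `τ < 0 < σ`. Hadamard's lemma gives `B(k₀ + t v) = t^m G(t, v)` with `G`
smooth across `t = 0`. The limit `G(0, v)` is annihilated by `X (X - τ) (X - σ)`, so a circle about
`τ` isolates `τ` from `0` and `σ`, and the contour integral of the resolvent of `G(t, v)` extends
`P₊(k₀ + t v)` smoothly to `t = 0` (`exists_polar_extension`). A function smooth in polar
coordinates has derivatives of order `N` bounded by `C / |q|^N` (`exists_polar_bound`). Since `m ≥
1`, this is stronger near `k₀` than the claim; away from `k₀` compactness suffices, because the
bands remain distinct on a slightly larger disc.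

For the section, one looks for a vector `e` with `p(0, v) e ≠ 0` in every direction `v`, where `p`
is the polar extension of `P₊`. In the two-dimensional range of `S(k₀)` the forbidden lines are the
ranges of the limiting lower projectors. They form a smooth curve in a complex projective line, of
real dimension two, and so cannot fill it (`exists_forall_apply_ne_zero`). Normalising `P₊ e` gives
a section near `k₀` with the same polar regularity. It is extended outwards, unchanged near `k₀`, by
finitely many short radial pull-backs followed by projection (`exists_isSectionOn_extension`). -/

noncomputable section

namespace Bloch

/-! ### Fourier series on the unit cell of the lattice. -/

section FourierBasis

/-- The circle `ℝ / ℤ` carries the Haar probability measure. -/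
local instance unitAddCircleMeasureSpace : MeasureSpace UnitAddCircle := ⟨AddCircle.haarAddCircle⟩

variable (a : Module.Basis (Fin 2) ℝ Plane)

/-- The measurable section `ℝ²/ℤ² → ℝ²` of the covering by the lattice coordinates. -/
def torusSection (x : UnitAddTorus (Fin 2)) : Plane :=
  a.equivFunL.symm (UnitAddTorus.measurableEquivPiIoc (0 : Fin 2 → ℝ) x).1

theorem measurable_torusSection : Measurable (torusSection a) :=
  a.equivFunL.symm.continuous.measurable.comp
    (measurable_subtype_coe.comp (UnitAddTorus.measurableEquivPiIoc 0).measurable)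

theorem map_torusSection :
    Measure.map (torusSection a) (volume : Measure (UnitAddTorus (Fin 2))) =
      (Measure.map a.equivFunL.symm (volume : Measure (Fin 2 → ℝ))).restrict (cell a) := by
  have hm : MeasurableSet {x : Fin 2 → ℝ | ∀ i, x i ∈ Set.Ioc ((0 : Fin 2 → ℝ) i)
      ((0 : Fin 2 → ℝ) i + 1)} := MeasurableSet.univ_pi' (fun i => measurableSet_Ioc)
  have h1 : torusSection a = a.equivFunL.symm ∘ Subtype.val ∘
    (UnitAddTorus.measurableEquivPiIoc (0 : Fin 2 → ℝ)) := rfl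
  have hL : Measurable a.equivFunL.symm := a.equivFunL.symm.continuous.measurable
  rw [h1, ← Measure.map_map hL
    (measurable_subtype_coe.comp (UnitAddTorus.measurableEquivPiIoc 0).measurable),
    ← Measure.map_map measurable_subtype_coe (UnitAddTorus.measurableEquivPiIoc 0).measurable,
    (UnitAddTorus.measurePreserving_equivPiIoc (0 : Fin 2 → ℝ)).map_eq]
  refine (congrArg (Measure.map a.equivFunL.symm)
    (map_comap_subtype_coe hm (volume : Measure (Fin 2 → ℝ)))).trans ?_
  rw [Measure.restrict_map hL (ZSpan.fundamentalDomain_measurableSet a)]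
  congr 1
  -- The torus is represented by the cube of half-open intervals `(0, 1]`, the cell by that of `[0,
  -- 1)`; they differ by a null set.
  refine Measure.restrict_congr_set ?_
  have e1 : {x : Fin 2 → ℝ | ∀ i, x i ∈ Set.Ioc ((0 : Fin 2 → ℝ) i) ((0 : Fin 2 → ℝ) i + 1)} =
    Set.univ.pi fun i => Set.Ioc ((0 : Fin 2 → ℝ) i) ((1 : Fin 2 → ℝ) i) := by
    ext x; simp
  have e2 : a.equivFunL.symm ⁻¹' (cell a) =
    Set.univ.pi fun i => Set.Ico ((0 : Fin 2 → ℝ) i) ((1 : Fin 2 → ℝ) i) := by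
    ext x
    have : ∀ i, a.repr (a.equivFunL.symm x) i = x i := fun i => by
      have := congrFun (a.equivFunL.apply_symm_apply x) i
      simpa using this
    simp [cell, ZSpan.mem_fundamentalDomain, this]
  rw [e1, e2]
  exact Measure.univ_pi_Ioc_ae_eq_Icc.trans Measure.univ_pi_Ico_ae_eq_Icc.symm

/-- Uniqueness of Haar measure: Lebesgue measure and its image under lattice coordinates are
proportional. Only a finite nonzero factor is needed to carry orthogonality and completeness of
characters from the standard torus to the cell. -/
theorem exists_restrict_cell_eq_smul_map : ∃ c : ℝ≥0∞, c ≠ 0 ∧ c ≠ ⊤ ∧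
    (volume.restrict (cell a) : Measure Plane) =
      c • Measure.map (torusSection a) (volume : Measure (UnitAddTorus (Fin 2))) := by
  have : (Measure.map a.equivFunL.symm (volume : Measure (Fin 2 → ℝ))).IsAddHaarMeasure :=
    a.equivFunL.symm.isAddHaarMeasure_map _
  refine ⟨Measure.addHaarScalarFactor (volume : Measure Plane)
    (Measure.map a.equivFunL.symm (volume : Measure (Fin 2 → ℝ))), ?_, ENNReal.coe_ne_top, ?_⟩
  · exact_mod_cast (Measure.addHaarScalarFactor_pos_of_isAddHaarMeasure _ _).ne'
  · rw [map_torusSection, ← Measure.restrict_smul]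
    congr 1
    exact Measure.isAddLeftInvariant_eq_smul _ _

theorem exp_inner_torusSection {l : Plane} {n : Fin 2 → ℤ}
    (h : ∀ j, inner ℝ l (a j) = 2 * Real.pi * n j) (x : UnitAddTorus (Fin 2)) :
    Complex.exp (Complex.I * (inner ℝ l (torusSection a x) : ℝ)) = UnitAddTorus.mFourier n x := by
  set y := UnitAddTorus.measurableEquivPiIoc (0 : Fin 2 → ℝ) x with hy
  have hx : x = fun i => ((y.1 i : ℝ) : UnitAddCircle) := by
    rw [← UnitAddTorus.coe_symm_measurableEquivPiIoc_apply, hy, MeasurableEquiv.symm_apply_apply]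
  have h1 : torusSection a x = ∑ i, y.1 i • a i := by
    simp only [torusSection, ← hy]
    exact a.equivFun_symm_apply y.1
  rw [h1, hx]
  simp only [UnitAddTorus.mFourier, ContinuousMap.coe_mk, fourier_coe_apply, ← Complex.exp_sum,
    inner_sum, inner_smul_right, h]
  congr 1
  push_cast
  rw [Finset.mul_sum]
  refine Finset.sum_congr rfl fun i _ => ?_
  ring

theorem exists_inner_eq (a : Module.Basis (Fin 2) ℝ Plane) (n : Fin 2 → ℤ) :
    ∃ l : dualLattice a, ∀ j, inner ℝ (l : Plane) (a j) = 2 * Real.pi * n j := by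
  let f : StrongDual ℝ Plane := LinearMap.toContinuousLinearMap
    (a.constr ℝ fun j => (2 * Real.pi * n j : ℝ))
  have h : ∀ j, inner ℝ ((InnerProductSpace.toDual ℝ Plane).symm f) (a j) = 2 * Real.pi * n j := by
    intro j
    rw [InnerProductSpace.toDual_symm_apply]
    simp [f]
  exact ⟨⟨_, fun j => ⟨n j, h j⟩⟩, h⟩

theorem eq_of_inner_basis_eq {l l' : Plane} (h : ∀ j, inner ℝ l (a j) = inner ℝ l' (a j)) :
    l = l' := by
  refine ext_inner_right ℝ fun x => ?_
  rw [← a.sum_repr x]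
  simp only [inner_sum, inner_smul_right, h]

theorem coeff_eq_integral (l : Plane) (u : Fibre a) :
    coeff a l u = ∫ y in cell a, starRingEnd ℂ (Complex.exp (Complex.I * (inner ℝ l y : ℝ))) * u y := by
  rw [coeff, L2.inner_def]
  refine integral_congr_ae ?_
  filter_upwards [(memLp_planeWave a l).coeFn_toLp] with y hy
  rw [planeWave, hy, RCLike.inner_apply, mul_comm]

/-- The area of the unit cell. -/
def cellArea : ℝ := (volume : Measure Plane).real (cell a)

theorem cellArea_pos : 0 < cellArea a :=
  ENNReal.toReal_pos (ZSpan.measure_fundamentalDomain_ne_zero a)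
    (ZSpan.fundamentalDomain_isBounded a).measure_lt_top.ne

theorem integral_cell_exp {l : Plane} (hl : l ∈ dualLattice a) (h0 : l ≠ 0) :
    ∫ y in cell a, Complex.exp (Complex.I * (inner ℝ l y : ℝ)) = 0 := by
  obtain ⟨c, hc0, hc1, hc⟩ := exists_restrict_cell_eq_smul_map a
  choose n hn using hl
  have hn0 : n ≠ 0 := by
    rintro rfl
    exact h0 (eq_of_inner_basis_eq a fun j => by simp [hn])
  rw [hc, integral_smul_measure, integral_map (measurable_torusSection a).aemeasurable
    (Continuous.aestronglyMeasurable (by fun_prop))]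
  simp only [exp_inner_torusSection a hn]
  have key := (UnitAddTorus.orthonormal_mFourier (d := Fin 2)).2 (i := 0) (j := n) hn0.symm
  simp only [L2.inner_def] at key
  have : ∫ x, UnitAddTorus.mFourier n x = 0 := by
    rw [← key]
    refine integral_congr_ae ?_
    filter_upwards [UnitAddTorus.coeFn_mFourierLp 2 (0 : Fin 2 → ℤ),
      UnitAddTorus.coeFn_mFourierLp 2 n] with x h1 h2
    rw [h1, h2]
    simp [UnitAddTorus.mFourier_zero]
  rw [this, smul_zero]

theorem coeff_planeWave (l l' : Plane) : coeff a l (planeWave a l') =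
    ∫ y in cell a, Complex.exp (Complex.I * (inner ℝ (l' - l) y : ℝ)) := by
  rw [coeff_eq_integral]
  refine integral_congr_ae ?_
  filter_upwards [(memLp_planeWave a l').coeFn_toLp] with y hy
  rw [planeWave, hy, ← Complex.exp_conj, ← Complex.exp_add]
  congr 1
  simp [inner_sub_left]
  ring

/-- Pulled back by `torusSection`, the plane waves of the dual lattice become the characters of the
standard torus, whose completeness is known. Coefficients change only by the nonzero factor relating
the two measures. -/
theorem eq_zero_of_coeff_eq_zero (u : Fibre a) (h : ∀ l ∈ dualLattice a, coeff a l u = 0) :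
    u = 0 := by
  obtain ⟨c, hc0, hc1, hc⟩ := exists_restrict_cell_eq_smul_map a
  have hmap : Measure.map (torusSection a) (volume : Measure (UnitAddTorus (Fin 2))) =
      c⁻¹ • volume.restrict (cell a) := by
    rw [hc, smul_smul, ENNReal.inv_mul_cancel hc0 hc1, one_smul]
  have hu : MemLp u 2 (Measure.map (torusSection a) volume) := by
    rw [hmap]
    exact (Lp.memLp u).smul_measure (ENNReal.inv_ne_top.2 hc0)
  have hg : MemLp (u ∘ torusSection a) 2 volume :=
    hu.comp_of_map (measurable_torusSection a).aemeasurable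
  have hg0 : hg.toLp _ = 0 := by
    refine (UnitAddTorus.mFourierBasis (d := Fin 2)).repr.injective ?_
    ext n
    rw [UnitAddTorus.mFourierBasis_repr, map_zero]
    obtain ⟨l, hl⟩ := exists_inner_eq a n
    have := h l l.2
    have hint : ∀ g : Plane → ℂ, ∫ y in cell a, g y =
        c.toReal • ∫ y, g y ∂(Measure.map (torusSection a) volume) := fun g => by
      rw [hc, integral_smul_measure]
    rw [coeff_eq_integral, hint, integral_map (measurable_torusSection a).aemeasurable] at this
    · rw [smul_eq_zero_iff_right (by simp [ENNReal.toReal_eq_zero_iff, hc0, hc1])] at this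
      rw [UnitAddTorus.mFourierCoeff]
      refine Eq.trans (integral_congr_ae ?_) this
      filter_upwards [hg.coeFn_toLp] with x hx
      rw [hx, exp_inner_torusSection a hl, UnitAddTorus.mFourier_neg]
      rfl
    · exact (Continuous.aestronglyMeasurable (by fun_prop)).mul hu.1
  rw [Lp.eq_zero_iff_ae_eq_zero]
  suffices hs : ∀ᵐ y ∂(c • Measure.map (torusSection a) volume), u y = 0 by
    exact (show ∀ᵐ y ∂(volume.restrict (cell a)), u y = 0 from (congrArg (fun ν : Measure Plane =>
      ∀ᵐ y ∂ν, u y = 0) hc).mpr hs)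
  refine Measure.ae_smul_measure ?_ c
  have h2 : (u ∘ torusSection a) =ᵐ[volume] 0 := by
    have := hg.coeFn_toLp
    rw [hg0] at this
    exact this.symm.trans (Lp.coeFn_zero _ _ _)
  have hs : AEStronglyMeasurable u (Measure.map (torusSection a) volume) := hu.1
  refine (hs.ae_eq_mk).trans ?_
  refine (ae_map_iff (measurable_torusSection a).aemeasurable
    (p := fun y => hs.mk u y = 0) (hs.stronglyMeasurable_mk.measurable (measurableSet_singleton 0))).2 ?_
  filter_upwards [h2, ae_of_ae_map (measurable_torusSection a).aemeasurable hs.ae_eq_mk] with x h3 h4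
  rw [← h4]; exact h3

theorem orthonormal_normalized_planeWave :
    Orthonormal ℂ fun l : dualLattice a => ((Real.sqrt (cellArea a))⁻¹ : ℂ) • planeWave a l := by
  classical
  rw [orthonormal_iff_ite]
  intro l l'
  rw [inner_smul_left, inner_smul_right]
  have : inner ℂ (planeWave a l) (planeWave a l') = coeff a l (planeWave a l') := rfl
  rw [this, coeff_planeWave]
  split_ifs with hll
  · subst hll
    simp only [sub_self, inner_zero_left, Complex.ofReal_zero, mul_zero, Complex.exp_zero,
      integral_const]
    have h := Real.mul_self_sqrt (cellArea_pos a).le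
    have h' : (Real.sqrt (cellArea a) : ℂ) ≠ 0 := by
      exact_mod_cast (Real.sqrt_pos.2 (cellArea_pos a)).ne'
    have hv : (volume.restrict (cell a)).real Set.univ = cellArea a := by
      simp [cellArea, Measure.real]
    rw [hv, ← h]
    simp only [map_inv₀, Complex.conj_ofReal, mul_one, Complex.real_smul, Complex.ofReal_mul]
    rw [Real.mul_self_sqrt (cellArea_pos a).le]
    field_simp
  · rw [integral_cell_exp a (sub_mem l'.2 l.2) (sub_ne_zero.2 fun h => hll (Subtype.ext h.symm))]
    simp

/-- The normalised plane waves form a Hilbert basis of `L²(Y)`. -/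
def fourierBasis : HilbertBasis (dualLattice a) ℂ (Fibre a) :=
  HilbertBasis.mkOfOrthogonalEqBot (orthonormal_normalized_planeWave a) <| by
    rw [Submodule.eq_bot_iff]
    intro u hu
    refine eq_zero_of_coeff_eq_zero a u fun l hl => ?_
    have := Submodule.mem_orthogonal _ _ |>.1 hu _ (Submodule.subset_span ⟨⟨l, hl⟩, rfl⟩)
    rw [inner_smul_left] at this
    refine (mul_eq_zero.1 this).resolve_left ?_
    have h' : (Real.sqrt (cellArea a) : ℂ) ≠ 0 := by
      exact_mod_cast (Real.sqrt_pos.2 (cellArea_pos a)).ne'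
    simpa using h'

theorem fourierBasis_apply (l : dualLattice a) :
    fourierBasis a l = ((Real.sqrt (cellArea a))⁻¹ : ℂ) • planeWave a l := by
  rw [fourierBasis, HilbertBasis.coe_mkOfOrthogonalEqBot]

theorem coeff_eq_repr (l : dualLattice a) (u : Fibre a) :
    coeff a l u = (Real.sqrt (cellArea a) : ℂ) * (fourierBasis a).repr u l := by
  have h' : (Real.sqrt (cellArea a) : ℂ) ≠ 0 := by
    exact_mod_cast (Real.sqrt_pos.2 (cellArea_pos a)).ne'
  rw [HilbertBasis.repr_apply_apply, fourierBasis_apply, inner_smul_left, coeff]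
  simp [h']

end FourierBasis

/-! ### Multiplication operators in a Hilbert basis. -/

section Diagonal

variable {ι E : Type*} [NormedAddCommGroup E] [InnerProductSpace ℂ E]

theorem norm_sq_eq_tsum_repr (b : HilbertBasis ι ℂ E) (x : E) :
    HasSum (fun i => ‖b.repr x i‖ ^ 2) (‖x‖ ^ 2) := by
  rw [← b.repr.norm_map x]
  have h := lp.hasSum_norm (p := 2) (by norm_num) (b.repr x)
  simpa using h

theorem exists_repr_eq (b : HilbertBasis ι ℂ E) {c : ι → ℂ} (h : Summable fun i => ‖c i‖ ^ 2) :
    ∃ x : E, ∀ i, b.repr x i = c i := by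
  have hc : Memℓp c 2 := memℓp_gen (by simpa using h)
  exact ⟨b.repr.symm ⟨c, hc⟩, fun i => by simp⟩

theorem exists_diagonal (b : HilbertBasis ι ℂ E) (c : ι → ℂ) (h : ∃ C : ℝ, 0 ≤ C ∧ ∀ i, ‖c i‖ ≤ C) :
    ∃ D : E →L[ℂ] E, ∀ x i, b.repr (D x) i = c i * b.repr x i := by
  obtain ⟨C, hC, hc⟩ := h
  have hle : ∀ x i, ‖c i * b.repr x i‖ ^ 2 ≤ C ^ 2 * ‖b.repr x i‖ ^ 2 := fun x i => by
    rw [norm_mul, mul_pow]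
    gcongr
    exact hc i
  have hs : ∀ x : E, Summable fun i => ‖c i * b.repr x i‖ ^ 2 := fun x =>
    Summable.of_nonneg_of_le (fun i => by positivity) (hle x)
      ((norm_sq_eq_tsum_repr b x).summable.mul_left _)
  choose D hD using fun x => exists_repr_eq b (hs x)
  refine ⟨LinearMap.mkContinuous ⟨⟨D, fun x y => ?_⟩, fun r x => ?_⟩ C fun x => ?_, hD⟩
  · refine b.repr.injective ?_
    ext i
    simp [hD, mul_add]
  · refine b.repr.injective ?_
    ext i
    simp [hD, mul_left_comm]
  · refine le_of_sq_le_sq ?_ (by positivity)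
    rw [mul_pow]
    have h1 := norm_sq_eq_tsum_repr b (D x)
    have h2 := (norm_sq_eq_tsum_repr b x).mul_left (C ^ 2)
    refine hasSum_le (fun i => ?_) h1 h2
    rw [hD]
    exact hle x i

open Classical in
/-- The operator acting on the coefficients with respect to a Hilbert basis as multiplication by a
bounded sequence `c` (and zero if `c` is unbounded). -/
def diagonal (b : HilbertBasis ι ℂ E) (c : ι → ℂ) : E →L[ℂ] E :=
  if h : ∃ C : ℝ, 0 ≤ C ∧ ∀ i, ‖c i‖ ≤ C then (exists_diagonal b c h).choose else 0

theorem diagonal_repr (b : HilbertBasis ι ℂ E) {c : ι → ℂ} {C : ℝ} (hC : 0 ≤ C)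
    (hc : ∀ i, ‖c i‖ ≤ C) (x : E) (i : ι) : b.repr (diagonal b c x) i = c i * b.repr x i := by
  have h : ∃ C : ℝ, 0 ≤ C ∧ ∀ i, ‖c i‖ ≤ C := ⟨C, hC, hc⟩
  rw [diagonal, dif_pos h]
  exact (exists_diagonal b c h).choose_spec x i

theorem norm_diagonal_le (b : HilbertBasis ι ℂ E) {c : ι → ℂ} {C : ℝ} (hC : 0 ≤ C)
    (hc : ∀ i, ‖c i‖ ≤ C) : ‖diagonal b c‖ ≤ C := by
  refine ContinuousLinearMap.opNorm_le_bound _ hC fun x => ?_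
  refine le_of_sq_le_sq ?_ (by positivity)
  rw [mul_pow]
  have h1 := norm_sq_eq_tsum_repr b (diagonal b c x)
  have h2 := (norm_sq_eq_tsum_repr b x).mul_left (C ^ 2)
  refine hasSum_le (fun i => ?_) h1 h2
  rw [diagonal_repr b hC hc, norm_mul, mul_pow]
  gcongr
  exact hc i

theorem ext_repr (b : HilbertBasis ι ℂ E) {A B : E →L[ℂ] E}
    (h : ∀ x i, b.repr (A x) i = b.repr (B x) i) : A = B := by
  ext x
  refine b.repr.injective ?_
  ext i
  exact h x i

theorem inner_eq_inner_of_repr (b : HilbertBasis ι ℂ E) {x y x' y' : E}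
    (h : ∀ i, inner ℂ (b.repr x i) (b.repr y i) = inner ℂ (b.repr x' i) (b.repr y' i)) :
    inner ℂ x y = inner ℂ x' y' := by
  rw [← b.repr.inner_map_map x y, ← b.repr.inner_map_map x' y', lp.inner_eq_tsum, lp.inner_eq_tsum]
  exact tsum_congr h

/-- Norm limit of finite-rank truncations: outside the finite set `s n` the coefficients are at most
`1 / (n + 1)`, and the norm of a diagonal operator is controlled by the supremum of its
coefficients. -/
theorem isCompactOperator_diagonal [CompleteSpace E] (b : HilbertBasis ι ℂ E) {c : ι → ℂ}
    (hc : Filter.Tendsto c Filter.cofinite (nhds 0)) {C : ℝ} (hC : 0 ≤ C) (hcC : ∀ i, ‖c i‖ ≤ C) :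
    IsCompactOperator (diagonal b c) := by
  classical
  have key : ∀ n : ℕ, ∃ s : Finset ι, ∀ i ∉ s, ‖c i‖ ≤ 1 / ((n : ℝ) + 1) := fun n => by
    have h : ∀ᶠ i in Filter.cofinite, ‖c i‖ < 1 / ((n : ℝ) + 1) := by
      have := hc.norm
      rw [norm_zero] at this
      exact this.eventually (gt_mem_nhds (by positivity))
    rw [Filter.eventually_cofinite] at h
    refine ⟨h.toFinset, fun i hi => ?_⟩
    rw [Set.Finite.mem_toFinset, Set.mem_ofPred_eq, not_not] at hi
    exact hi.le
  choose s hs using key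
  have hF : ∀ n, IsCompactOperator (∑ i ∈ s n, c i • (innerSL ℂ (b i)).smulRight (b i) : E →L[ℂ] E) :=
    fun n => by
      refine Submodule.sum_mem (compactOperator (RingHom.id ℂ) E E) fun i _ => ?_
      refine Submodule.smul_mem _ _ ?_
      have h : IsCompactOperator (ContinuousLinearMap.toSpanSingleton ℂ (b i)) :=
        isCompactOperator_of_locallyCompactSpace_rng _
      exact h.comp_clm (innerSL ℂ (b i))
  refine isCompactOperator_of_tendsto (l := Filter.atTop)
    (F := fun n : ℕ => (∑ i ∈ s n, c i • (innerSL ℂ (b i)).smulRight (b i) : E →L[ℂ] E)) ?_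
    (Filter.Eventually.of_forall hF)
  rw [tendsto_iff_norm_sub_tendsto_zero]
  refine squeeze_zero (fun _ => norm_nonneg _) (fun n => ?_) tendsto_one_div_add_atTop_nhds_zero_nat
  have hb : ∀ i, ‖(if i ∈ s n then (0 : ℂ) else c i)‖ ≤ 1 / ((n : ℝ) + 1) := fun i => by
    split_ifs with h
    · simp; positivity
    · exact hs n i h
  rw [norm_sub_rev]
  convert! norm_diagonal_le b (by positivity) hb using 2
  refine ext_repr b fun x i => ?_
  rw [diagonal_repr b (by positivity) hb]
  have h3 : b.repr ((∑ i ∈ s n, c i • (innerSL ℂ (b i)).smulRight (b i) : E →L[ℂ] E) x) i =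
      if i ∈ s n then c i * b.repr x i else 0 := by
    simp only [_root_.sum_apply, _root_.smul_apply,
      ContinuousLinearMap.smulRight_apply, innerSL_apply_apply, ← b.repr_apply_apply, map_sum, map_smul]
    simp only [lp.coeFn_sum, Finset.sum_apply, lp.coeFn_smul, Pi.smul_apply, b.repr_self]
    simp [lp.single_apply, Pi.single_apply]
  rw [_root_.sub_apply, map_sub, lp.coeFn_sub, Pi.sub_apply, h3,
    diagonal_repr b hC hcC]
  split_ifs <;> simp

end Diagonal

/-! ### Quasi-periodic trigonometric polynomials and their norms. -/

section TrigPoly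

variable (a : Module.Basis (Fin 2) ℝ Plane)

/-- The quasi-periodic trigonometric polynomial `y ↦ ∑ c_l e^{i (l + k)·y}`. -/
def trigPoly (k : Plane) (s : Finset (dualLattice a)) (c : dualLattice a → ℂ) (y : Plane) : ℂ :=
  ∑ l ∈ s, c l * Complex.exp (Complex.I * (inner ℝ ((l : Plane) + k) y : ℝ))

variable {a}

theorem contDiff_trigPoly (k : Plane) (s : Finset (dualLattice a)) (c : dualLattice a → ℂ) :
    ContDiff ℝ ∞ (trigPoly a k s c) := by
  unfold trigPoly
  refine ContDiff.sum fun l _ => ?_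
  have h : ContDiff ℝ ∞ fun y : Plane => (inner ℝ ((l : Plane) + k) y : ℝ) :=
    contDiff_const.inner ℝ contDiff_id
  have h2 : ContDiff ℝ ∞ fun y : Plane => ((inner ℝ ((l : Plane) + k) y : ℝ) : ℂ) :=
    Complex.ofRealCLM.contDiff.comp h
  exact contDiff_const.mul (contDiff_const.mul h2).cexp

theorem fderiv_trigPoly (k : Plane) (s : Finset (dualLattice a)) (c : dualLattice a → ℂ)
    (y v : Plane) : fderiv ℝ (trigPoly a k s c) y v =
      trigPoly a k s (fun l => Complex.I * (inner ℝ ((l : Plane) + k) v : ℝ) * c l) y := by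
  have key : ∀ l : dualLattice a, HasFDerivAt (fun y : Plane =>
      c l * Complex.exp (Complex.I * (inner ℝ ((l : Plane) + k) y : ℝ)))
      (c l • (Complex.exp (Complex.I * (inner ℝ ((l : Plane) + k) y : ℝ)) • (Complex.I •
        (Complex.ofRealCLM.comp (innerSL ℝ ((l : Plane) + k)))))) y := fun l => by
    have h1 : HasFDerivAt (fun y : Plane => ((inner ℝ ((l : Plane) + k) y : ℝ) : ℂ))
        (Complex.ofRealCLM.comp (innerSL ℝ ((l : Plane) + k))) y :=
      (Complex.ofRealCLM.comp (innerSL ℝ ((l : Plane) + k))).hasFDerivAt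
    exact ((h1.const_mul Complex.I).cexp).const_mul (c l)
  have h := HasFDerivAt.fun_sum (u := s) fun l _ => key l
  have h2 : trigPoly a k s c = fun y => ∑ l ∈ s,
      c l * Complex.exp (Complex.I * (inner ℝ ((l : Plane) + k) y : ℝ)) := rfl
  rw [h2, h.fderiv, _root_.sum_apply, trigPoly]
  refine Finset.sum_congr rfl fun l _ => ?_
  simp [inner_add_left]
  ring

/-- Since `e^{i l·g} = 1` for dual lattice vectors `l`, a lattice translation only multiplies by the
phase `e^{i k·g}`. Periodicity of the modulus is what allows norms over bounded sets to be compared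
with norms over the cell. -/
theorem norm_trigPoly_add_lattice (k : Plane) (s : Finset (dualLattice a)) (c : dualLattice a → ℂ)
    {g : Plane} (hg : g ∈ Submodule.span ℤ (Set.range a)) (y : Plane) :
    ‖trigPoly a k s c (g + y)‖ = ‖trigPoly a k s c y‖ := by
  have hlg : ∀ l : dualLattice a, Complex.exp (Complex.I * (inner ℝ (l : Plane) g : ℝ)) = 1 := by
    intro l
    obtain ⟨n, rfl⟩ := (Submodule.mem_span_range_iff_exists_fun ℤ).1 hg
    choose p hp using l.2
    rw [Complex.exp_eq_one_iff]
    refine ⟨∑ j, n j * p j, ?_⟩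
    simp only [inner_sum, inner_smul_right_eq_smul, hp]
    push_cast
    rw [Finset.mul_sum, Finset.sum_mul]
    refine Finset.sum_congr rfl fun j _ => ?_
    simp
    ring
  have : trigPoly a k s c (g + y) =
      Complex.exp (Complex.I * (inner ℝ k g : ℝ)) * trigPoly a k s c y := by
    simp only [trigPoly, Finset.mul_sum]
    refine Finset.sum_congr rfl fun l _ => ?_
    have h : (Complex.I * (inner ℝ ((l : Plane) + k) (g + y) : ℝ) : ℂ) =
        Complex.I * (inner ℝ (l : Plane) g : ℝ) + Complex.I * (inner ℝ k g : ℝ) +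
          Complex.I * (inner ℝ ((l : Plane) + k) y : ℝ) := by
      simp only [inner_add_left, inner_add_right]
      push_cast
      ring
    rw [h, Complex.exp_add, Complex.exp_add, hlg]
    ring
  rw [this, norm_mul, mul_comm Complex.I, Complex.norm_exp_ofReal_mul_I, one_mul]

theorem norm_trigPoly_ae (k : Plane) (s : Finset (dualLattice a)) (c : dualLattice a → ℂ) :
    ∀ᵐ y ∂(volume.restrict (cell a)), ‖trigPoly a k s c y‖ =
      ‖(∑ l ∈ s, c l • planeWave a l : Fibre a) y‖ := by
  have h1 : ∀ᵐ y ∂(volume.restrict (cell a)), ∀ l ∈ s, planeWave a l y =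
      Complex.exp (Complex.I * (inner ℝ (l : Plane) y : ℝ)) :=
    (ae_ball_iff s.countable_toSet).2 fun l _ => (memLp_planeWave a l).coeFn_toLp
  have h2 : ∀ᵐ y ∂(volume.restrict (cell a)), (∑ l ∈ s, c l • planeWave a l : Fibre a) y =
      ∑ l ∈ s, c l * planeWave a l y := by
    clear h1
    classical
    induction s using Finset.induction_on with
    | empty =>
      filter_upwards [Lp.coeFn_zero ℂ 2 (volume.restrict (cell a))] with y hy
      simpa using hy
    | insert l t hl ih =>
      rw [Finset.sum_insert hl]
      filter_upwards [ih, Lp.coeFn_add (c l • planeWave a l) (∑ l ∈ t, c l • planeWave a l : Fibre a),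
        Lp.coeFn_smul (c l) (planeWave a l)] with y e1 e2 e3
      rw [e2, Finset.sum_insert hl, Pi.add_apply, e1, e3, Pi.smul_apply, smul_eq_mul]
  filter_upwards [h1, h2] with y e1 e2
  rw [e2]
  have : trigPoly a k s c y = Complex.exp (Complex.I * (inner ℝ k y : ℝ)) *
      ∑ l ∈ s, c l * planeWave a l y := by
    rw [trigPoly, Finset.mul_sum]
    refine Finset.sum_congr rfl fun l hl => ?_
    rw [e1 l hl, inner_add_left]
    push_cast
    rw [mul_add, Complex.exp_add]
    ring
  rw [this, norm_mul, mul_comm Complex.I, Complex.norm_exp_ofReal_mul_I, one_mul]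

theorem eLpNorm_trigPoly_cell (k : Plane) (s : Finset (dualLattice a)) (c : dualLattice a → ℂ) :
    eLpNorm (trigPoly a k s c) 2 (volume.restrict (cell a)) =
      ENNReal.ofReal ‖∑ l ∈ s, c l • planeWave a l‖ := by
  rw [ofReal_norm, Lp.enorm_def]
  exact eLpNorm_congr_norm_ae (norm_trigPoly_ae k s c)

theorem norm_sum_planeWave (s : Finset (dualLattice a)) (c : dualLattice a → ℂ) :
    ‖∑ l ∈ s, c l • planeWave a l‖ ^ 2 = cellArea a * ∑ l ∈ s, ‖c l‖ ^ 2 := by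
  have h' : (Real.sqrt (cellArea a) : ℂ) ≠ 0 := by
    exact_mod_cast (Real.sqrt_pos.2 (cellArea_pos a)).ne'
  have h : ∑ l ∈ s, c l • planeWave a l =
      (Real.sqrt (cellArea a) : ℂ) • ∑ l ∈ s, c l • fourierBasis a l := by
    rw [Finset.smul_sum]
    refine Finset.sum_congr rfl fun l _ => ?_
    rw [fourierBasis_apply, smul_comm (c l), smul_smul, mul_inv_cancel₀ h', one_smul]
  rw [h, norm_smul, mul_pow]
  congr 1
  · simp [Real.sq_sqrt (cellArea_pos a).le]
  · have := (fourierBasis a).orthonormal.inner_sum c c s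
    have h2 : ((‖∑ l ∈ s, c l • fourierBasis a l‖ ^ 2 : ℝ) : ℂ) = ((∑ l ∈ s, ‖c l‖ ^ 2 : ℝ) : ℂ) := by
      push_cast
      refine (inner_self_eq_norm_sq_to_K (𝕜 := ℂ) (∑ l ∈ s, c l • fourierBasis a l)).symm.trans ?_
      rw [this]
      refine Finset.sum_congr rfl fun l _ => ?_
      rw [mul_comm, Complex.mul_conj']
    exact_mod_cast h2

theorem norm_sum_planeWave_mono (s : Finset (dualLattice a)) {c c' : dualLattice a → ℂ}
    (h : ∀ l, ‖c l‖ ≤ ‖c' l‖) :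
    ‖∑ l ∈ s, c l • planeWave a l‖ ≤ ‖∑ l ∈ s, c' l • planeWave a l‖ := by
  refine le_of_sq_le_sq ?_ (norm_nonneg _)
  rw [norm_sum_planeWave, norm_sum_planeWave]
  have := (cellArea_pos a).le
  gcongr with l
  exact h l

open scoped Pointwise in
/-- The `L²` norm over a bounded set is controlled by the `L²` norm over the unit cell, for functions
of periodic modulus. -/
theorem exists_eLpNorm_restrict_le (a : Module.Basis (Fin 2) ℝ Plane) {B : Set Plane}
    (hB : Bornology.IsBounded B) :
    ∃ N : ℕ, ∀ f : Plane → ℂ, (∀ g ∈ Submodule.span ℤ (Set.range a), ∀ y, ‖f (g + y)‖ = ‖f y‖) →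
      eLpNorm f 2 (volume.restrict B) ≤ N * eLpNorm f 2 (volume.restrict (cell a)) := by
  -- A bounded set meets only finitely many lattice translates of the cell; their number is the
  -- constant.
  have hfin : ({g : Plane | g ∈ Submodule.span ℤ (Set.range a) ∧ ∃ y ∈ cell a, g + y ∈ B}).Finite := by
    have hb : Bornology.IsBounded (B - cell a) :=
      hB.sub (ZSpan.fundamentalDomain_isBounded a)
    refine (ZSpan.setFinite_inter a hb).subset ?_
    rintro g ⟨hg, y, hy, hgy⟩
    exact ⟨⟨g + y, hgy, y, hy, by simp⟩, hg⟩
  set F := hfin.toFinset with hF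
  refine ⟨F.card, fun f hf => ?_⟩
  have hcov : B ⊆ ⋃ g ∈ F, (fun y => -g + y) ⁻¹' (cell a) := by
    intro x hx
    simp only [Set.mem_iUnion]
    have h1 : -(ZSpan.floor a x : Plane) + x ∈ cell a := by
      have := ZSpan.fract_mem_fundamentalDomain a x
      rwa [ZSpan.fract_apply, sub_eq_neg_add] at this
    refine ⟨ZSpan.floor a x, ?_, h1⟩
    rw [hF, Set.Finite.mem_toFinset]
    exact ⟨(ZSpan.floor a x).2, _, h1, by simpa using hx⟩
  have hsq : ∀ μ : Measure Plane, eLpNorm f 2 μ = (∫⁻ y, ‖f y‖ₑ ^ (2 : ℝ) ∂μ) ^ (1 / 2 : ℝ) :=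
    fun μ => by
      rw [eLpNorm_eq_lintegral_rpow_enorm_toReal (by norm_num) (by norm_num)]
      norm_num
  have hint : ∫⁻ y in B, ‖f y‖ₑ ^ (2 : ℝ) ≤ F.card * ∫⁻ y in cell a, ‖f y‖ₑ ^ (2 : ℝ) := by
    calc ∫⁻ y in B, ‖f y‖ₑ ^ (2 : ℝ)
        ≤ ∫⁻ y in ⋃ g ∈ F, (fun y => -g + y) ⁻¹' (cell a), ‖f y‖ₑ ^ (2 : ℝ) :=
          lintegral_mono_set hcov
      _ ≤ ∑ g ∈ F, ∫⁻ y in (fun y => -g + y) ⁻¹' (cell a), ‖f y‖ₑ ^ (2 : ℝ) :=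
by
          have hU : ⋃ g ∈ F, (fun y => -g + y) ⁻¹' (cell a) =
              ⋃ g : F, (fun y => -(g : Plane) + y) ⁻¹' (cell a) := by
            ext y
            simp
          rw [← Finset.tsum_subtype F fun g => ∫⁻ y in (fun y => -g + y) ⁻¹' (cell a),
            ‖f y‖ₑ ^ (2 : ℝ), hU]
          exact lintegral_iUnion_le _ _
      _ = ∑ g ∈ F, ∫⁻ y in cell a, ‖f y‖ₑ ^ (2 : ℝ) := by
          refine Finset.sum_congr rfl fun g hg => ?_
          rw [hF, Set.Finite.mem_toFinset] at hg
          have h2 := (measurePreserving_add_left (volume : Measure Plane) (-g)).setLIntegral_comp_preimage_emb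
            (MeasurableEquiv.addLeft (-g)).measurableEmbedding (fun y => ‖f y‖ₑ ^ (2 : ℝ)) (cell a)
          rw [← h2]
          refine lintegral_congr fun y => ?_
          have := hf (-g) (neg_mem hg.1) y
          rw [← ofReal_norm, ← this, ofReal_norm]
      _ = F.card * ∫⁻ y in cell a, ‖f y‖ₑ ^ (2 : ℝ) := by simp
  rw [hsq, hsq]
  calc (∫⁻ y in B, ‖f y‖ₑ ^ (2 : ℝ)) ^ (1 / 2 : ℝ)
      ≤ (F.card * ∫⁻ y in cell a, ‖f y‖ₑ ^ (2 : ℝ)) ^ (1 / 2 : ℝ) := by gcongr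
    _ = (F.card : ℝ≥0∞) ^ (1 / 2 : ℝ) * (∫⁻ y in cell a, ‖f y‖ₑ ^ (2 : ℝ)) ^ (1 / 2 : ℝ) :=
        ENNReal.mul_rpow_of_nonneg _ _ (by norm_num)
    _ ≤ _ := by
        gcongr
        rcases Nat.eq_zero_or_pos F.card with h0 | h0
        · simp [h0]
        · calc (F.card : ℝ≥0∞) ^ (1 / 2 : ℝ) ≤ (F.card : ℝ≥0∞) ^ (1 : ℝ) :=
              ENNReal.rpow_le_rpow_of_exponent_le (by exact_mod_cast h0) (by norm_num)
            _ = _ := by simp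

end TrigPoly

/-! ### From `Δ`-boundedness on the plane to a bound on the cell. -/

section PotentialBound

theorem laplacian_eq_sum_fderiv {F : Type*} [NormedAddCommGroup F] [NormedSpace ℝ F]
    {f : Plane → F} (hf : ContDiff ℝ 2 f) (x : Plane) :
    Laplacian.laplacian f x = ∑ j, fderiv ℝ (fun y => fderiv ℝ f y (EuclideanSpace.single j 1)) x
      (EuclideanSpace.single j 1) := by
  rw [InnerProductSpace.laplacian_eq_iteratedFDeriv_orthonormalBasis f
    (EuclideanSpace.basisFun (Fin 2) ℝ)]
  refine Finset.sum_congr rfl fun j _ => ?_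
  have hd : DifferentiableAt ℝ (fderiv ℝ f) x :=
    ((hf.fderiv_right (m := 1) (by norm_num)).differentiable (by norm_num)) x
  rw [iteratedFDeriv_two_apply, fderiv_clm_apply hd (differentiableAt_const _)]
  simp

theorem isWeakLaplacian_laplacian {w : Plane → ℂ} (hw : ContDiff ℝ ∞ w) (hc : HasCompactSupport w) :
    IsWeakLaplacian w (Laplacian.laplacian w) := by
  intro φ hφ hφc
  let ψ : SchwartzMap Plane ℝ := hφc.toSchwartzMap hφ
  let W : SchwartzMap Plane ℂ := hc.toSchwartzMap hw
  have h := SchwartzMap.integral_smul_laplacian_right_eq_left (μ := volume) ψ W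
  simp only [SchwartzMap.laplacian_apply] at h
  exact h.symm

/-- The derivative of `f` in the direction `v`. -/
def dirDeriv {F : Type*} [NormedAddCommGroup F] [NormedSpace ℝ F] (v : Plane) (f : Plane → F)
    (y : Plane) : F := fderiv ℝ f y v

theorem contDiff_dirDeriv {F : Type*} [NormedAddCommGroup F] [NormedSpace ℝ F] {f : Plane → F}
    (hf : ContDiff ℝ ∞ f) (v : Plane) : ContDiff ℝ ∞ (dirDeriv v f) :=
  (hf.fderiv_right (m := ∞) (by norm_num)).clm_apply contDiff_const

theorem dirDeriv_smul {χ : Plane → ℝ} {p : Plane → ℂ} (hχ : ContDiff ℝ ∞ χ) (hp : ContDiff ℝ ∞ p)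
    (v : Plane) : dirDeriv v (fun y => χ y • p y) =
      fun y => dirDeriv v χ y • p y + χ y • dirDeriv v p y := by
  ext y
  have h1 := (hχ.differentiable (by norm_num)) y
  have h2 := (hp.differentiable (by norm_num)) y
  rw [dirDeriv, fderiv_fun_smul h1 h2]
  simp [dirDeriv, add_comm]

theorem dirDeriv_add {f g : Plane → ℂ} (hf : ContDiff ℝ ∞ f) (hg : ContDiff ℝ ∞ g)
    (v : Plane) : dirDeriv v (fun y => f y + g y) = fun y => dirDeriv v f y + dirDeriv v g y := by
  ext y
  have h1 := (hf.differentiable (by norm_num)) y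
  have h2 := (hg.differentiable (by norm_num)) y
  simp [dirDeriv, fderiv_fun_add h1 h2]

variable {a : Module.Basis (Fin 2) ℝ Plane}

theorem dirDeriv_trigPoly (k : Plane) (s : Finset (dualLattice a)) (c : dualLattice a → ℂ)
    (v : Plane) : dirDeriv v (trigPoly a k s c) =
      trigPoly a k s (fun l => Complex.I * (inner ℝ ((l : Plane) + k) v : ℝ) * c l) := by
  ext y
  exact fderiv_trigPoly k s c y v

theorem eLpNorm_smul_le_of_tsupport {g : Plane → ℝ} {q : Plane → ℂ} {B : Set Plane} {C : ℝ}
    (hB : MeasurableSet B) (hg : Function.support g ⊆ B) (hC : ∀ y, ‖g y‖ ≤ C) :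
    eLpNorm (fun y => g y • q y) 2 volume ≤
      ENNReal.ofReal C * eLpNorm q 2 (volume.restrict B) := by
  rw [← eLpNorm_indicator_eq_eLpNorm_restrict hB, ← Real.enorm_eq_ofReal
    ((norm_nonneg _).trans (hC 0)), ← eLpNorm_const_smul]
  refine eLpNorm_mono fun y => ?_
  by_cases hy : y ∈ B
  · simp only [Pi.smul_apply, Set.indicator_of_mem hy, norm_smul]
    gcongr
    exact (hC y).trans (le_abs_self C)
  · have : g y = 0 := by
      by_contra h
      exact hy (hg h)
    rw [this, zero_smul, norm_zero]
    exact norm_nonneg _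

/-- Bloch functions are not in `L²(ℝ²)`, so the hypothesis is applied to `f p`, with `f` a cutoff
equal to `1` on the cell. The product rule produces derivatives of `p` of order at most two, whose
symbols are dominated by `1 + |l + k|²`. No constant depends on `k`, because `f` and the number of
translates meeting its support do not. -/
theorem potential_bound {V : Plane → ℝ} (hV : IsLaplacianBoundedZero V) {α : ℝ} (hα : 0 < α) :
    ∃ β : ℝ, 0 ≤ β ∧ ∀ (k : Plane) (s : Finset (dualLattice a)) (c : dualLattice a → ℂ),
      eLpNorm (fun y => V y • trigPoly a k s c y) 2 (volume.restrict (cell a)) ≤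
        ENNReal.ofReal (α * ‖∑ l ∈ s, (((1 + ‖(l : Plane) + k‖ ^ 2 : ℝ) : ℂ) * c l) • planeWave a l‖ +
          β * ‖∑ l ∈ s, c l • planeWave a l‖) := by
  obtain ⟨R, hR0, hR⟩ := (ZSpan.fundamentalDomain_isBounded a).subset_closedBall_lt 0 0
  let f : ContDiffBump (0 : Plane) := ⟨R, R + 1, hR0, by linarith⟩
  have hχ : ContDiff ℝ ∞ f := f.contDiff
  have hχc : HasCompactSupport f := f.hasCompactSupport
  set B := tsupport f with hBdef
  have hBm : MeasurableSet B := (isClosed_tsupport _).measurableSet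
  obtain ⟨N, hN⟩ := exists_eLpNorm_restrict_le a (B := B) hχc.isCompact.isBounded
  have hsub : ∀ (g : Plane → ℝ) (v : Plane), tsupport (dirDeriv v g) ⊆ tsupport g :=
    fun g v => tsupport_fderiv_apply_subset ℝ v
  have hbound : ∀ g : Plane → ℝ, ContDiff ℝ ∞ g → tsupport g ⊆ B →
      ∃ C : ℝ, 0 ≤ C ∧ ∀ y, ‖g y‖ ≤ C := fun g hg hgB => by
    obtain ⟨C, hC⟩ := (hχc.isCompact.of_isClosed_subset (isClosed_tsupport _)
      hgB).exists_bound_of_continuousOn hg.continuous.continuousOn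
    refine ⟨|C|, abs_nonneg _, fun y => ?_⟩
    by_cases hy : y ∈ tsupport g
    · exact (hC y hy).trans (le_abs_self C)
    · rw [image_eq_zero_of_notMem_tsupport hy, norm_zero]
      exact abs_nonneg C
  set e : Fin 2 → Plane := fun j => EuclideanSpace.single j 1 with he
  have hχ1 : ∀ j, ContDiff ℝ ∞ (dirDeriv (e j) f) := fun j => contDiff_dirDeriv hχ _
  have hχ2 : ∀ j, ContDiff ℝ ∞ (dirDeriv (e j) (dirDeriv (e j) f)) :=
    fun j => contDiff_dirDeriv (hχ1 j) _
  obtain ⟨C0, hC0, hC0'⟩ := hbound f hχ subset_rfl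
  choose C1 hC1 hC1' using fun j => hbound _ (hχ1 j) (hsub _ _)
  choose C2 hC2 hC2' using fun j => hbound _ (hχ2 j) ((hsub _ _).trans (hsub _ _))
  set C := C0 + ∑ j, C1 j + ∑ j, C2 j with hCdef
  have hs1 : ∀ j, C1 j ≤ ∑ j, C1 j := fun j =>
    Finset.single_le_sum (fun i _ => hC1 i) (Finset.mem_univ j)
  have hs2 : ∀ j, C2 j ≤ ∑ j, C2 j := fun j =>
    Finset.single_le_sum (fun i _ => hC2 i) (Finset.mem_univ j)
  have hp1 : 0 ≤ ∑ j, C1 j := Finset.sum_nonneg fun i _ => hC1 i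
  have hp2 : 0 ≤ ∑ j, C2 j := Finset.sum_nonneg fun i _ => hC2 i
  have hCnn : 0 ≤ C := by positivity
  have hCN : 0 ≤ C * N := by positivity
  -- The Laplacian of `f p` is a sum of eight terms, four for each coordinate, each bounded by `C *
  -- N * D`. Hence the factor `8`; the summand `1` keeps the denominator positive.
  set α' : ℝ≥0 := Real.toNNReal (α / (8 * (C * N) + 1)) with hα'
  have hα'' : (α' : ℝ) = α / (8 * (C * N) + 1) := Real.coe_toNNReal _ (by positivity)
  obtain ⟨β, hβ⟩ := hV α' (by rw [← NNReal.coe_pos, hα'']; positivity)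
  refine ⟨β * (C * N), by positivity, fun k s c => ?_⟩
  set c2 : dualLattice a → ℂ := fun l => ((1 + ‖(l : Plane) + k‖ ^ 2 : ℝ) : ℂ) * c l with hc2
  have hterm : ∀ (g : Plane → ℝ) (c' c'' : dualLattice a → ℂ), tsupport g ⊆ B → (∀ y, ‖g y‖ ≤ C) →
      (∀ l, ‖c' l‖ ≤ ‖c'' l‖) → eLpNorm (fun y => g y • trigPoly a k s c' y) 2 volume ≤
        ENNReal.ofReal (C * N * ‖∑ l ∈ s, c'' l • planeWave a l‖) := by
    intro g c' c'' hg hgC hc'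
    refine (eLpNorm_smul_le_of_tsupport hBm ((subset_tsupport g).trans hg) hgC).trans ?_
    rw [ENNReal.ofReal_mul hCN, ENNReal.ofReal_mul hCnn, ENNReal.ofReal_natCast, mul_assoc]
    gcongr
    refine (hN _ fun z hz y => norm_trigPoly_add_lattice k s c' hz y).trans ?_
    rw [eLpNorm_trigPoly_cell]
    gcongr
    exact norm_sum_planeWave_mono s hc'
  set w : Plane → ℂ := fun y => f y • trigPoly a k s c y with hw
  have hp := contDiff_trigPoly (a := a) k s c
  have hwC : ContDiff ℝ ∞ w := hχ.smul hp
  have hwc : HasCompactSupport w := hχc.smul_right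
  have hξ : ∀ (l : dualLattice a) j, |inner ℝ ((l : Plane) + k) (e j)| ≤ ‖(l : Plane) + k‖ :=
    fun l j => by
      have := abs_real_inner_le_norm ((l : Plane) + k) (e j)
      simpa [he] using this
  set cd : Fin 2 → dualLattice a → ℂ :=
    fun j l => Complex.I * (inner ℝ ((l : Plane) + k) (e j) : ℝ) * c l with hcd
  set cdd : Fin 2 → dualLattice a → ℂ :=
    fun j l => Complex.I * (inner ℝ ((l : Plane) + k) (e j) : ℝ) * cd j l with hcdd
  have hn2 : ∀ l, ‖c2 l‖ = (1 + ‖(l : Plane) + k‖ ^ 2) * ‖c l‖ := fun l => by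
    rw [hc2, norm_mul, Complex.norm_real, Real.norm_of_nonneg (by positivity)]
  have hb0 : ∀ l, ‖c l‖ ≤ ‖c2 l‖ := fun l => by
    rw [hn2]
    nlinarith [norm_nonneg (c l), sq_nonneg ‖(l : Plane) + k‖,
      mul_nonneg (sq_nonneg ‖(l : Plane) + k‖) (norm_nonneg (c l))]
  have hb1 : ∀ j l, ‖cd j l‖ ≤ ‖c2 l‖ := fun j l => by
    rw [hn2, hcd]
    simp only [norm_mul, Complex.norm_I, Complex.norm_real, one_mul, Real.norm_eq_abs]
    refine mul_le_mul_of_nonneg_right ((hξ l j).trans ?_) (norm_nonneg _)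
    nlinarith [sq_nonneg (‖(l : Plane) + k‖ - 1)]
  have hb2 : ∀ j l, ‖cdd j l‖ ≤ ‖c2 l‖ := fun j l => by
    rw [hn2, hcdd, hcd]
    simp only [norm_mul, Complex.norm_I, Complex.norm_real, one_mul, Real.norm_eq_abs, ← mul_assoc]
    refine mul_le_mul_of_nonneg_right ?_ (norm_nonneg _)
    have := hξ l j
    have h0 := abs_nonneg (inner ℝ ((l : Plane) + k) (e j))
    nlinarith
  have hlap : Laplacian.laplacian w = fun y => ∑ j, ((dirDeriv (e j) (dirDeriv (e j) f) y •
      trigPoly a k s c y + dirDeriv (e j) f y • trigPoly a k s (cd j) y) +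
      (dirDeriv (e j) f y • trigPoly a k s (cd j) y + f y • trigPoly a k s (cdd j) y)) := by
    ext y
    rw [laplacian_eq_sum_fderiv (hwC.of_le (by norm_cast))]
    refine Finset.sum_congr rfl fun j _ => ?_
    change dirDeriv (e j) (dirDeriv (e j) w) y = _
    rw [hw, dirDeriv_smul hχ hp, dirDeriv_trigPoly, dirDeriv_add (f := fun y => dirDeriv (e j) f y • trigPoly a k s c y)
      (g := fun y => f y • trigPoly a k s (cd j) y) ((hχ1 j).smul hp)
      (hχ.smul (contDiff_trigPoly _ _ _)), dirDeriv_smul (hχ1 j) hp,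
      dirDeriv_smul hχ (contDiff_trigPoly _ _ _), dirDeriv_trigPoly, dirDeriv_trigPoly]
  set D := ‖∑ l ∈ s, c2 l • planeWave a l‖ with hD
  have hlapN : eLpNorm (Laplacian.laplacian w) 2 volume ≤ ENNReal.ofReal (8 * (C * N) * D) := by
    have hm : ∀ {g : Plane → ℝ} {c'}, ContDiff ℝ ∞ g →
        AEStronglyMeasurable (fun y => g y • trigPoly a k s c' y) volume := fun hg =>
      (hg.continuous.smul (contDiff_trigPoly _ _ _).continuous).aestronglyMeasurable
    have hj : ∀ j, eLpNorm (fun y => ((dirDeriv (e j) (dirDeriv (e j) f) y •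
      trigPoly a k s c y + dirDeriv (e j) f y • trigPoly a k s (cd j) y) +
      (dirDeriv (e j) f y • trigPoly a k s (cd j) y + f y • trigPoly a k s (cdd j) y))) 2 volume ≤
        ENNReal.ofReal (4 * (C * N * D)) := fun j => by
      have t1 := hterm _ c c2 ((hsub _ _).trans (hsub _ _))
        (fun y => (hC2' j y).trans (by linarith [hs2 j])) hb0
      have t2 := hterm _ (cd j) c2 (hsub _ _)
        (fun y => (hC1' j y).trans (by linarith [hs1 j])) (hb1 j)
      have t3 := hterm f (cdd j) c2 subset_rfl (fun y => (hC0' y).trans (by linarith)) (hb2 j)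
      refine (eLpNorm_add_le ((hm (hχ2 j)).add (hm (hχ1 j))) ((hm (hχ1 j)).add (hm hχ))
        (by norm_num)).trans ?_
      refine (add_le_add (eLpNorm_add_le (hm (hχ2 j)) (hm (hχ1 j)) (by norm_num))
        (eLpNorm_add_le (hm (hχ1 j)) (hm hχ) (by norm_num))).trans ?_
      refine (add_le_add (add_le_add t1 t2) (add_le_add t2 t3)).trans ?_
      rw [← ENNReal.ofReal_add (by positivity) (by positivity),
        ← ENNReal.ofReal_add (by positivity) (by positivity)]
      exact ENNReal.ofReal_le_ofReal (by linarith)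
    rw [hlap]
    simp only [Fin.sum_univ_two]
    refine (eLpNorm_add_le (((hm (hχ2 0)).add (hm (hχ1 0))).add ((hm (hχ1 0)).add (hm hχ)))
      (((hm (hχ2 1)).add (hm (hχ1 1))).add ((hm (hχ1 1)).add (hm hχ))) (by norm_num)).trans ?_
    refine (add_le_add (hj 0) (hj 1)).trans ?_
    rw [← ENNReal.ofReal_add (by positivity) (by positivity)]
    exact ENNReal.ofReal_le_ofReal (by linarith)
  have hwN : eLpNorm w 2 volume ≤ ENNReal.ofReal (C * N * ‖∑ l ∈ s, c l • planeWave a l‖) :=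
    hterm f c c subset_rfl (fun y => (hC0' y).trans (by linarith)) fun l => le_rfl
  have hΔm : AEStronglyMeasurable (Laplacian.laplacian w) volume := by
    rw [hlap]
    refine Continuous.aestronglyMeasurable (continuous_finsetSum _ fun j _ => ?_)
    have h0 : ∀ c', Continuous (trigPoly a k s c') := fun c' => (contDiff_trigPoly _ _ _).continuous
    exact (((hχ2 j).continuous.smul (h0 _)).add ((hχ1 j).continuous.smul (h0 _))).add
      (((hχ1 j).continuous.smul (h0 _)).add (hχ.continuous.smul (h0 _)))
  have main := (hβ w (Laplacian.laplacian w)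
    ⟨hwC.continuous.aestronglyMeasurable, hwN.trans_lt ENNReal.ofReal_lt_top⟩
    ⟨hΔm, hlapN.trans_lt ENNReal.ofReal_lt_top⟩ (isWeakLaplacian_laplacian hwC hwc)).2
  calc eLpNorm (fun y => V y • trigPoly a k s c y) 2 (volume.restrict (cell a))
      = eLpNorm (fun y => V y • w y) 2 (volume.restrict (cell a)) := by
        refine eLpNorm_congr_ae ?_
        filter_upwards [ae_restrict_mem (ZSpan.fundamentalDomain_measurableSet a)] with y hy
        have : f y = 1 := f.one_of_mem_closedBall (hR hy)
        simp [hw, this]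
    _ ≤ eLpNorm (fun y => V y • w y) 2 volume :=
        eLpNorm_mono_measure _ Measure.restrict_le_self
    _ ≤ _ := main
    _ ≤ ENNReal.ofReal (α' * (8 * (C * N) * D)) +
          ENNReal.ofReal (β * (C * N * ‖∑ l ∈ s, c l • planeWave a l‖)) := by
        rw [ENNReal.ofReal_mul α'.coe_nonneg, ENNReal.ofReal_mul β.coe_nonneg, ENNReal.ofReal_coe_nnreal,
          ENNReal.ofReal_coe_nnreal]
        gcongr
    _ ≤ _ := by
        rw [← ENNReal.ofReal_add (by positivity) (by positivity)]
        refine ENNReal.ofReal_le_ofReal (add_le_add ?_ (by rw [mul_assoc (β : ℝ)]))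
        rw [← mul_assoc]
        gcongr
        rw [hα'', div_mul_eq_mul_div, div_le_iff₀ (by positivity)]
        nlinarith

end PotentialBound

/-! ### The potential relative to the free resolvent. -/

section FreeResolvent

theorem diagonal_apply_basis {ι E : Type*} [NormedAddCommGroup E] [InnerProductSpace ℂ E]
    (b : HilbertBasis ι ℂ E) {c : ι → ℂ} {C : ℝ} (hC : 0 ≤ C) (hc : ∀ i, ‖c i‖ ≤ C) (i : ι) :
    diagonal b c (b i) = c i • b i := by
  classical
  refine b.repr.injective ?_
  ext j
  rw [diagonal_repr b hC hc, map_smul, lp.coeFn_smul, Pi.smul_apply, b.repr_self]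
  by_cases h : j = i
  · subst h; simp
  · simp [h]

variable (a : Module.Basis (Fin 2) ℝ Plane)

/-- The Fourier symbol of `((-i∇ + k)² + μ)⁻¹`. -/
def freeSymbol (μ : ℝ) (k : Plane) (l : dualLattice a) : ℂ := (((‖(l : Plane) + k‖ ^ 2 + μ)⁻¹ : ℝ) : ℂ)

/-- The resolvent `((-i∇ + k)² + μ)⁻¹` of the free fibre operator. -/
def freeResolvent (μ : ℝ) (k : Plane) : Fibre a →L[ℂ] Fibre a :=
  diagonal (fourierBasis a) (freeSymbol a μ k)

variable {a}

theorem norm_freeSymbol {μ : ℝ} (hμ : 0 < μ) (k : Plane) (l : dualLattice a) :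
    ‖freeSymbol a μ k l‖ = (‖(l : Plane) + k‖ ^ 2 + μ)⁻¹ := by
  rw [freeSymbol, Complex.norm_real, Real.norm_of_nonneg (by positivity)]

theorem norm_freeSymbol_le {μ : ℝ} (hμ : 0 < μ) (k : Plane) (l : dualLattice a) :
    ‖freeSymbol a μ k l‖ ≤ μ⁻¹ := by
  rw [norm_freeSymbol hμ]
  gcongr
  nlinarith [sq_nonneg ‖(l : Plane) + k‖]

theorem freeResolvent_repr {μ : ℝ} (hμ : 0 < μ) (k : Plane) (x : Fibre a) (l : dualLattice a) :
    (fourierBasis a).repr (freeResolvent a μ k x) l =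
      freeSymbol a μ k l * (fourierBasis a).repr x l :=
  diagonal_repr _ (inv_nonneg.2 hμ.le) (norm_freeSymbol_le hμ k) x l

theorem sqrt_cellArea_ne_zero : (Real.sqrt (cellArea a) : ℂ) ≠ 0 := by
  exact_mod_cast (Real.sqrt_pos.2 (cellArea_pos a)).ne'

theorem freeResolvent_planeWave {μ : ℝ} (hμ : 0 < μ) (k : Plane) (l : dualLattice a) :
    freeResolvent a μ k (planeWave a l) = freeSymbol a μ k l • planeWave a l := by
  have h : planeWave a l = (Real.sqrt (cellArea a) : ℂ) • fourierBasis a l := by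
    rw [fourierBasis_apply, smul_smul, mul_inv_cancel₀ sqrt_cellArea_ne_zero, one_smul]
  rw [h, map_smul, freeResolvent, diagonal_apply_basis _ (inv_nonneg.2 hμ.le) (norm_freeSymbol_le hμ k),
    smul_comm]

/-- Take relative bound `1/4` and `μ ≥ max 1 (4 β)`. The symbol `(1 + |ξ|²) / (|ξ|² + μ)` is at most
`1`, and the lower-order term contributes at most `β / μ ≤ 1/4`. The total `1/2` makes `1 + V Λ`
invertible by a Neumann series, where `Λ` is the free resolvent. -/
theorem exists_potential_resolvent_bound {V : Plane → ℝ} (hVm : AEMeasurable V volume)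
    (hV : IsLaplacianBoundedZero V) : ∃ μ₀ : ℝ, 1 ≤ μ₀ ∧ ∀ μ, μ₀ ≤ μ → ∀ (k : Plane) (x : Fibre a),
      eLpNorm (fun y => V y • freeResolvent a μ k x y) 2 (volume.restrict (cell a)) ≤
        ENNReal.ofReal (1 / 2 * ‖x‖) := by
  obtain ⟨β, hβ0, hβ⟩ := potential_bound (a := a) hV (show (0 : ℝ) < 1 / 4 by norm_num)
  refine ⟨max 1 (4 * β), le_max_left _ _, fun μ hμ k x => ?_⟩
  have hμ1 : 1 ≤ μ := (le_max_left _ _).trans hμ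
  have hμβ : 4 * β ≤ μ := (le_max_right _ _).trans hμ
  have hμ0 : 0 < μ := by linarith
  have hVs : AEStronglyMeasurable V (volume.restrict (cell a)) :=
    hVm.aestronglyMeasurable.mono_measure Measure.restrict_le_self
  have hspan : ∀ x ∈ Submodule.span ℂ (Set.range (fourierBasis a)),
      eLpNorm (fun y => V y • freeResolvent a μ k x y) 2 (volume.restrict (cell a)) ≤
        ENNReal.ofReal (1 / 2 * ‖x‖) := by
    intro x hx
    obtain ⟨d, hd⟩ := Finsupp.mem_span_range_iff_exists_finsupp.1 hx
    set c : dualLattice a → ℂ := fun l => d l * ((Real.sqrt (cellArea a))⁻¹ : ℝ) with hc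
    have hx' : x = ∑ l ∈ d.support, c l • planeWave a l := by
      rw [← hd, Finsupp.sum]
      refine Finset.sum_congr rfl fun l _ => ?_
      rw [fourierBasis_apply, smul_smul, hc, Complex.ofReal_inv]
    set c' : dualLattice a → ℂ := fun l => freeSymbol a μ k l * c l with hc'
    have hΛ : freeResolvent a μ k x = ∑ l ∈ d.support, c' l • planeWave a l := by
      rw [hx', map_sum]
      refine Finset.sum_congr rfl fun l _ => ?_
      rw [map_smul, freeResolvent_planeWave hμ0, smul_smul, mul_comm]
    have h1 : eLpNorm (fun y => V y • freeResolvent a μ k x y) 2 (volume.restrict (cell a)) =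
        eLpNorm (fun y => V y • trigPoly a k d.support c' y) 2 (volume.restrict (cell a)) := by
      refine eLpNorm_congr_norm_ae ?_
      filter_upwards [norm_trigPoly_ae k d.support c'] with y hy
      rw [norm_smul, norm_smul, hy, hΛ]
    rw [h1]
    refine (hβ k d.support c').trans (ENNReal.ofReal_le_ofReal ?_)
    have e1 : ‖∑ l ∈ d.support, (((1 + ‖(l : Plane) + k‖ ^ 2 : ℝ) : ℂ) * c' l) • planeWave a l‖ ≤ ‖x‖ := by
      rw [hx']
      refine norm_sum_planeWave_mono d.support (c := fun l => ((1 + ‖(l : Plane) + k‖ ^ 2 : ℝ) : ℂ) * c' l)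
        fun l => ?_
      simp only [hc', norm_mul, norm_freeSymbol hμ0, Complex.norm_real]
      rw [Real.norm_of_nonneg (by positivity), ← mul_assoc]
      refine mul_le_of_le_one_left (by positivity) ?_
      rw [← div_eq_mul_inv, div_le_one (by positivity)]
      linarith
    have e2 : ‖∑ l ∈ d.support, c' l • planeWave a l‖ ≤ μ⁻¹ * ‖x‖ := by
      have : ((μ⁻¹ : ℝ) : ℂ) • x = ∑ l ∈ d.support, (((μ⁻¹ : ℝ) : ℂ) * c l) • planeWave a l := by
        rw [hx', Finset.smul_sum]
        simp only [smul_smul]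
      have h3 : μ⁻¹ * ‖x‖ = ‖((μ⁻¹ : ℝ) : ℂ) • x‖ := by
        rw [norm_smul, Complex.norm_real, Real.norm_of_nonneg (by positivity)]
      rw [h3, this]
      refine norm_sum_planeWave_mono d.support (c' := fun l => ((μ⁻¹ : ℝ) : ℂ) * c l) fun l => ?_
      simp only [hc', norm_mul, Complex.norm_real]
      rw [Real.norm_of_nonneg (by positivity)]
      gcongr
      exact norm_freeSymbol_le hμ0 k l
    have e3 : β * (μ⁻¹ * ‖x‖) ≤ 1 / 4 * ‖x‖ := by
      rw [← mul_assoc]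
      gcongr
      rw [← div_eq_mul_inv, div_le_iff₀ hμ0]
      linarith
    have e4 := mul_le_mul_of_nonneg_left e2 hβ0
    linarith
  have hdense : x ∈ closure (Submodule.span ℂ (Set.range (fourierBasis a)) : Set (Fibre a)) := by
    have := (fourierBasis a).dense_span
    rw [← Submodule.topologicalClosure_coe, this]
    trivial
  obtain ⟨z, hz, hzx⟩ := mem_closure_iff_seq_limit.1 hdense
  have hlim : Filter.Tendsto (fun n => freeResolvent a μ k (z n)) Filter.atTop
      (nhds (freeResolvent a μ k x)) := ((freeResolvent a μ k).continuous.tendsto x).comp hzx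
  -- Continuity of multiplication by `V` is not available, so the bound passes from finite sums of
  -- plane waves to all `x` by Fatou's lemma along an almost everywhere convergent subsequence.
  obtain ⟨ns, hns, hae⟩ := (tendstoInMeasure_of_tendsto_Lp hlim).exists_seq_tendsto_ae
  have h2 := Lp.eLpNorm_lim_le_liminf_eLpNorm (p := 2) (μ := volume.restrict (cell a))
    (f := fun n y => V y • freeResolvent a μ k (z (ns n)) y)
    (fun n => hVs.smul (Lp.aestronglyMeasurable _)) (fun y => V y • freeResolvent a μ k x y)
    (by filter_upwards [hae] with y hy using hy.const_smul (V y))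
  refine h2.trans ?_
  have h3 : Filter.Tendsto (fun n => ENNReal.ofReal (1 / 2 * ‖z (ns n)‖)) Filter.atTop
      (nhds (ENNReal.ofReal (1 / 2 * ‖x‖))) :=
    (ENNReal.continuous_ofReal.tendsto _).comp
      (((hzx.comp hns.tendsto_atTop).norm).const_mul (1 / 2))
  rw [← h3.liminf_eq]
  exact Filter.liminf_le_liminf (Filter.Eventually.of_forall fun n => hspan _ (hz (ns n)))

theorem exists_potential_resolvent {V : Plane → ℝ} (hVm : AEMeasurable V volume)
    (hV : IsLaplacianBoundedZero V) : ∃ μ₀ : ℝ, 1 ≤ μ₀ ∧ ∀ μ, μ₀ ≤ μ → ∀ k : Plane,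
      ∃ W : Fibre a →L[ℂ] Fibre a, ‖W‖ ≤ 1 / 2 ∧
        ∀ x, ∀ᵐ y ∂(volume.restrict (cell a)), W x y = V y • freeResolvent a μ k x y := by
  obtain ⟨μ₀, h1, h⟩ := exists_potential_resolvent_bound (a := a) hVm hV
  refine ⟨μ₀, h1, fun μ hμ k => ?_⟩
  have hVs : AEStronglyMeasurable V (volume.restrict (cell a)) :=
    hVm.aestronglyMeasurable.mono_measure Measure.restrict_le_self
  have hm : ∀ x, MemLp (fun y => V y • freeResolvent a μ k x y) 2 (volume.restrict (cell a)) :=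
    fun x => ⟨hVs.smul (Lp.aestronglyMeasurable _), (h μ hμ k x).trans_lt ENNReal.ofReal_lt_top⟩
  refine ⟨LinearMap.mkContinuous ⟨⟨fun x => (hm x).toLp _, fun x x' => ?_⟩, fun r x => ?_⟩ (1 / 2)
    fun x => ?_, LinearMap.mkContinuous_norm_le _ (by norm_num) _, fun x => (hm x).coeFn_toLp⟩
  · rw [← MemLp.toLp_add]
    refine MemLp.toLp_congr _ _ ?_
    rw [map_add]
    filter_upwards [Lp.coeFn_add (freeResolvent a μ k x) (freeResolvent a μ k x')] with y hy
    rw [hy, Pi.add_apply, Pi.add_apply, smul_add]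
  · refine Lp.ext ?_
    rw [RingHom.id_apply]
    filter_upwards [(hm (r • x)).coeFn_toLp, (hm x).coeFn_toLp, Lp.coeFn_smul r ((hm x).toLp _),
      Lp.coeFn_smul r (freeResolvent a μ k x)] with y e1 e2 e3 e4
    refine e1.trans (Eq.trans ?_ e3.symm)
    rw [Pi.smul_apply, e2, map_smul, e4, Pi.smul_apply, smul_comm]
  · change ‖(hm x).toLp _‖ ≤ _
    rw [Lp.norm_toLp]
    exact ENNReal.toReal_le_of_le_ofReal (by positivity) (h μ hμ k x)

end FreeResolvent

/-! ### The smooth resolvent family of the fibre Hamiltonians. -/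

section Resolvent

variable {a : Module.Basis (Fin 2) ℝ Plane}

/-- `T k` is the resolvent `(H(k) + μ)⁻¹`, with `-μ` well below the spectrum of every `H(k)`. -/
structure IsResolventFamily (a : Module.Basis (Fin 2) ℝ Plane) (V : Plane → ℝ) (μ : ℝ)
    (T : Plane → Fibre a →L[ℂ] Fibre a) : Prop where
  contDiff : ContDiff ℝ ∞ T
  compact : ∀ k, IsCompactOperator (T k)
  symm : ∀ k x y, inner ℂ (T k x) y = inner ℂ x (T k y)
  injective : ∀ k, Function.Injective (T k)
  mem_eigenspace_iff : ∀ k e u, u ∈ eigenspace a V k e ↔ u = ((e + μ : ℝ) : ℂ) • T k u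
  eigenspace_eq_bot : ∀ k e, e ≤ 1 - μ → eigenspace a V k e = ⊥

theorem coeff_injective {u v : Fibre a} (h : ∀ l ∈ dualLattice a, coeff a l u = coeff a l v) :
    u = v := by
  rw [← sub_eq_zero]
  refine eq_zero_of_coeff_eq_zero a _ fun l hl => ?_
  rw [coeff, inner_sub_right]
  exact sub_eq_zero.2 (h l hl)

/-- Together with `sq_add_le` this makes the weights `1 + |l|²` and `|l + k|² + μ` equivalent for
fixed `k`, so that the `k`-independent Sobolev space is the range of each free resolvent. -/
theorem one_add_sq_le (k x : Plane) :
    1 + ‖x‖ ^ 2 ≤ (2 + 2 * ‖k‖ ^ 2) * (‖x + k‖ ^ 2 + 1) := by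
  have h : ‖x‖ ≤ ‖x + k‖ + ‖k‖ := by
    have := norm_sub_le (x + k) k
    simpa using this
  have h0 := norm_nonneg x
  have h2 : ‖x‖ ^ 2 ≤ 2 * ‖x + k‖ ^ 2 + 2 * ‖k‖ ^ 2 := by
    nlinarith [sq_nonneg (‖x + k‖ - ‖k‖), norm_nonneg (x + k), norm_nonneg k]
  nlinarith [mul_nonneg (sq_nonneg ‖k‖) (sq_nonneg ‖x + k‖), sq_nonneg ‖x + k‖, sq_nonneg ‖k‖]

theorem sq_add_le {μ : ℝ} (hμ : 0 ≤ μ) (k x : Plane) :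
    ‖x + k‖ ^ 2 + μ ≤ (2 + 2 * ‖k‖ ^ 2 + μ) * (1 + ‖x‖ ^ 2) := by
  have h : ‖x + k‖ ≤ ‖x‖ + ‖k‖ := norm_add_le x k
  have h0 := norm_nonneg (x + k)
  have h2 : ‖x + k‖ ^ 2 ≤ 2 * ‖x‖ ^ 2 + 2 * ‖k‖ ^ 2 := by
    nlinarith [sq_nonneg (‖x‖ - ‖k‖), norm_nonneg x, norm_nonneg k]
  nlinarith [mul_nonneg (sq_nonneg ‖k‖) (sq_nonneg ‖x‖), sq_nonneg ‖x‖, sq_nonneg ‖k‖,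
    mul_nonneg hμ (sq_nonneg ‖x‖)]

theorem mem_sobolevTwo_iff (u : Fibre a) : u ∈ sobolevTwo a ↔
    Summable fun l : dualLattice a => ((1 + ‖(l : Plane)‖ ^ 2) * ‖(fourierBasis a).repr u l‖) ^ 2 := by
  have h : ∀ l : dualLattice a, ((1 + ‖(l : Plane)‖ ^ 2) * ‖coeff a l u‖) ^ 2 =
      cellArea a * ((1 + ‖(l : Plane)‖ ^ 2) * ‖(fourierBasis a).repr u l‖) ^ 2 := fun l => by
    rw [coeff_eq_repr, norm_mul, Complex.norm_real, Real.norm_of_nonneg (Real.sqrt_nonneg _),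
      mul_left_comm, mul_pow, Real.sq_sqrt (cellArea_pos a).le]
  change (Summable fun l : dualLattice a => ((1 + ‖(l : Plane)‖ ^ 2) * ‖coeff a l u‖) ^ 2) ↔ _
  simp_rw [h]
  exact summable_mul_left_iff (cellArea_pos a).ne'

/-- Substituting `u = Λ g`, with `Λ` the free resolvent, turns `(H(k) + μ) u` into `g + V Λ g = (1 +
W) g`. Thus the unbounded operator is described by bounded ones, and its resolvent must be `Λ (1 +
W)⁻¹`. -/
theorem mem_fibreHamiltonian_iff {V : Plane → ℝ} {μ : ℝ} (hμ : 1 ≤ μ) {k : Plane}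
    {W : Fibre a →L[ℂ] Fibre a}
    (hW : ∀ x, ∀ᵐ y ∂(volume.restrict (cell a)), W x y = V y • freeResolvent a μ k x y)
    (p : Fibre a × Fibre a) : p ∈ fibreHamiltonian a V k ↔
      ∃ g, p.1 = freeResolvent a μ k g ∧ p.2 + (μ : ℂ) • p.1 = g + W g := by
  have hμ0 : 0 < μ := by linarith
  have hne : ∀ l : dualLattice a, ((‖(l : Plane) + k‖ ^ 2 + μ : ℝ) : ℂ) ≠ 0 := fun l => by
    have : 0 < ‖(l : Plane) + k‖ ^ 2 + μ := by positivity
    exact_mod_cast this.ne'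
  have hsym : ∀ l : dualLattice a, freeSymbol a μ k l = ((‖(l : Plane) + k‖ ^ 2 + μ : ℝ) : ℂ)⁻¹ :=
    fun l => by rw [freeSymbol, Complex.ofReal_inv]
  have hcoef : ∀ (l : dualLattice a) g, ((‖(l : Plane) + k‖ ^ 2 + μ : ℝ) : ℂ) *
      coeff a l (freeResolvent a μ k g) = coeff a l g := fun l g => by
    rw [coeff_eq_repr, coeff_eq_repr, freeResolvent_repr hμ0, hsym, mul_left_comm,
      mul_inv_cancel_left₀ (hne l)]
  constructor
  · rintro ⟨h1, w, hw, h2⟩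
    rw [mem_sobolevTwo_iff] at h1
    obtain ⟨g, hg⟩ := exists_repr_eq (fourierBasis a)
      (c := fun l => ((‖(l : Plane) + k‖ ^ 2 + μ : ℝ) : ℂ) * (fourierBasis a).repr p.1 l) <| by
        refine Summable.of_nonneg_of_le (fun l => by positivity) (fun l => ?_)
          (h1.mul_left ((2 + 2 * ‖k‖ ^ 2 + μ) ^ 2))
        rw [norm_mul, Complex.norm_real, Real.norm_of_nonneg (by positivity), ← mul_pow, ← mul_assoc]
        gcongr
        exact sq_add_le hμ0.le k l
    have hu : p.1 = freeResolvent a μ k g := by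
      refine (fourierBasis a).repr.injective ?_
      ext l
      rw [freeResolvent_repr hμ0, hg, hsym, inv_mul_cancel_left₀ (hne l)]
    have hWg : W g = w := by
      refine Lp.ext ?_
      filter_upwards [hw, hW g] with y e1 e2
      rw [e2, e1, hu]
    refine ⟨g, hu, coeff_injective fun l hl => ?_⟩
    have e := hcoef ⟨l, hl⟩ g
    rw [← hu] at e
    have e' := h2 l hl
    rw [hWg]
    simp only [coeff, inner_add_right, inner_smul_right] at e e' ⊢
    rw [e', ← e]
    push_cast
    ring
  · rintro ⟨g, hu, hf⟩
    refine ⟨?_, W g, ?_, fun l hl => ?_⟩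
    · rw [mem_sobolevTwo_iff]
      refine Summable.of_nonneg_of_le (fun l => by positivity) (fun l => ?_)
        ((norm_sq_eq_tsum_repr (fourierBasis a) g).summable.mul_left ((2 + 2 * ‖k‖ ^ 2) ^ 2))
      rw [hu, freeResolvent_repr hμ0, norm_mul, norm_freeSymbol hμ0, ← mul_assoc, mul_pow]
      gcongr
      rw [← div_eq_mul_inv, div_le_iff₀ (by positivity)]
      refine (one_add_sq_le k l).trans ?_
      gcongr
    · filter_upwards [hW g] with y hy
      rw [hy, hu]
    · have e := hcoef ⟨l, hl⟩ g
      have e' := congrArg (coeff a l) hf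
      rw [← hu] at e
      simp only [coeff, inner_add_right, inner_smul_right] at e e' ⊢
      rw [← e] at e'
      push_cast at e' ⊢
      linear_combination e'

theorem isUnit_one_add {W : Fibre a →L[ℂ] Fibre a} (hW : ‖W‖ ≤ 1 / 2) : IsUnit (1 + W) := by
  have : ‖-W‖ < 1 := by rw [norm_neg]; linarith
  have h := isUnit_one_sub_of_norm_lt_one this
  rwa [sub_neg_eq_add] at h

theorem freeResolvent_symm {μ : ℝ} (hμ : 0 < μ) (k : Plane) (x y : Fibre a) :
    inner ℂ (freeResolvent a μ k x) y = inner ℂ x (freeResolvent a μ k y) := by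
  refine inner_eq_inner_of_repr (fourierBasis a) fun l => ?_
  rw [freeResolvent_repr hμ, freeResolvent_repr hμ, freeSymbol]
  simp only [RCLike.inner_apply, map_mul, Complex.conj_ofReal]
  ring

theorem freeResolvent_injective {μ : ℝ} (hμ : 0 < μ) (k : Plane) :
    Function.Injective (freeResolvent a μ k) := by
  intro x y h
  refine (fourierBasis a).repr.injective ?_
  ext l
  have h1 := congrArg (fun z => (fourierBasis a).repr z l) h
  simp only [freeResolvent_repr hμ] at h1
  refine mul_left_cancel₀ ?_ h1
  rw [freeSymbol]
  have : 0 < (‖(l : Plane) + k‖ ^ 2 + μ)⁻¹ := by positivity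
  exact_mod_cast this.ne'

/-- Balls contain finitely many dual lattice points, since such a point is determined by the
integers `n_j = l·a_j / 2π`, which are bounded when `|l|` is. -/
theorem tendsto_freeSymbol {μ : ℝ} (hμ : 0 < μ) (k : Plane) :
    Filter.Tendsto (freeSymbol a μ k) Filter.cofinite (nhds 0) := by
  have hfin : ∀ R : ℝ, {l : dualLattice a | ‖(l : Plane)‖ ≤ R}.Finite := by
    intro R
    choose n hn using fun l : dualLattice a => l.2
    refine Set.Finite.of_finite_image (f := n) ?_ ?_
    · refine (Set.finite_Icc (fun j => -⌈R * ‖a j‖⌉) (fun j => ⌈R * ‖a j‖⌉)).subset ?_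
      rintro _ ⟨l, hl, rfl⟩
      have : ∀ j, |(n l j : ℝ)| ≤ R * ‖a j‖ := fun j => by
        have h1 := abs_real_inner_le_norm (l : Plane) (a j)
        rw [hn, abs_mul, abs_of_pos Real.two_pi_pos] at h1
        have h2 : 1 ≤ 2 * Real.pi := by linarith [Real.pi_gt_three]
        have h3 : ‖(l : Plane)‖ * ‖a j‖ ≤ R * ‖a j‖ := by
          gcongr
          exact hl
        nlinarith [abs_nonneg (n l j : ℝ)]
      refine ⟨fun j => ?_, fun j => ?_⟩
      · have h1 := (abs_le.1 (this j)).1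
        have h2 := Int.le_ceil (R * ‖a j‖)
        have : (-⌈R * ‖a j‖⌉ : ℝ) ≤ n l j := by linarith
        exact_mod_cast this
      · have h1 := (abs_le.1 (this j)).2
        have h2 := Int.le_ceil (R * ‖a j‖)
        have : (n l j : ℝ) ≤ ⌈R * ‖a j‖⌉ := by linarith
        exact_mod_cast this
    · intro l _ l' _ hll
      refine Subtype.ext (eq_of_inner_basis_eq a fun j => ?_)
      rw [hn, hn, hll]
  rw [Metric.tendsto_nhds]
  intro ε hε
  rw [Filter.eventually_cofinite]
  refine (hfin (1 / ε + ‖k‖ + 1)).subset fun l hl => ?_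
  simp only [Set.mem_ofPred_eq, dist_zero_right, norm_freeSymbol hμ, not_lt] at hl ⊢
  by_contra hcon
  push Not at hcon
  have h1 : ‖(l : Plane)‖ ≤ ‖(l : Plane) + k‖ + ‖k‖ := by
    have := norm_sub_le ((l : Plane) + k) k
    simpa using this
  have hε' : 0 < 1 / ε := by positivity
  have h2 : 1 / ε + 1 < ‖(l : Plane) + k‖ := by linarith
  have h3 : 1 / ε < ‖(l : Plane) + k‖ ^ 2 + μ := by nlinarith
  have h4 := (inv_lt_inv₀ (by positivity) hε').2 h3
  rw [one_div, inv_inv] at h4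
  linarith

/-- The resolvent of the fibre Hamiltonian in terms of the free resolvent. -/
theorem exists_isResolventFamily {V : Plane → ℝ} (hVm : AEMeasurable V volume)
    (hV : IsLaplacianBoundedZero V) :
    ∃ (μ : ℝ) (T : Plane → Fibre a →L[ℂ] Fibre a), IsResolventFamily a V μ T := by
  obtain ⟨μ₀, hμ₀, h⟩ := exists_potential_resolvent (a := a) hVm hV
  -- The extra unit gives a margin: for `t ≤ 1 - μ = -μ₀` the value `-t` is itself an admissible
  -- shift, so no such `t` is an eigenvalue. Consequently all bands satisfy `E + μ ≥ 1`.
  set μ := μ₀ + 1 with hμ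
  have hμ0 : 0 < μ := by linarith
  choose W hWn hW using h μ (by linarith)
  set b := fourierBasis a
  set e : Fin 2 → Plane := fun j => EuclideanSpace.single j 1 with he
  have hA : ∀ j (l : dualLattice a),
      ‖((inner ℝ (l : Plane) (e j) : ℝ) : ℂ) * freeSymbol a μ 0 l‖ ≤ 1 := fun j l => by
    rw [norm_mul, Complex.norm_real, norm_freeSymbol hμ0, add_zero, ← div_eq_mul_inv,
      div_le_one (by positivity)]
    have := norm_inner_le_norm (𝕜 := ℝ) (l : Plane) (e j)
    have h2 : ‖inner ℝ (l : Plane) (e j)‖ ≤ ‖(l : Plane)‖ := by simpa [he] using this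
    nlinarith [sq_nonneg (‖(l : Plane)‖ - 1)]
  set A : Fin 2 → Fibre a →L[ℂ] Fibre a := fun j =>
    diagonal b fun l => ((inner ℝ (l : Plane) (e j) : ℝ) : ℂ) * freeSymbol a μ 0 l with hAdef
  -- `N k` multiplies the coefficient at `l` by `(|l + k|² + μ) / (|l|² + μ)`. Expanding the square
  -- shows it to be a polynomial in `k` with bounded operator coefficients.
  set N : Plane → Fibre a →L[ℂ] Fibre a := fun k =>
    1 + (∑ j, ((2 * inner ℝ k (e j) : ℝ) : ℂ) • A j) + ((‖k‖ ^ 2 : ℝ) : ℂ) • freeResolvent a μ 0 with hN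
  have hinner : ∀ k l : Plane, inner ℝ k l = ∑ j, inner ℝ k (e j) * inner ℝ l (e j) := fun k l => by
    simp [he, PiLp.inner_apply, mul_comm]
  have hNrepr : ∀ k x (l : dualLattice a), b.repr (N k x) l =
      ((‖(l : Plane) + k‖ ^ 2 + μ : ℝ) : ℂ) * (freeSymbol a μ 0 l * b.repr x l) := fun k x l => by
    have h1 : freeSymbol a μ 0 l = ((‖(l : Plane)‖ ^ 2 + μ : ℝ) : ℂ)⁻¹ := by
      rw [freeSymbol, Complex.ofReal_inv, add_zero]
    have h2 : ((‖(l : Plane)‖ ^ 2 + μ : ℝ) : ℂ) ≠ 0 := by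
      have : 0 < ‖(l : Plane)‖ ^ 2 + μ := by positivity
      exact_mod_cast this.ne'
    have h3 : ‖(l : Plane) + k‖ ^ 2 = ‖(l : Plane)‖ ^ 2 + 2 * ∑ j, inner ℝ k (e j) * inner ℝ (l : Plane) (e j) +
        ‖k‖ ^ 2 := by rw [norm_add_sq_real, ← hinner k l, real_inner_comm]
    have h4 : b.repr x l = (((‖(l : Plane)‖ ^ 2 + μ : ℝ) : ℂ) * freeSymbol a μ 0 l) * b.repr x l := by
      rw [h1, mul_inv_cancel₀ h2, one_mul]
    simp only [hN, Fin.sum_univ_two, _root_.add_apply, _root_.smul_apply, one_apply_eq_self,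
      map_add, map_smul, lp.coeFn_add, lp.coeFn_smul, Pi.add_apply, Pi.smul_apply, smul_eq_mul,
      hAdef, diagonal_repr b zero_le_one (hA _)]
    rw [freeResolvent_repr hμ0, h3, Fin.sum_univ_two]
    nth_rewrite 1 [h4]
    push_cast
    ring
  have hNinv : ∀ k, IsUnit (N k) := fun k => by
    have hb' : ∀ l : dualLattice a, ‖((‖(l : Plane)‖ ^ 2 + μ : ℝ) : ℂ) * freeSymbol a μ k l‖ ≤
        (2 + 2 * ‖k‖ ^ 2) * (1 + μ) := fun l => by
      rw [norm_mul, Complex.norm_real, norm_freeSymbol hμ0, ← div_eq_mul_inv,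
        Real.norm_of_nonneg (by positivity), div_le_iff₀ (by positivity)]
      have h5 := one_add_sq_le k (l : Plane)
      have h6 : ‖(l : Plane) + k‖ ^ 2 + 1 ≤ ‖(l : Plane) + k‖ ^ 2 + μ := by linarith
      have h7 : 0 ≤ (2 + 2 * ‖k‖ ^ 2) * (‖(l : Plane) + k‖ ^ 2 + μ) := by positivity
      have h8 : (2 + 2 * ‖k‖ ^ 2) * (‖(l : Plane) + k‖ ^ 2 + 1) ≤
        (2 + 2 * ‖k‖ ^ 2) * (‖(l : Plane) + k‖ ^ 2 + μ) := by gcongr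
      nlinarith [sq_nonneg ‖(l : Plane)‖]
    have hr := diagonal_repr b (by positivity) hb'
    have hs : ∀ (k : Plane) (l : dualLattice a),
        ((‖(l : Plane) + k‖ ^ 2 + μ : ℝ) : ℂ) * freeSymbol a μ k l = 1 := fun k l => by
      have : ‖(l : Plane) + k‖ ^ 2 + μ ≠ 0 := by positivity
      rw [freeSymbol, ← Complex.ofReal_mul, mul_inv_cancel₀ this, Complex.ofReal_one]
    have hs0 : ∀ l : dualLattice a, ((‖(l : Plane)‖ ^ 2 + μ : ℝ) : ℂ) * freeSymbol a μ 0 l = 1 :=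
      fun l => by
        have := hs 0 l
        rwa [add_zero] at this
    refine ⟨⟨N k, diagonal b fun l => ((‖(l : Plane)‖ ^ 2 + μ : ℝ) : ℂ) * freeSymbol a μ k l,
      ext_repr b fun x l => ?_, ext_repr b fun x l => ?_⟩, rfl⟩
    · rw [mul_apply_eq_comp, hNrepr, hr, one_apply_eq_self]
      linear_combination (freeSymbol a μ 0 l * ((‖(l : Plane)‖ ^ 2 + μ : ℝ) : ℂ) * b.repr x l) * hs k l
        + b.repr x l * hs0 l
    · rw [mul_apply_eq_comp, hr, hNrepr, one_apply_eq_self]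
      linear_combination (freeSymbol a μ 0 l * ((‖(l : Plane)‖ ^ 2 + μ : ℝ) : ℂ) * b.repr x l) * hs k l
        + b.repr x l * hs0 l
  have hΛN : ∀ k, freeResolvent a μ k * N k = freeResolvent a μ 0 := fun k =>
    ext_repr b fun x l => by
      have : ‖(l : Plane) + k‖ ^ 2 + μ ≠ 0 := by positivity
      rw [mul_apply_eq_comp, freeResolvent_repr hμ0, hNrepr, freeResolvent_repr hμ0,
        ← mul_assoc, freeSymbol, ← Complex.ofReal_mul, inv_mul_cancel₀ this, Complex.ofReal_one, one_mul]
  have hWN : ∀ k, W k * N k = W 0 := fun k => by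
    ext1 x
    refine Lp.ext ?_
    filter_upwards [hW k (N k x), hW 0 x] with y e1 e2
    rw [mul_apply_eq_comp, e1, e2, ← hΛN k, mul_apply_eq_comp]
  -- Hence `Λ_k (1 + W k)⁻¹ = Λ_0 (N k + W 0)⁻¹`. On the right only the polynomial `N k` depends on
  -- `k`, so smoothness follows from that of inversion; no regularity of `W` in `k` is used.
  have hJ : ∀ k, N k + W 0 = (1 + W k) * N k := fun k => by rw [add_mul, one_mul, hWN]
  have hU : ∀ k, IsUnit (1 + W k) := fun k => isUnit_one_add (hWn k)
  have hJU : ∀ k, IsUnit (N k + W 0) := fun k => by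
    rw [hJ]
    exact (hU k).mul (hNinv k)
  have hT : ∀ k, freeResolvent a μ 0 * Ring.inverse (N k + W 0) =
      freeResolvent a μ k * Ring.inverse (1 + W k) := fun k => by
    have h1 : (freeResolvent a μ k * Ring.inverse (1 + W k)) * (N k + W 0) = freeResolvent a μ 0 := by
      rw [hJ, mul_assoc, ← mul_assoc (Ring.inverse _), Ring.inverse_mul_cancel _ (hU k), one_mul, hΛN]
    rw [← h1, mul_assoc, Ring.mul_inverse_cancel _ (hJU k), mul_one]
  have hTapp : ∀ k g, freeResolvent a μ 0 (Ring.inverse (N k + W 0) (g + W k g)) =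
      freeResolvent a μ k g := fun k g => by
    have h1 := congrArg (fun B : Fibre a →L[ℂ] Fibre a => B (g + W k g)) (hT k)
    simp only [mul_apply_eq_comp] at h1
    rw [h1]
    congr 1
    have h2 := congrArg (fun B : Fibre a →L[ℂ] Fibre a => B g) (Ring.inverse_mul_cancel _ (hU k))
    simpa using h2
  have hsurj : ∀ k x, ∃ g, x = g + W k g := fun k x => by
    refine ⟨Ring.inverse (1 + W k) x, ?_⟩
    have h2 := congrArg (fun B : Fibre a →L[ℂ] Fibre a => B x) (Ring.mul_inverse_cancel _ (hU k))
    simpa using h2.symm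
  refine ⟨μ, fun k => freeResolvent a μ 0 * Ring.inverse (N k + W 0), ?_, ?_, ?_, ?_, ?_, ?_⟩
  · have hNs : ContDiff ℝ ∞ fun k => N k + W 0 := by
      refine ContDiff.add (ContDiff.add (contDiff_const.add (ContDiff.sum fun j _ => ?_)) ?_) contDiff_const
      · refine ContDiff.smul (Complex.ofRealCLM.contDiff.comp ?_) contDiff_const
        exact contDiff_const.mul (contDiff_id.inner ℝ contDiff_const)
      · exact ContDiff.smul (Complex.ofRealCLM.contDiff.comp (contDiff_norm_sq ℝ)) contDiff_const
    have hinv : ContDiff ℝ ∞ fun k => Ring.inverse (N k + W 0) := by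
      rw [contDiff_iff_contDiffAt]
      intro k
      have h1 : ContDiffAt ℝ ∞ Ring.inverse ((hJU k).unit : Fibre a →L[ℂ] Fibre a) :=
        contDiffAt_ringInverse ℝ (hJU k).unit
      exact ContDiffAt.comp k (g := Ring.inverse) h1 hNs.contDiffAt
    exact contDiff_const.mul hinv
  · intro k
    exact (isCompactOperator_diagonal b (tendsto_freeSymbol hμ0 0) (inv_nonneg.2 hμ0.le)
      (norm_freeSymbol_le hμ0 0)).comp_clm (Ring.inverse (N k + W 0))
  · intro k x y
    obtain ⟨f, rfl⟩ := hsurj k x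
    obtain ⟨g, rfl⟩ := hsurj k y
    simp only [mul_apply_eq_comp, hTapp]
    -- This is where the potential being real enters: it moves across the inner product.
    have hsw : inner ℂ (freeResolvent a μ k f) (W k g) = inner ℂ (W k f) (freeResolvent a μ k g) := by
      rw [L2.inner_def, L2.inner_def]
      refine integral_congr_ae ?_
      filter_upwards [hW k f, hW k g] with y e1 e2
      rw [e1, e2, inner_smul_left_eq_smul, inner_smul_right_eq_smul]
    rw [inner_add_right, inner_add_left, freeResolvent_symm hμ0, hsw]
  · intro k x y hxy
    obtain ⟨f, rfl⟩ := hsurj k x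
    obtain ⟨g, rfl⟩ := hsurj k y
    simp only [mul_apply_eq_comp, hTapp] at hxy
    rw [freeResolvent_injective hμ0 k hxy]
  · intro k t u
    simp only [mul_apply_eq_comp]
    change (u, (t : ℂ) • u) ∈ fibreHamiltonian a V k ↔ _
    rw [mem_fibreHamiltonian_iff (by linarith) (hW k)]
    simp only [← add_smul, ← Complex.ofReal_add]
    constructor
    · rintro ⟨g, h1, h2⟩
      rw [← map_smul, ← map_smul, h2, hTapp]
      exact h1
    · intro h1
      obtain ⟨g, hg⟩ := hsurj k (((t + μ : ℝ) : ℂ) • u)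
      refine ⟨g, ?_, hg⟩
      rw [← hTapp, ← hg, map_smul, map_smul]
      exact h1
  · intro k t ht
    obtain ⟨W', hWn', hW'⟩ := h (-t) (by linarith) k
    rw [Submodule.eq_bot_iff]
    intro u hu
    change (u, (t : ℂ) • u) ∈ fibreHamiltonian a V k at hu
    rw [mem_fibreHamiltonian_iff (by linarith) hW'] at hu
    obtain ⟨g, h1, h2⟩ := hu
    simp only [Complex.ofReal_neg, neg_smul, add_neg_cancel] at h2
    have hg : g = 0 := by
      have h3 := congrArg (fun B : Fibre a →L[ℂ] Fibre a => B g)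
        (Ring.inverse_mul_cancel _ (isUnit_one_add hWn'))
      simp only [mul_apply_eq_comp, _root_.add_apply, one_apply_eq_self,
        ← h2, map_zero] at h3
      exact h3.symm
    change u = _ at h1
    rw [h1, hg, map_zero]

end Resolvent

/-! ### Spectral theory of the fibres: completeness, min-max, continuity of the bands. -/

namespace IsResolventFamily

variable {a : Module.Basis (Fin 2) ℝ Plane} {V : Plane → ℝ} {μ : ℝ}
  {T : Plane → Fibre a →L[ℂ] Fibre a}

theorem apply_of_mem (hT : IsResolventFamily a V μ T) {k : Plane} {e : ℝ} {u : Fibre a}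
    (hu : u ∈ eigenspace a V k e) : T k u = (((e + μ)⁻¹ : ℝ) : ℂ) • u := by
  have h := (hT.mem_eigenspace_iff k e u).1 hu
  -- At `e + μ = 0` the eigenspace is zero, so the convention `0⁻¹ = 0` is harmless.
  by_cases h0 : e + μ = 0
  · rw [h0, Complex.ofReal_zero, zero_smul] at h
    rw [h, map_zero, smul_zero]
  · have h0' : ((e + μ : ℝ) : ℂ) ≠ 0 := by exact_mod_cast h0
    conv_rhs => rw [h]
    rw [smul_smul, Complex.ofReal_inv, inv_mul_cancel₀ h0', one_smul]

theorem lt_of_ne_bot (hT : IsResolventFamily a V μ T) {k : Plane} {e : ℝ}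
    (h : eigenspace a V k e ≠ ⊥) : 1 - μ < e := by
  by_contra hcon
  exact h (hT.eigenspace_eq_bot k e (not_lt.1 hcon))

theorem inner_eq_zero (hT : IsResolventFamily a V μ T) {k : Plane} {e e' : ℝ} (he : e ≠ e')
    {u v : Fibre a} (hu : u ∈ eigenspace a V k e) (hv : v ∈ eigenspace a V k e') :
    inner ℂ u v = 0 := by
  by_cases h0 : eigenspace a V k e = ⊥
  · rw [h0, Submodule.mem_bot] at hu
    rw [hu, inner_zero_left]
  by_cases h0' : eigenspace a V k e' = ⊥
  · rw [h0', Submodule.mem_bot] at hv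
    rw [hv, inner_zero_right]
  have h1 := hT.lt_of_ne_bot h0
  have h2 := hT.lt_of_ne_bot h0'
  have h := hT.symm k u v
  rw [hT.apply_of_mem hu, hT.apply_of_mem hv, inner_smul_left, inner_smul_right,
    Complex.conj_ofReal, ← sub_eq_zero, ← sub_mul] at h
  refine (mul_eq_zero.1 h).resolve_left ?_
  intro h3
  rw [sub_eq_zero] at h3
  have h4 : (e + μ)⁻¹ = (e' + μ)⁻¹ := by exact_mod_cast h3
  rw [inv_inj] at h4
  exact he (by linarith only [h4])

/-- The spectral theorem for the compact self-adjoint `T k`: injectivity excludes the eigenvalue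
`0`, and a real eigenvalue `x ≠ 0` corresponds to the energy `x⁻¹ - μ`. -/
theorem orthogonal_iSup_eigenspace (hT : IsResolventFamily a V μ T) (k : Plane) :
    (⨆ e : ℝ, eigenspace a V k e)ᗮ = ⊥ := by
  have hs : (T k).IsSymmetric := hT.symm k
  rw [← le_bot_iff, ← ContinuousLinearMap.orthogonalComplement_iSup_eigenspaces_eq_bot (hT.compact k) hs]
  refine Submodule.orthogonal_le (iSup_le fun t => ?_)
  intro u hu
  by_cases hu0 : u = 0
  · rw [hu0]
    exact Submodule.zero_mem _
  have htu : T k u = t • u := Module.End.mem_eigenspace_iff.1 hu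
  have ht : Module.End.HasEigenvalue (T k : Module.End ℂ (Fibre a)) t :=
    Module.End.hasEigenvalue_of_hasEigenvector ⟨hu, hu0⟩
  have hreal : starRingEnd ℂ t = t := hs.conj_eigenvalue_eq_self ht
  obtain ⟨x, rfl⟩ := Complex.conj_eq_iff_real.1 hreal
  have hx : x ≠ 0 := by
    rintro rfl
    rw [Complex.ofReal_zero, zero_smul] at htu
    exact hu0 (hT.injective k (htu.trans (map_zero _).symm))
  refine Submodule.mem_iSup_of_mem (x⁻¹ - μ) ((hT.mem_eigenspace_iff k _ u).2 ?_)
  have hx' : (x : ℂ) ≠ 0 := by exact_mod_cast hx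
  rw [htu, smul_smul, sub_add_cancel, Complex.ofReal_inv, inv_mul_cancel₀ hx', one_smul]

theorem ext_eigenspaces (hT : IsResolventFamily a V μ T) (k : Plane)
    {A B : Fibre a →L[ℂ] Fibre a}
    (h : ∀ e, ∀ u ∈ eigenspace a V k e, A u = B u) : A = B := by
  have hle : (⨆ e : ℝ, eigenspace a V k e) ≤ LinearMap.ker (A - B : Fibre a →L[ℂ] Fibre a).toLinearMap :=
    iSup_le fun e u hu => by
      rw [LinearMap.mem_ker]
      change A u - B u = 0
      rw [h e u hu, sub_self]
  have hd : (⨆ e : ℝ, eigenspace a V k e).topologicalClosure = ⊤ :=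
    (Submodule.topologicalClosure_eq_top_iff).2 (hT.orthogonal_iSup_eigenspace k)
  have hc : (⨆ e : ℝ, eigenspace a V k e).topologicalClosure ≤
      LinearMap.ker (A - B : Fibre a →L[ℂ] Fibre a).toLinearMap :=
    Submodule.topologicalClosure_minimal _ hle (A - B).isClosed_ker
  ext1 u
  have : u ∈ LinearMap.ker (A - B : Fibre a →L[ℂ] Fibre a).toLinearMap := hc (hd ▸ Submodule.mem_top)
  exact sub_eq_zero.1 this

theorem re_inner_sum (hT : IsResolventFamily a V μ T) {k : Plane} {ι : Type*} {ε : ι → ℝ}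
    (hε : Function.Injective ε) (s : Finset ι) {f : ι → Fibre a}
    (hf : ∀ e ∈ s, f e ∈ eigenspace a V k (ε e)) :
    (inner ℂ (T k (∑ e ∈ s, f e)) (∑ e ∈ s, f e)).re = ∑ e ∈ s, (ε e + μ)⁻¹ * ‖f e‖ ^ 2 ∧
      ‖∑ e ∈ s, f e‖ ^ 2 = ∑ e ∈ s, ‖f e‖ ^ 2 := by
  classical
  induction s using Finset.induction_on with
  | empty => simp
  | insert e s he ih =>
    obtain ⟨h1, h2⟩ := ih fun e' he' => hf e' (Finset.mem_insert_of_mem he')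
    have hfe := hf e (Finset.mem_insert_self _ _)
    have horth : inner ℂ (f e) (∑ e ∈ s, f e) = 0 := by
      rw [inner_sum]
      refine Finset.sum_eq_zero fun e' he' => hT.inner_eq_zero ?_ hfe
        (hf e' (Finset.mem_insert_of_mem he'))
      intro hee
      exact he (hε hee ▸ he')
    have horth' : inner ℂ (∑ e ∈ s, f e) (f e) = 0 := by
      rw [← inner_conj_symm, horth, map_zero]
    rw [Finset.sum_insert he, Finset.sum_insert he, Finset.sum_insert he]
    constructor
    · rw [map_add, inner_add_left, inner_add_right, inner_add_right, hT.symm k (∑ e ∈ s, f e) (f e),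
        hT.apply_of_mem hfe, inner_smul_left, inner_smul_left, inner_smul_right, horth, horth',
        mul_zero, mul_zero, add_zero, zero_add, Complex.add_re, h1, Complex.conj_ofReal,
        inner_self_eq_norm_sq_to_K]
      congr 1
      norm_cast
      change ((((ε e + μ)⁻¹ : ℝ) : ℂ) * ((‖f e‖ ^ 2 : ℝ) : ℂ)).re = _
      rw [← Complex.ofReal_mul, Complex.ofReal_re]
    · have := norm_add_sq (𝕜 := ℂ) (f e) (∑ e ∈ s, f e)
      rw [this, horth, h2]
      simp

/-- One half of min-max, by orthogonality of eigenvectors of different energies. Inversion reverses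
the order: low energy means a large quadratic form of `T k`. -/
theorem le_re_inner_of_mem_low (hT : IsResolventFamily a V μ T) {k : Plane} {e : ℝ} {u : Fibre a}
    (hu : u ∈ lowEnergySpace a V k e) : (e + μ)⁻¹ * ‖u‖ ^ 2 ≤ (inner ℂ (T k u) u).re := by
  obtain ⟨f, hf, rfl⟩ := (Submodule.mem_iSup_iff_exists_finsupp _ _).1 hu
  have h := hT.re_inner_sum Subtype.val_injective f.support fun x _ => hf x
  rw [Finsupp.sum, h.1, h.2, Finset.mul_sum]
  refine Finset.sum_le_sum fun x _ => ?_
  by_cases hx0 : f x = 0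
  · simp [hx0]
  have hlt := hT.lt_of_ne_bot (k := k) (e := x) fun hb => hx0 (by
    have := hf x
    rwa [hb, Submodule.mem_bot] at this)
  have hxe : (x : ℝ) ≤ e := x.2
  gcongr
  linarith only [hlt]

/-- The other half. By completeness, the orthogonal complement lies in the closed span of the
eigenvectors of energy above `e`; the inequality holds on the algebraic span and is a closed
condition. -/
theorem re_inner_le_of_orthogonal (hT : IsResolventFamily a V μ T) {k : Plane} {e : ℝ}
    (he : 0 < e + μ) {u : Fibre a} (hu : u ∈ (lowEnergySpace a V k e)ᗮ) :
    (inner ℂ (T k u) u).re ≤ (e + μ)⁻¹ * ‖u‖ ^ 2 := by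
  set S : Submodule ℂ (Fibre a) := ⨆ e' : Set.Ioi e, eigenspace a V k e' with hS
  have hSle : ∀ v ∈ S, (inner ℂ (T k v) v).re ≤ (e + μ)⁻¹ * ‖v‖ ^ 2 := by
    intro v hv
    obtain ⟨f, hf, rfl⟩ := (Submodule.mem_iSup_iff_exists_finsupp _ _).1 hv
    have h := hT.re_inner_sum Subtype.val_injective f.support fun x _ => hf x
    rw [Finsupp.sum, h.1, h.2, Finset.mul_sum]
    refine Finset.sum_le_sum fun x _ => ?_
    have hxe : e < (x : ℝ) := x.2
    gcongr
  have hmem : u ∈ S.topologicalClosure := by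
    have hle : (⨆ e : ℝ, eigenspace a V k e) ≤ lowEnergySpace a V k e ⊔ S := by
      refine iSup_le fun e' => ?_
      rcases le_or_gt e' e with h | h
      · exact le_sup_of_le_left (le_iSup (fun x : Set.Iic e => eigenspace a V k x) ⟨e', h⟩)
      · exact le_sup_of_le_right (le_iSup (fun x : Set.Ioi e => eigenspace a V k x) ⟨e', h⟩)
    have hbot : (lowEnergySpace a V k e)ᗮ ⊓ Sᗮ = ⊥ := by
      rw [Submodule.inf_orthogonal, ← le_bot_iff, ← hT.orthogonal_iSup_eigenspace k]
      exact Submodule.orthogonal_le hle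
    have hlowS : lowEnergySpace a V k e ⟂ S.topologicalClosure := by
      rw [Submodule.isOrtho_comm, Submodule.IsOrtho]
      refine Submodule.topologicalClosure_minimal _ ?_ (Submodule.isClosed_orthogonal _)
      rw [← Submodule.IsOrtho, Submodule.isOrtho_comm]
      refine Submodule.isOrtho_iSup_left.2 fun x => Submodule.isOrtho_iSup_right.2 fun y => ?_
      intro v hv
      rw [Submodule.mem_orthogonal]
      intro w hw
      have hxy : (y : ℝ) ≠ x := ((show (x : ℝ) ≤ e from x.2).trans_lt y.2).ne'
      exact hT.inner_eq_zero hxy hw hv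
    have hz : u - S.topologicalClosure.starProjection u ∈ (lowEnergySpace a V k e)ᗮ ⊓ Sᗮ := by
      refine ⟨Submodule.sub_mem _ hu ?_, ?_⟩
      · exact hlowS.symm (Submodule.starProjection_apply_mem _ _)
      · rw [← Submodule.orthogonal_closure]
        exact Submodule.sub_starProjection_mem_orthogonal _
    rw [hbot, Submodule.mem_bot, sub_eq_zero] at hz
    rw [hz]
    exact Submodule.starProjection_apply_mem _ _
  have hclosed : IsClosed {v : Fibre a | (inner ℂ (T k v) v).re ≤ (e + μ)⁻¹ * ‖v‖ ^ 2} := by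
    refine isClosed_le (Complex.continuous_re.comp ?_) (by fun_prop)
    exact (T k).continuous.inner continuous_id
  exact closure_minimal (s := (S : Set (Fibre a))) hSle hclosed hmem

theorem low_eq_bot (hT : IsResolventFamily a V μ T) {k : Plane} {e : ℝ} (he : e ≤ 1 - μ) :
    lowEnergySpace a V k e = ⊥ := by
  rw [lowEnergySpace, iSup_eq_bot]
  exact fun x => hT.eigenspace_eq_bot k x ((show (x : ℝ) ≤ e from x.2).trans he)

/-- On the closure of this space `T k` is bounded below, hence a closed embedding. Being compact
too, it makes the identity of the closure compact. -/
theorem finiteDimensional_low (hT : IsResolventFamily a V μ T) (k : Plane) (e : ℝ) :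
    FiniteDimensional ℂ (lowEnergySpace a V k e) := by
  rcases le_or_gt e (1 - μ) with h | h
  · rw [hT.low_eq_bot h]
    infer_instance
  have he : 0 < e + μ := by linarith
  set M := (lowEnergySpace a V k e).topologicalClosure with hM
  have hbd : ∀ u ∈ M, ‖u‖ ≤ (e + μ) * ‖T k u‖ := by
    have hcl : IsClosed {u : Fibre a | ‖u‖ ≤ (e + μ) * ‖T k u‖} :=
      isClosed_le continuous_norm (continuous_const.mul (T k).continuous.norm)
    refine fun u hu => closure_minimal (s := (lowEnergySpace a V k e : Set (Fibre a)))
      (fun v hv => ?_) hcl hu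
    have h1 := hT.le_re_inner_of_mem_low hv
    have h2 : (inner ℂ (T k v) v).re ≤ ‖T k v‖ * ‖v‖ :=
      (Complex.re_le_norm _).trans (norm_inner_le_norm _ _)
    have h3 : (e + μ)⁻¹ * ‖v‖ ^ 2 ≤ ‖T k v‖ * ‖v‖ := h1.trans h2
    rcases (norm_nonneg v).eq_or_lt with hv0 | hv0
    · change ‖v‖ ≤ _
      rw [← hv0]
      positivity
    · rw [inv_mul_le_iff₀ he, pow_two, ← mul_assoc] at h3
      exact le_of_mul_le_mul_right h3 hv0
  let S : M →L[ℂ] Fibre a := (T k).comp M.subtypeL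
  have hS : AntilipschitzWith ⟨e + μ, he.le⟩ S := ContinuousLinearMap.antilipschitz_of_bound _
    fun u => hbd u u.2
  have hcl : Topology.IsClosedEmbedding S := hS.isClosedEmbedding S.uniformContinuous
  obtain ⟨K, hK, hK0⟩ := (hT.compact k).comp_clm M.subtypeL
  have : FiniteDimensional ℂ M := FiniteDimensional.of_isCompactOperator_id
    ⟨S ⁻¹' K, hcl.isCompact_preimage hK, hK0⟩
  exact Submodule.finiteDimensional_of_le (Submodule.le_topologicalClosure _)

theorem low_mono {k : Plane} {e e' : ℝ} (h : e ≤ e') :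
    lowEnergySpace a V k e ≤ lowEnergySpace a V k e' :=
  iSup_le fun x => le_iSup (fun y : Set.Iic e' => eigenspace a V k y) ⟨x, (show (x : ℝ) ≤ e from x.2).trans h⟩

theorem finrank_low_mono (hT : IsResolventFamily a V μ T) {k : Plane} {e e' : ℝ} (h : e ≤ e') :
    Module.finrank ℂ (lowEnergySpace a V k e) ≤ Module.finrank ℂ (lowEnergySpace a V k e') :=
  have := hT.finiteDimensional_low k e'
  Submodule.finrank_mono (low_mono h)

/-- A form of the min-max principle: comparison of the numbers of eigenvalues of two operators of
the family. -/
theorem finrank_low_le (hT : IsResolventFamily a V μ T) {k k' : Plane} {e e' : ℝ}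
    (he' : 0 < e' + μ) (h : (e' + μ)⁻¹ + ‖T k' - T k‖ < (e + μ)⁻¹) :
    Module.finrank ℂ (lowEnergySpace a V k e) ≤ Module.finrank ℂ (lowEnergySpace a V k' e') := by
  by_contra! hlt
  have := hT.finiteDimensional_low k e
  have := hT.finiteDimensional_low k' e'
  let Q : lowEnergySpace a V k e →ₗ[ℂ] lowEnergySpace a V k' e' :=
    (lowEnergySpace a V k' e').orthogonalProjectionOnto.toLinearMap ∘ₗ (lowEnergySpace a V k e).subtype
  -- If the dimension dropped, the orthogonal projection between the two low-energy spaces would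
  -- kill some vector, low for `k` and orthogonal to the low space of `k'`. The two form bounds then
  -- contradict the hypothesis.
  obtain ⟨u, hu, hu0⟩ := (Submodule.ne_bot_iff _).1 (LinearMap.ker_ne_bot_of_finrank_lt (f := Q) hlt)
  have hperp : (u : Fibre a) ∈ (lowEnergySpace a V k' e')ᗮ :=
    Submodule.orthogonalProjectionOnto_eq_zero_iff.1 (LinearMap.mem_ker.1 hu)
  have h1 := hT.le_re_inner_of_mem_low u.2
  have h2 := hT.re_inner_le_of_orthogonal he' hperp
  have h3 : (inner ℂ (T k (u : Fibre a)) (u : Fibre a)).re - (inner ℂ (T k' (u : Fibre a)) (u : Fibre a)).re ≤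
      ‖T k' - T k‖ * ‖(u : Fibre a)‖ ^ 2 := by
    rw [← Complex.sub_re, ← inner_sub_left]
    refine (Complex.re_le_norm _).trans ((norm_inner_le_norm _ _).trans ?_)
    rw [pow_two, ← mul_assoc]
    gcongr
    rw [norm_sub_rev]
    exact (T k' - T k).le_opNorm (u : Fibre a)
  have h4 : 0 < ‖(u : Fibre a)‖ ^ 2 := by
    have : (u : Fibre a) ≠ 0 := fun h => hu0 (Subtype.ext h)
    positivity
  have h5 := mul_lt_mul_of_pos_right h h4
  rw [add_mul] at h5
  exact absurd h5 (not_lt.2 (sub_le_iff_le_add'.1 ((sub_le_sub h1 h2).trans h3)))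

theorem infinite_dualLattice (a : Module.Basis (Fin 2) ℝ Plane) : Infinite (dualLattice a) := by
  choose l hl using exists_inner_eq a
  refine Infinite.of_injective l fun n n' h => ?_
  ext j
  have h1 := hl n j
  rw [h, hl n' j] at h1
  have h2 := mul_left_cancel₀ Real.two_pi_pos.ne' h1
  exact_mod_cast h2.symm

/-- Otherwise the dimensions stabilise and one finite-dimensional space contains all eigenvectors,
hence is everything by completeness; but the plane waves are infinitely many. So the infimum
defining each band is over a nonempty set. -/
theorem exists_lt_finrank_low (hT : IsResolventFamily a V μ T) (k : Plane) (n : ℕ) :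
    ∃ e, n < Module.finrank ℂ (lowEnergySpace a V k e) := by
  by_contra! hcon
  obtain ⟨e₀, he₀⟩ : ∃ e₀, ∀ e, Module.finrank ℂ (lowEnergySpace a V k e) ≤
      Module.finrank ℂ (lowEnergySpace a V k e₀) := by
    have hb : BddAbove (Set.range fun e => Module.finrank ℂ (lowEnergySpace a V k e)) :=
      ⟨n, by rintro _ ⟨e, rfl⟩; exact hcon e⟩
    obtain ⟨e₀, h⟩ := Nat.sSup_mem (Set.range_nonempty _) hb
    exact ⟨e₀, fun e => (le_csSup hb ⟨e, rfl⟩).trans h.ge⟩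
  have hfd := hT.finiteDimensional_low k e₀
  have hle : (⨆ e : ℝ, eigenspace a V k e) ≤ lowEnergySpace a V k e₀ := by
    refine iSup_le fun e => ?_
    have := hT.finiteDimensional_low k (max e e₀)
    rw [Submodule.eq_of_le_of_finrank_le (low_mono (le_max_right e e₀)) (he₀ (max e e₀))]
    exact le_iSup (fun y : Set.Iic (max e e₀) => eigenspace a V k y) ⟨e, Set.mem_Iic.2 (le_max_left _ _)⟩
  have htop : lowEnergySpace a V k e₀ = ⊤ := by
    rw [← Submodule.orthogonal_eq_bot_iff, ← le_bot_iff, ← hT.orthogonal_iSup_eigenspace k]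
    exact Submodule.orthogonal_le hle
  rw [htop] at hfd
  have : FiniteDimensional ℂ (Fibre a) := Module.finite_def.2 (Module.Finite.iff_fg.1 hfd)
  have := infinite_dualLattice a
  exact Module.Finite.not_linearIndependent_of_infinite _ (fourierBasis a).orthonormal.linearIndependent

theorem band_eq (hT : IsResolventFamily a V μ T) (n : ℕ) (k : Plane) :
    band a V n k = sInf {e : ℝ | n < Module.finrank ℂ (lowEnergySpace a V k e)} := by
  rw [band]
  congr 1
  ext e
  have := hT.finiteDimensional_low k e
  rw [Set.mem_ofPred_eq, Set.mem_ofPred_eq, ← Module.finrank_eq_rank, Nat.cast_lt]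

theorem lt_of_lt_finrank_low (hT : IsResolventFamily a V μ T) {n : ℕ} {k : Plane} {e : ℝ}
    (h : n < Module.finrank ℂ (lowEnergySpace a V k e)) : 1 - μ < e := by
  by_contra! hcon
  rw [hT.low_eq_bot hcon, finrank_bot] at h
  omega

theorem band_le (hT : IsResolventFamily a V μ T) {n : ℕ} {k : Plane} {e : ℝ}
    (h : n < Module.finrank ℂ (lowEnergySpace a V k e)) : band a V n k ≤ e := by
  rw [hT.band_eq]
  exact csInf_le ⟨1 - μ, fun e he => (hT.lt_of_lt_finrank_low he).le⟩ h

theorem lt_finrank_low (hT : IsResolventFamily a V μ T) {n : ℕ} {k : Plane} {e : ℝ}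
    (h : band a V n k < e) : n < Module.finrank ℂ (lowEnergySpace a V k e) := by
  rw [hT.band_eq] at h
  obtain ⟨e', he', hlt⟩ := exists_lt_of_csInf_lt (hT.exists_lt_finrank_low k n) h
  exact lt_of_lt_of_le he' (hT.finrank_low_mono hlt.le)

theorem le_band (hT : IsResolventFamily a V μ T) (n : ℕ) (k : Plane) : 1 - μ ≤ band a V n k := by
  rw [hT.band_eq]
  exact le_csInf (hT.exists_lt_finrank_low k n) fun e he => (hT.lt_of_lt_finrank_low he).le

/-- Norm continuity of `T` and `finrank_low_le`, used in both directions, show that eigenvalue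
counts at nearby momenta interlace after a small shift of energy. -/
theorem continuous_band (hT : IsResolventFamily a V μ T) (n : ℕ) : Continuous (band a V n) := by
  rw [continuous_iff_continuousAt]
  intro k
  rw [Metric.continuousAt_iff']
  -- The restriction `ε < 1` keeps `e₄ + μ` positive, since `E + μ ≥ 1`.
  have key : ∀ ε : ℝ, 0 < ε → ε < 1 → ∀ᶠ k' in nhds k, dist (band a V n k') (band a V n k) < ε := by
    intro ε hε hε1
    set E := band a V n k
    have hE : 1 - μ ≤ E := hT.le_band n k
    have hnear : ∀ δ : ℝ, 0 < δ → ∀ᶠ k' in nhds k, ‖T k' - T k‖ < δ := fun δ hδ => by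
      have := (hT.contDiff.continuous.tendsto k).eventually (Metric.ball_mem_nhds (T k) hδ)
      filter_upwards [this] with k' hk'
      rwa [dist_eq_norm] at hk'
    have hinv : ∀ x y : ℝ, 0 < x + μ → x < y → 0 < (x + μ)⁻¹ - (y + μ)⁻¹ := fun x y hx hxy => by
      rw [sub_pos]
      exact (inv_lt_inv₀ (by linarith) hx).2 (by linarith)
    obtain ⟨e₁, he₁⟩ : ∃ e₁, e₁ = E + ε / 3 := ⟨_, rfl⟩
    obtain ⟨e₂, he₂⟩ : ∃ e₂, e₂ = E + 2 * ε / 3 := ⟨_, rfl⟩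
    obtain ⟨e₃, he₃⟩ : ∃ e₃, e₃ = E - ε / 3 := ⟨_, rfl⟩
    obtain ⟨e₄, he₄⟩ : ∃ e₄, e₄ = E - 2 * ε / 3 := ⟨_, rfl⟩
    filter_upwards [hnear _ (hinv e₁ e₂ (by linarith) (by linarith)),
      hnear _ (hinv e₄ e₃ (by linarith) (by linarith))] with k' h1 h2
    have hup : band a V n k' ≤ e₂ :=
      hT.band_le ((hT.lt_finrank_low (show band a V n k < e₁ by linarith only [he₁, hε])).trans_le
        (hT.finrank_low_le (by linarith only [he₂, hE, hε]) (lt_sub_iff_add_lt'.1 h1)))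
    have hlo : e₄ ≤ band a V n k' := by
      by_contra! hcon
      have h3 := (hT.lt_finrank_low hcon).trans_le (hT.finrank_low_le (k' := k)
        (e' := e₃) (by linarith only [he₃, hE, hε, hε1]) (by rw [norm_sub_rev]; exact lt_sub_iff_add_lt'.1 h2))
      have := hT.band_le h3
      linarith only [this, he₃, hε]
    rw [Real.dist_eq, abs_lt]
    constructor <;> linarith only [hup, hlo, he₂, he₄, hε]
  intro ε hε
  filter_upwards [key (min ε (1 / 2)) (by positivity) (by linarith [min_le_right ε (1 / 2)])] with k' hk'
  exact hk'.trans_le (min_le_left _ _)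

/-- The index is the number of eigenvalues up to `e`, minus one because bands are counted from zero.
Were that band below `e`, the low-energy space would already be complete at some `e' < e`, yet
eigenvectors of energy `e` are orthogonal to it. -/
theorem exists_band_eq (hT : IsResolventFamily a V μ T) {k : Plane} {e : ℝ}
    (h : eigenspace a V k e ≠ ⊥) : ∃ i, band a V i k = e := by
  have hle : eigenspace a V k e ≤ lowEnergySpace a V k e :=
    le_iSup (fun y : Set.Iic e => eigenspace a V k y) ⟨e, le_refl e⟩
  have := hT.finiteDimensional_low k e
  have hpos : 0 < Module.finrank ℂ (lowEnergySpace a V k e) := by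
    rw [Module.finrank_pos_iff, Submodule.nontrivial_iff_ne_bot]
    exact fun hb => h (le_bot_iff.1 (hb ▸ hle))
  refine ⟨Module.finrank ℂ (lowEnergySpace a V k e) - 1, le_antisymm (hT.band_le (by omega)) ?_⟩
  by_contra! hcon
  set e' := (band a V (Module.finrank ℂ (lowEnergySpace a V k e) - 1) k + e) / 2 with he'
  have hlt' : band a V (Module.finrank ℂ (lowEnergySpace a V k e) - 1) k < e' := by
    rw [he']
    linarith only [hcon]
  have h1 := hT.lt_finrank_low hlt'
  have hlt : e' < e := by rw [he']; linarith only [hcon]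
  have heq := Submodule.eq_of_le_of_finrank_le (low_mono (a := a) (V := V) (k := k) hlt.le) (by omega)
  obtain ⟨u, hu, hu0⟩ := (Submodule.ne_bot_iff _).1 h
  have hu' : u ∈ lowEnergySpace a V k e' := heq ▸ hle hu
  have horth : u ∈ (lowEnergySpace a V k e')ᗮ := by
    have hle2 : lowEnergySpace a V k e' ≤ (ℂ ∙ u)ᗮ := by
      refine iSup_le fun x v hv => ?_
      rw [Submodule.mem_orthogonal_singleton_iff_inner_right]
      exact hT.inner_eq_zero ((show (x : ℝ) ≤ e' from x.2).trans_lt hlt).ne' hu hv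
    rw [Submodule.mem_orthogonal']
    intro v hv
    exact Submodule.mem_orthogonal_singleton_iff_inner_right.1 (hle2 hv)
  exact hu0 (inner_self_eq_zero.1 ((Submodule.mem_orthogonal _ _).1 horth u hu'))

end IsResolventFamily

/-! ### Hadamard division and functions smooth in polar coordinates. -/

section Analysis

variable {E F : Type*} [NormedAddCommGroup E] [NormedSpace ℝ E] [NormedAddCommGroup F]
  [NormedSpace ℝ F]

/-- The integral is the value at `0` of the convolution of the indicator of `(0, 1]` with `s ↦ χ(s)
f(x, -s)`. The cutoff is `1` on `[-1, 1]` and supplies the compact support that smoothness of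
convolutions with a parameter requires. -/
theorem contDiff_intervalIntegral_param {f : E × ℝ → F} (hf : ContDiff ℝ ∞ f) :
    ContDiff ℝ ∞ fun x => ∫ s in (0 : ℝ)..1, f (x, s) := by
  let χ : ContDiffBump (0 : ℝ) := ⟨1, 2, one_pos, one_lt_two⟩
  let g : E → ℝ → F := fun x s => χ s • f (x, -s)
  have hg : ContDiff ℝ ∞ (Function.uncurry g) := by
    have h1 : ContDiff ℝ ∞ fun p : E × ℝ => f (p.1, -p.2) := by fun_prop
    have h2 : ContDiff ℝ ∞ fun p : E × ℝ => χ p.2 := χ.contDiff.comp contDiff_snd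
    exact h2.smul h1
  have h := contDiffOn_convolution_right_with_param_comp (n := ⊤) (μ := volume)
    (f := Set.indicator (Set.Ioc (0 : ℝ) 1) fun _ => (1 : ℝ)) (g := g) (s := Set.univ)
    (v := fun _ => 0) (k := Metric.closedBall 0 2) (ContinuousLinearMap.lsmul ℝ ℝ)
    contDiffOn_const isOpen_univ (isCompact_closedBall _ _)
    (fun x s _ hs => by
      have : χ s = 0 := χ.zero_of_le_dist (by
        rw [Metric.mem_closedBall, not_le] at hs
        exact hs.le)
      simp only [g, this, zero_smul])
    (((integrable_indicator_iff measurableSet_Ioc).2 (by simp)).locallyIntegrable)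
    hg.contDiffOn
  rw [contDiffOn_univ] at h
  convert h using 2 with x
  rw [convolution_def, intervalIntegral.integral_of_le zero_le_one,
    ← integral_indicator measurableSet_Ioc]
  congr 1
  ext s
  by_cases hs : s ∈ Set.Ioc (0 : ℝ) 1
  · have hχ : χ (-s) = 1 := χ.one_of_mem_closedBall (by
      rw [Metric.mem_closedBall, dist_zero_right, norm_neg, Real.norm_eq_abs]
      exact abs_le.2 ⟨by linarith [hs.1], hs.2⟩)
    simp [g, hs, hχ]
  · simp [hs]

/-- The fundamental theorem of calculus in the first variable: `f(t, x) = t ∫₀¹ ∂_t f(s t, x) ds`.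
-/
theorem exists_eq_smul_of_forall_zero [CompleteSpace F] {f : ℝ × E → F} (hf : ContDiff ℝ ∞ f)
    (h0 : ∀ x, f (0, x) = 0) : ∃ g : ℝ × E → F, ContDiff ℝ ∞ g ∧ ∀ p, f p = p.1 • g p := by
  have hf1 : Differentiable ℝ f := hf.differentiable (by simp)
  have hd : ContDiff ℝ ∞ (fderiv ℝ f) := hf.fderiv_right (m := ∞) (by simp)
  refine ⟨fun p => ∫ s in (0 : ℝ)..1, fderiv ℝ f (s * p.1, p.2) (1, 0), ?_, fun p => ?_⟩
  · refine contDiff_intervalIntegral_param (f := fun q : (ℝ × E) × ℝ =>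
      fderiv ℝ f (q.2 * q.1.1, q.1.2) (1, 0)) ?_
    exact (hd.comp (by fun_prop)).clm_apply contDiff_const
  · rw [← intervalIntegral.integral_smul]
    have key : ∀ s ∈ Set.uIcc (0 : ℝ) 1, HasDerivAt (fun s : ℝ => f (s * p.1, p.2))
        (p.1 • fderiv ℝ f (s * p.1, p.2) (1, 0)) s := fun s _ => by
      have h1 : HasDerivAt (fun s : ℝ => (s * p.1, p.2)) (p.1, (0 : E)) s :=
        (by simpa using (hasDerivAt_id s).mul_const p.1 : HasDerivAt (fun s : ℝ => s * p.1) p.1 s).prodMk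
          (hasDerivAt_const s p.2)
      have h2 := (hf1 (s * p.1, p.2)).hasFDerivAt.comp_hasDerivAt s h1
      have h3 : ((p.1, (0 : E)) : ℝ × E) = p.1 • (1, 0) := by simp
      rwa [h3, map_smul] at h2
    rw [intervalIntegral.integral_eq_sub_of_hasDerivAt key]
    · simp [h0]
    · refine Continuous.intervalIntegrable ?_ _ _
      exact continuous_const.smul ((hd.continuous.comp (by fun_prop)).clm_apply continuous_const)

/-- Hadamard's lemma: division of a smooth function by a power of the first variable. -/
theorem exists_eq_pow_smul [CompleteSpace F] (m : ℕ) {f : ℝ × E → F} (hf : ContDiff ℝ ∞ f)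
    (hbd : ∀ x, ∃ C, ∀ᶠ t in nhdsWithin (0 : ℝ) (Set.Ioi 0), ‖f (t, x)‖ ≤ C * t ^ m) :
    ∃ g : ℝ × E → F, ContDiff ℝ ∞ g ∧ ∀ p, f p = p.1 ^ m • g p := by
  induction m generalizing f with
  | zero => exact ⟨f, hf, fun p => by simp⟩
  | succ m ih =>
    have h0 : ∀ x, f (0, x) = 0 := fun x => by
      obtain ⟨C, hC⟩ := hbd x
      have h1 : Filter.Tendsto (fun t : ℝ => f (t, x)) (nhdsWithin 0 (Set.Ioi 0)) (nhds (f (0, x))) :=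
        ((hf.continuous.comp (by fun_prop : Continuous fun t : ℝ => (t, x))).tendsto 0).mono_left
          nhdsWithin_le_nhds
      have h2 : Filter.Tendsto (fun t : ℝ => C * t ^ (m + 1)) (nhdsWithin 0 (Set.Ioi 0)) (nhds 0) := by
        have : Continuous fun t : ℝ => C * t ^ (m + 1) := by fun_prop
        have h3 := this.tendsto 0
        rw [zero_pow (Nat.succ_ne_zero m), mul_zero] at h3
        exact h3.mono_left nhdsWithin_le_nhds
      exact tendsto_nhds_unique h1 (squeeze_zero_norm' hC h2)
    obtain ⟨g, hg, hfg⟩ := exists_eq_smul_of_forall_zero hf h0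
    obtain ⟨g', hg', hgg'⟩ := ih hg fun x => by
      obtain ⟨C, hC⟩ := hbd x
      refine ⟨C, ?_⟩
      filter_upwards [hC, self_mem_nhdsWithin] with t ht ht0
      have ht0' : (0 : ℝ) < t := ht0
      rw [hfg, norm_smul, Real.norm_of_nonneg ht0'.le, pow_succ, ← mul_assoc, mul_comm] at ht
      exact le_of_mul_le_mul_right ht ht0'
    exact ⟨g', hg', fun p => by rw [hfg, hgg', smul_smul, pow_succ']⟩

theorem norm_iteratedFDeriv_comp_affine_le {G : Type*} [NormedAddCommGroup G] [NormedSpace ℝ G]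
    {f : E → F} {i : ℕ} {c : E} {x : G} (J : G →L[ℝ] E) (hf : ContDiffAt ℝ i f (c + J x)) :
    ‖iteratedFDeriv ℝ i (fun x => f (c + J x)) x‖ ≤ ‖iteratedFDeriv ℝ i f (c + J x)‖ * ‖J‖ ^ i := by
  have h1 : ContDiffAt ℝ i (fun y => f (c + y)) (J x) := hf.comp (J x) (by fun_prop)
  obtain ⟨u, hu, hxu, hcd⟩ := h1.contDiffOn' le_rfl (by simp)
  rw [Set.insert_eq_of_mem (Set.mem_univ _), Set.univ_inter] at hcd
  have hpre : IsOpen (J ⁻¹' u) := hu.preimage J.continuous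
  have h2 := J.iteratedFDerivWithin_comp_right hcd hu.uniqueDiffOn hpre.uniqueDiffOn hxu le_rfl
  rw [iteratedFDerivWithin_of_isOpen i hpre hxu, iteratedFDerivWithin_of_isOpen i hu hxu,
    iteratedFDeriv_comp_add_left] at h2
  change ‖iteratedFDeriv ℝ i ((fun y => f (c + y)) ∘ J) x‖ ≤ _
  rw [h2]
  refine (ContinuousMultilinearMap.norm_compContinuousLinearMap_le _ _).trans_eq ?_
  simp

/-- Bounds for a function which is smooth in polar coordinates. -/
theorem exists_polar_bound [ProperSpace E] {f : E → F} {g : ℝ × E → F} {x₀ : E}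
    (hg : ∀ v ∈ Metric.sphere (0 : E) 1, ∀ᶠ p in nhds ((0 : ℝ), v), ContDiffAt ℝ ∞ g p ∧
      (0 < p.1 → f (x₀ + p.1 • p.2) = g p)) :
    ∃ ρ : ℝ, 0 < ρ ∧ ∀ N : ℕ, ∃ C, ∀ q : E, 0 < ‖q‖ → ‖q‖ ≤ ρ →
      ‖iteratedFDeriv ℝ N f (x₀ + q)‖ ≤ C / ‖q‖ ^ N := by
  -- Compactness of the sphere makes the radius uniform over all directions.
  have hev : ∀ᶠ t in nhds (0 : ℝ), ∀ v ∈ Metric.sphere (0 : E) 1, ∀ᶠ p in nhds (t, v),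
      ContDiffAt ℝ ∞ g p ∧ (0 < p.1 → f (x₀ + p.1 • p.2) = g p) :=
    (isCompact_sphere (0 : E) 1).eventually_forall_of_forall_eventually fun v hv =>
      (hg v hv).eventually_nhds
  obtain ⟨ρ, hρ, hball⟩ := Metric.eventually_nhds_iff.1 hev
  refine ⟨ρ / 2, by positivity, fun N => ?_⟩
  have hgood : ∀ t ∈ Set.Icc 0 (ρ / 2), ∀ v ∈ Metric.sphere (0 : E) 1, ∀ᶠ p in nhds (t, v),
      ContDiffAt ℝ ∞ g p ∧ (0 < p.1 → f (x₀ + p.1 • p.2) = g p) := fun t ht => hball (by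
    rw [Real.dist_eq, sub_zero, abs_of_nonneg ht.1]
    linarith [ht.2])
  have hcont : ContinuousOn (fun p => ‖iteratedFDeriv ℝ N g p‖)
      (Set.Icc 0 (ρ / 2) ×ˢ Metric.sphere (0 : E) 1) := by
    rintro ⟨t, v⟩ ⟨ht, hv⟩
    have h1 := (hgood t ht v hv).self_of_nhds.1
    exact ((h1.iteratedFDeriv_right (m := 0) (i := N) (by
      rw [zero_add]
      exact_mod_cast le_top)).continuousAt.norm).continuousWithinAt
  obtain ⟨C, hC⟩ := (isCompact_Icc.prod (isCompact_sphere (0 : E) 1)).bddAbove_image hcont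
  refine ⟨C, fun q hq hqρ => ?_⟩
  set t := ‖q‖ with ht
  have hv : t⁻¹ • q ∈ Metric.sphere (0 : E) 1 := by
    rw [mem_sphere_zero_iff_norm, norm_smul, norm_inv, Real.norm_of_nonneg hq.le, ← ht,
      inv_mul_cancel₀ hq.ne']
  have hgq := hgood t ⟨hq.le, hqρ⟩ _ hv
  -- The radius `t = ‖q‖` stays frozen while `q'` varies, the second argument leaving the unit
  -- sphere; this is why `g` is required on a full neighbourhood of `(0, v)`. Near `q` the function
  -- is thus `g` composed with an affine map of slope `t⁻¹`, and each derivative costs one factor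
  -- `t⁻¹`.
  have hsl : (fun q' => f (x₀ + q')) =ᶠ[nhds q] fun q' => g (t, t⁻¹ • q') := by
    have hc : Filter.Tendsto (fun q' : E => (t, t⁻¹ • q')) (nhds q) (nhds (t, t⁻¹ • q)) :=
      (by fun_prop : Continuous fun q' : E => (t, t⁻¹ • q')).tendsto q
    filter_upwards [hc.eventually hgq] with q' hq'
    rw [← hq'.2 hq, smul_smul, mul_inv_cancel₀ hq.ne', one_smul]
  have hshift : iteratedFDeriv ℝ N f (x₀ + q) = iteratedFDeriv ℝ N (fun q' => f (x₀ + q')) q := by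
    rw [iteratedFDeriv_comp_add_left]
  rw [hshift, (hsl.iteratedFDeriv ℝ N).self_of_nhds]
  let J : E →L[ℝ] ℝ × E := t⁻¹ • ContinuousLinearMap.inr ℝ ℝ E
  have hJ : (fun q' => g (t, t⁻¹ • q')) = fun q' => g ((t, 0) + J q') := by
    ext q'
    simp [J]
  have hJq : ((t, (0 : E)) + J q) = (t, t⁻¹ • q) := by simp [J]
  have hJnorm : ‖J‖ ≤ t⁻¹ := by
    refine J.opNorm_le_bound (by positivity) fun x => ?_
    have ht0 : 0 ≤ t⁻¹ := inv_nonneg.2 hq.le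
    simp [J, Prod.norm_def, norm_smul, abs_of_nonneg hq.le, mul_nonneg ht0]
  have hb := norm_iteratedFDeriv_comp_affine_le (f := g) (i := N) (c := (t, 0)) (x := q) J (by
    rw [hJq]
    exact hgq.self_of_nhds.1.of_le (by exact_mod_cast le_top))
  rw [hJq] at hb
  have hCq : ‖iteratedFDeriv ℝ N g (t, t⁻¹ • q)‖ ≤ C := hC ⟨_, ⟨⟨hq.le, hqρ⟩, hv⟩, rfl⟩
  rw [hJ, div_eq_mul_inv, ← inv_pow]
  have hC0 : 0 ≤ C := (norm_nonneg _).trans hCq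
  exact hb.trans (by gcongr)

end Analysis

/-! ### Riesz projectors: smoothness and action on eigenvectors. -/

section Riesz

theorem ringInverse_continuousMap_apply {𝔸 X : Type*} [NormedRing 𝔸] [TopologicalSpace X]
    {F : C(X, 𝔸)} (hF : IsUnit F) (x : X) : Ring.inverse F x = Ring.inverse (F x) := by
  obtain ⟨u, rfl⟩ := hF
  have h := Ring.inverse_unit
    (Units.map ((Pi.evalMonoidHom (fun _ : X => 𝔸) x).comp ContinuousMap.coeFnMonoidHom) u)
  rw [Ring.inverse_unit]
  exact h.symm

variable {𝔸 : Type*} [NormedRing 𝔸] [NormedAlgebra ℂ 𝔸] [CompleteSpace 𝔸]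

/-- The contour integral `(2πi)⁻¹ ∮ (z - A)⁻¹ dz` over the circle of centre `c` and radius `R`. -/
def rieszProjector (c : ℂ) (R : ℝ) (A : 𝔸) : 𝔸 :=
  (2 * Real.pi * Complex.I : ℂ)⁻¹ • circleIntegral (fun z => resolvent A z) c R

theorem eventually_sphere_subset_resolventSet {c : ℂ} {R : ℝ} {A₀ : 𝔸}
    (h : Metric.sphere c R ⊆ resolventSet ℂ A₀) :
    ∀ᶠ A in nhds A₀, Metric.sphere c R ⊆ resolventSet ℂ A := by
  refine (isCompact_sphere c R).eventually_forall_of_forall_eventually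
    (P := fun A z => z ∈ resolventSet ℂ A) fun z hz => ?_
  have hc : Continuous fun p : 𝔸 × ℂ => algebraMap ℂ 𝔸 p.2 - p.1 :=
    ((algebraMapCLM ℂ 𝔸).continuous.comp continuous_snd).sub continuous_fst
  exact (hc.tendsto (A₀, z)).eventually
    (Units.isOpen.mem_nhds (show IsUnit (algebraMap ℂ 𝔸 z - A₀) from h hz))

theorem exists_integral_clm {X : Type*} [TopologicalSpace X] [CompactSpace X] [MeasurableSpace X]
    [BorelSpace X] (ν : Measure X) [IsFiniteMeasure ν] (𝔸 : Type*) [NormedAddCommGroup 𝔸]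
    [NormedSpace ℂ 𝔸] : ∃ L : C(X, 𝔸) →L[ℂ] 𝔸, ∀ f, L f = ∫ x, f x ∂ν := by
  have hint : ∀ f : C(X, 𝔸), Integrable f ν := fun f =>
    f.continuous.integrable_of_hasCompactSupport (HasCompactSupport.of_compactSpace _)
  refine ⟨LinearMap.mkContinuous
    { toFun := fun f => ∫ x, f x ∂ν
      map_add' := fun f g => integral_add (hint f) (hint g)
      map_smul' := fun c f => integral_smul c f } (ν.real Set.univ) fun f => ?_, fun f => rfl⟩
  rw [mul_comm]
  exact norm_integral_le_of_norm_le_const (Filter.Eventually.of_forall f.norm_coe_le_norm)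

theorem exists_const_clm (X : Type*) [TopologicalSpace X] [CompactSpace X] (𝔸 : Type*)
    [NormedAddCommGroup 𝔸] [NormedSpace ℂ 𝔸] :
    ∃ L : 𝔸 →L[ℂ] C(X, 𝔸), ∀ A, L A = ContinuousMap.const X A :=
  ⟨LinearMap.mkContinuous
    { toFun := fun A => ContinuousMap.const X A
      map_add' := fun _ _ => rfl
      map_smul' := fun _ _ => rfl } 1 fun A => by
        rw [one_mul]
        exact (ContinuousMap.norm_le _ (norm_nonneg _)).2 fun x => le_refl _, fun A => rfl⟩

/-- The integrand is treated as one element of the Banach algebra `C(X, 𝔸)`, `X = [0, 2π]`. The map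
is then affine, followed by inversion, which is smooth at units, multiplication by `D` and the
continuous linear integration `L`. -/
theorem contDiffAt_rieszProjector {c : ℂ} {R : ℝ} (hR : 0 ≤ R) {A₀ : 𝔸}
    (h : Metric.sphere c R ⊆ resolventSet ℂ A₀) :
    ContDiffAt ℂ ∞ (rieszProjector c R) A₀ := by
  let X := Set.Icc (0 : ℝ) (2 * Real.pi)
  let ν : Measure X := Measure.comap Subtype.val volume
  have hν : IsFiniteMeasure ν := ⟨by
    rw [(MeasurableEmbedding.subtype_coe measurableSet_Icc).comap_apply, Set.image_univ,
      Subtype.range_coe]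
    exact measure_Icc_lt_top⟩
  let Z : C(X, 𝔸) := ⟨fun x => algebraMap ℂ 𝔸 (circleMap c R x),
    (algebraMapCLM ℂ 𝔸).continuous.comp ((continuous_circleMap c R).comp continuous_subtype_val)⟩
  let D : C(X, 𝔸) := ⟨fun x => algebraMap ℂ 𝔸 (deriv (circleMap c R) x),
    (algebraMapCLM ℂ 𝔸).continuous.comp (by
      simp only [deriv_circleMap]
      fun_prop)⟩
  obtain ⟨K, hK⟩ := exists_const_clm X 𝔸
  obtain ⟨L, hL⟩ := exists_integral_clm ν 𝔸
  have hZK : ∀ A x, (Z - K A) x = algebraMap ℂ 𝔸 (circleMap c R x) - A := fun A x => by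
    rw [hK]
    rfl
  have hunit : ∀ A : 𝔸, Metric.sphere c R ⊆ resolventSet ℂ A → IsUnit (Z - K A) := fun A hA =>
    (ContinuousMap.isUnit_iff_forall_isUnit _).2 fun x => by
      rw [hZK]
      exact hA (circleMap_mem_sphere c hR x)
  have heq : rieszProjector c R =ᶠ[nhds A₀] fun A =>
      (2 * Real.pi * Complex.I : ℂ)⁻¹ • L (D * Ring.inverse (Z - K A)) := by
    filter_upwards [eventually_sphere_subset_resolventSet h] with A hA
    rw [rieszProjector, hL, circleIntegral, intervalIntegral.integral_of_le Real.two_pi_pos.le,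
      ← integral_Icc_eq_integral_Ioc, ← integral_subtype_comap measurableSet_Icc]
    refine congrArg _ (integral_congr_ae (Filter.Eventually.of_forall fun x => ?_))
    dsimp only
    rw [ContinuousMap.mul_apply, ringInverse_continuousMap_apply (hunit A hA), hZK,
      Algebra.smul_def]
    rfl
  refine ContDiffAt.congr_of_eventuallyEq ?_ heq
  obtain ⟨U, hU⟩ := hunit A₀ h
  have h1 : ContDiffAt ℂ ∞ Ring.inverse (Z - K A₀) := hU ▸ contDiffAt_ringInverse ℂ U
  have h2 : ContDiffAt ℂ ∞ (fun A => Z - K A) A₀ := contDiffAt_const.sub K.contDiff.contDiffAt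
  have h3 : ContDiffAt ℂ ∞ (Ring.inverse ∘ fun A => Z - K A) A₀ := ContDiffAt.comp A₀ h1 h2
  have h4 : ContDiffAt ℂ ∞ (fun A => D * Ring.inverse (Z - K A)) A₀ := contDiffAt_const.mul h3
  exact (L.contDiff.contDiffAt.comp A₀ h4).const_smul _

theorem circleIntegrable_resolvent {c : ℂ} {R : ℝ} (hR : 0 ≤ R) {A : 𝔸}
    (h : Metric.sphere c R ⊆ resolventSet ℂ A) : CircleIntegrable (fun z => resolvent A z) c R := by
  refine ContinuousOn.circleIntegrable hR fun z hz => ContinuousAt.continuousWithinAt ?_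
  obtain ⟨U, hU⟩ := h hz
  have h1 : ContinuousAt Ring.inverse (algebraMap ℂ 𝔸 z - A) := hU ▸ NormedRing.inverse_continuousAt U
  exact ContinuousAt.comp (f := fun z => algebraMap ℂ 𝔸 z - A) h1
    ((algebraMapCLM ℂ 𝔸).continuous.continuousAt.sub continuousAt_const)

theorem circleIntegral_sub_inv_of_lt {c w : ℂ} {R : ℝ} (hR : 0 ≤ R) (h : R < ‖w - c‖) :
    circleIntegral (fun z => (z - w)⁻¹) c R = 0 := by
  have hne : ∀ z ∈ Metric.closedBall c R, z - w ≠ 0 := fun z hz h0 => by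
    rw [sub_eq_zero.1 h0, mem_closedBall_iff_norm] at hz
    linarith
  refine Complex.circleIntegral_eq_zero_of_differentiable_on_off_countable hR Set.countable_empty
    (fun z hz => ContinuousAt.continuousWithinAt ?_) fun z hz => ?_
  · exact (continuousAt_id.sub continuousAt_const).inv₀ (hne z hz)
  · exact (differentiableAt_id.sub_const w).inv (hne z (Metric.ball_subset_closedBall hz.1))

variable {H : Type*} [NormedAddCommGroup H] [NormedSpace ℂ H] [CompleteSpace H]

/-- On an eigenvector the resolvent acts as the scalar `(z - t)⁻¹`, which reduces the operator
integral to a Cauchy integral. -/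
theorem rieszProjector_apply_eq {c : ℂ} {R : ℝ} (hR : 0 ≤ R) {A : H →L[ℂ] H}
    (h : Metric.sphere c R ⊆ resolventSet ℂ A) {t : ℂ} {u : H} (hu : A u = t • u) :
    rieszProjector c R A u =
      ((2 * Real.pi * Complex.I : ℂ)⁻¹ * circleIntegral (fun z => (z - t)⁻¹) c R) • u := by
  by_cases hu0 : u = 0
  · simp [hu0]
  have hres : ∀ z ∈ Metric.sphere c R, resolvent A z u = (z - t)⁻¹ • u := fun z hz => by
    have h1 : (resolvent A z) ((algebraMap ℂ (H →L[ℂ] H) z - A) u) = u := by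
      have := Ring.inverse_mul_cancel _ (h hz)
      exact congrArg (fun B : H →L[ℂ] H => B u) this
    have h2 : (algebraMap ℂ (H →L[ℂ] H) z - A) u = (z - t) • u := by
      rw [_root_.sub_apply, hu, sub_smul]
      rfl
    rw [h2, map_smul] at h1
    have h3 : z - t ≠ 0 := fun h0 => hu0 (by rw [← h1, h0, zero_smul])
    rw [eq_inv_smul_iff₀ h3, h1]
  rw [rieszProjector, _root_.smul_apply, mul_smul]
  congr 1
  have h4 := (ContinuousLinearMap.apply ℂ H u).intervalIntegral_comp_comm
    (circleIntegrable_resolvent hR h).out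
  rw [circleIntegral, circleIntegral, ← intervalIntegral.integral_smul_const]
  refine h4.symm.trans (intervalIntegral.integral_congr fun θ _ => ?_)
  simp [hres _ (circleMap_mem_sphere c hR θ), smul_smul]

theorem rieszProjector_apply_of_lt {c : ℂ} {R : ℝ} {A : H →L[ℂ] H}
    (h : Metric.sphere c R ⊆ resolventSet ℂ A) {t : ℂ} {u : H} (hu : A u = t • u)
    (ht : ‖t - c‖ < R) : rieszProjector c R A u = u := by
  rw [rieszProjector_apply_eq ((norm_nonneg _).trans ht.le) h hu,
    circleIntegral.integral_sub_inv_of_mem_ball (mem_ball_iff_norm.2 ht),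
    inv_mul_cancel₀ Complex.two_pi_I_ne_zero, one_smul]

theorem rieszProjector_apply_of_gt {c : ℂ} {R : ℝ} (hR : 0 ≤ R) {A : H →L[ℂ] H}
    (h : Metric.sphere c R ⊆ resolventSet ℂ A) {t : ℂ} {u : H} (hu : A u = t • u)
    (ht : R < ‖t - c‖) : rieszProjector c R A u = 0 := by
  rw [rieszProjector_apply_eq hR h hu, circleIntegral_sub_inv_of_lt hR ht, mul_zero, zero_smul]

theorem contDiffAt_rieszProjector_comp {E : Type*} [NormedAddCommGroup E] [NormedSpace ℝ E]
    {c : ℂ} {R : ℝ} (hR : 0 ≤ R) {A : E → H →L[ℂ] H} {x : E} (hA : ContDiffAt ℝ ∞ A x)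
    (h : Metric.sphere c R ⊆ resolventSet ℂ (A x)) :
    ContDiffAt ℝ ∞ (fun y => rieszProjector c R (A y)) x :=
  ((contDiffAt_rieszProjector hR h).restrict_scalars ℝ).comp x hA

end Riesz

theorem eigenprojector_apply_of_mem {a : Module.Basis (Fin 2) ℝ Plane} {V : Plane → ℝ} {n : ℕ}
    {k : Plane} {u : Fibre a} (hu : u ∈ eigenspace a V k (band a V n k)) :
    eigenprojector a V n k u = u :=
  Submodule.starProjection_eq_self_iff.2 (Submodule.le_topologicalClosure _ hu)

theorem abs_inv_add_sub_inv_add_lt {μ e₁ e R : ℝ} (h₁ : 1 ≤ e₁ + μ) (h : 1 ≤ e + μ)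
    (hR : |e - e₁| < R) : |(e + μ)⁻¹ - (e₁ + μ)⁻¹| < R := by
  have h2 : (e + μ)⁻¹ - (e₁ + μ)⁻¹ = -(e - e₁) / ((e + μ) * (e₁ + μ)) := by
    field_simp
    ring
  rw [h2, abs_div, abs_neg]
  refine (div_le_self (abs_nonneg _) ?_).trans_lt hR
  rw [abs_of_pos (by positivity)]
  nlinarith

/-- The left side is the value at `e = e₁ + δ`, the least favourable energy: inversion contracts
distances more strongly at higher energies. -/
theorem le_abs_inv_add_sub_inv_add {μ e₁ e δ : ℝ} (h₁ : 1 ≤ e₁ + μ) (h : 1 ≤ e + μ) (hδ : 0 < δ)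
    (he : δ ≤ |e - e₁|) :
    δ / ((e₁ + μ) * (e₁ + μ + δ)) ≤ |(e + μ)⁻¹ - (e₁ + μ)⁻¹| := by
  have h2 : (e + μ)⁻¹ - (e₁ + μ)⁻¹ = -(e - e₁) / ((e + μ) * (e₁ + μ)) := by
    field_simp
    ring
  rw [h2, abs_div, abs_neg, abs_of_pos (show 0 < (e + μ) * (e₁ + μ) by positivity),
    div_le_div_iff₀ (by positivity) (by positivity)]
  have h3 : e + μ ≤ e₁ + μ + |e - e₁| := by linarith [le_abs_self (e - e₁)]
  have h4 : δ * (e + μ) ≤ |e - e₁| * (e₁ + μ + δ) := by nlinarith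
  nlinarith

/-- The energies near `e₁` are separated by a circle from those at distance at least `δ`. -/
theorem exists_separating_radius {μ e₁ δ : ℝ} (h₁ : 1 ≤ e₁ + μ) (hδ : 0 < δ) :
    ∃ R : ℝ, 0 < R ∧ R < (e₁ + μ)⁻¹ ∧ ∀ e, 1 ≤ e + μ →
      (|e - e₁| < R → |(e + μ)⁻¹ - (e₁ + μ)⁻¹| < R) ∧
      (δ ≤ |e - e₁| → R < |(e + μ)⁻¹ - (e₁ + μ)⁻¹|) := by
  have h0 : 0 < δ / ((e₁ + μ) * (e₁ + μ + δ)) := by positivity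
  have h2 : δ / ((e₁ + μ) * (e₁ + μ + δ)) < (e₁ + μ)⁻¹ := by
    rw [div_lt_iff₀ (by positivity), inv_mul_cancel_left₀ (by positivity)]
    linarith
  -- Half of the minimal distance after inversion. It is also below `(e₁ + μ)⁻¹`, so the circle
  -- leaves outside the point `0`, where the spectrum of a compact operator may accumulate.
  exact ⟨δ / ((e₁ + μ) * (e₁ + μ + δ)) / 2, by linarith, by linarith, fun e he =>
    ⟨abs_inv_add_sub_inv_add_lt h₁ he, fun h => by
      linarith [le_abs_inv_add_sub_inv_add h₁ he hδ h]⟩⟩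

/-! ### Smoothness of the spectral projectors. -/

namespace IsResolventFamily

variable {a : Module.Basis (Fin 2) ℝ Plane} {V : Plane → ℝ} {μ : ℝ}
  {T : Plane → Fibre a →L[ℂ] Fibre a}

theorem isClosed_eigenspace (hT : IsResolventFamily a V μ T) (k : Plane) (e : ℝ) :
    IsClosed (eigenspace a V k e : Set (Fibre a)) := by
  have : (eigenspace a V k e : Set (Fibre a)) = {u | u = ((e + μ : ℝ) : ℂ) • T k u} :=
    Set.ext fun u => hT.mem_eigenspace_iff k e u
  rw [this]
  exact isClosed_eq continuous_id (((e + μ : ℝ) : ℂ) • T k).continuous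

theorem eigenprojector_apply_mem (hT : IsResolventFamily a V μ T) (n : ℕ) (k : Plane)
    (u : Fibre a) : eigenprojector a V n k u ∈ eigenspace a V k (band a V n k) :=
  (hT.isClosed_eigenspace k _).submodule_topologicalClosure_eq.le
    (Submodule.starProjection_apply_mem _ u)

theorem eigenprojector_apply_of_ne (hT : IsResolventFamily a V μ T) {n : ℕ} {k : Plane} {e : ℝ}
    (he : e ≠ band a V n k) {u : Fibre a} (hu : u ∈ eigenspace a V k e) :
    eigenprojector a V n k u = 0 := by
  rw [eigenprojector, Submodule.starProjection_apply_eq_zero_iff, Submodule.orthogonal_closure,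
    Submodule.mem_orthogonal]
  exact fun v hv => hT.inner_eq_zero he.symm hv hu

theorem one_le_band_add (hT : IsResolventFamily a V μ T) (i : ℕ) (k : Plane) :
    1 ≤ band a V i k + μ := by linarith [hT.le_band i k]

theorem mem_resolventSet (hT : IsResolventFamily a V μ T) {k : Plane} {z : ℂ} (hz : z ≠ 0)
    (h : ∀ i, (((band a V i k + μ)⁻¹ : ℝ) : ℂ) ≠ z) : z ∈ resolventSet ℂ (T k) := by
  refine (IsCompactOperator.hasEigenvalue_or_mem_resolventSet (hT.compact k) hz).resolve_left
    fun hev => ?_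
  have hs : (T k).IsSymmetric := hT.symm k
  obtain ⟨u, hu⟩ := hev.exists_hasEigenvector
  have htu : T k u = z • u := hu.apply_eq_smul
  obtain ⟨x, rfl⟩ := Complex.conj_eq_iff_real.1 (hs.conj_eigenvalue_eq_self hev)
  have hx : x ≠ 0 := by exact_mod_cast hz
  have hmem : u ∈ eigenspace a V k (x⁻¹ - μ) := by
    rw [hT.mem_eigenspace_iff, htu, smul_smul, sub_add_cancel, Complex.ofReal_inv,
      inv_mul_cancel₀ hz, one_smul]
  obtain ⟨i, hi⟩ := hT.exists_band_eq (fun hb => hu.2 (by rwa [hb, Submodule.mem_bot] at hmem))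
  exact h i (by rw [hi, sub_add_cancel, inv_inv])

theorem sphere_subset_resolventSet (hT : IsResolventFamily a V μ T) {k : Plane} {t R : ℝ}
    (hR : 0 ≤ R) (ht : R < t) (h : ∀ i, |(band a V i k + μ)⁻¹ - t| ≠ R) :
    Metric.sphere (t : ℂ) R ⊆ resolventSet ℂ (T k) := by
  intro z hz
  rw [mem_sphere_iff_norm] at hz
  refine hT.mem_resolventSet ?_ fun i hi => h i ?_
  · rintro rfl
    rw [zero_sub, norm_neg, Complex.norm_real, Real.norm_of_nonneg (hR.trans ht.le)] at hz
    exact ht.ne' hz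
  · rw [← hz, ← hi, ← Complex.ofReal_sub, Complex.norm_real, Real.norm_eq_abs]

theorem rieszProjector_apply_of_lt (hT : IsResolventFamily a V μ T) {k : Plane} {t R : ℝ}
    (hs : Metric.sphere (t : ℂ) R ⊆ resolventSet ℂ (T k)) {e : ℝ} (he : |(e + μ)⁻¹ - t| < R)
    {u : Fibre a} (hu : u ∈ eigenspace a V k e) : rieszProjector (t : ℂ) R (T k) u = u := by
  refine Bloch.rieszProjector_apply_of_lt hs (hT.apply_of_mem hu) ?_
  rwa [← Complex.ofReal_sub, Complex.norm_real, Real.norm_eq_abs]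

theorem rieszProjector_apply_of_gt (hT : IsResolventFamily a V μ T) {k : Plane} {t R : ℝ}
    (hR : 0 ≤ R)
    (hs : Metric.sphere (t : ℂ) R ⊆ resolventSet ℂ (T k)) {e : ℝ} (he : R < |(e + μ)⁻¹ - t|)
    {u : Fibre a} (hu : u ∈ eigenspace a V k e) : rieszProjector (t : ℂ) R (T k) u = 0 := by
  refine Bloch.rieszProjector_apply_of_gt hR hs (hT.apply_of_mem hu) ?_
  rwa [← Complex.ofReal_sub, Complex.norm_real, Real.norm_eq_abs]

/-- Near `k₁` a fixed circle separates the upper band from all others. The Riesz projector of `T k`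
and the eigenprojector then agree on each eigenvector, hence everywhere by completeness. -/
theorem contDiffAt_eigenprojector (hT : IsResolventFamily a V μ T) {n : ℕ} {k₁ : Plane} {g : ℝ}
    (hg : 0 < g) (hgap : ∀ k, ∀ i, i ≠ n + 1 → i ≠ n → g ≤ |band a V (n + 1) k - band a V i k|)
    (hne : band a V (n + 1) k₁ ≠ band a V n k₁) :
    ContDiffAt ℝ ∞ (eigenprojector a V (n + 1)) k₁ := by
  set e₁ := band a V (n + 1) k₁ with he₁
  have h₁ : 1 ≤ e₁ + μ := hT.one_le_band_add _ _
  -- Halved because a band may move by `δ` before a distance `δ` is left. The gap is uniform in `i`,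
  -- so only the two bands `n` and `n + 1` need continuity.
  set δ := min |e₁ - band a V n k₁| g / 2 with hδ
  have hδ1 : 2 * δ ≤ |e₁ - band a V n k₁| := by
    rw [hδ]
    linarith [min_le_left |e₁ - band a V n k₁| g]
  have hδ2 : 2 * δ ≤ g := by
    rw [hδ]
    linarith [min_le_right |e₁ - band a V n k₁| g]
  have hδ0 : 0 < δ := half_pos (lt_min (abs_pos.2 (sub_ne_zero.2 hne)) hg)
  obtain ⟨R, hR0, hRt, hR⟩ := exists_separating_radius h₁ hδ0
  have hev : ∀ᶠ k in nhds k₁, |band a V (n + 1) k - e₁| < R ∧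
      ∀ i, i ≠ n + 1 → δ ≤ |band a V i k - e₁| := by
    have hn1 := Metric.tendsto_nhds.1 ((hT.continuous_band (n + 1)).tendsto k₁) (min R δ)
      (lt_min hR0 hδ0)
    have hn2 := Metric.tendsto_nhds.1 ((hT.continuous_band n).tendsto k₁) δ hδ0
    filter_upwards [hn1, hn2] with k hk1 hk2
    rw [Real.dist_eq] at hk1 hk2
    refine ⟨hk1.trans_le (min_le_left _ _), fun i hi => ?_⟩
    have hk1' := hk1.trans_le (min_le_right R δ)
    by_cases hin : i = n
    · subst hin
      have := abs_sub_le e₁ (band a V i k) (band a V i k₁)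
      rw [abs_sub_comm e₁ (band a V i k)] at this
      linarith
    · have := abs_sub_le (band a V (n + 1) k) e₁ (band a V i k)
      rw [abs_sub_comm e₁ (band a V i k)] at this
      linarith [hgap k i hi hin]
  have hsph : ∀ k, (|band a V (n + 1) k - e₁| < R ∧ ∀ i, i ≠ n + 1 → δ ≤ |band a V i k - e₁|) →
      Metric.sphere (((e₁ + μ)⁻¹ : ℝ) : ℂ) R ⊆ resolventSet ℂ (T k) := fun k hk =>
    hT.sphere_subset_resolventSet hR0.le hRt fun i => by
      by_cases hi : i = n + 1
      · exact hi ▸ ((hR _ (hT.one_le_band_add _ _)).1 hk.1).ne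
      · exact ((hR _ (hT.one_le_band_add _ _)).2 (hk.2 i hi)).ne'
  have heq : eigenprojector a V (n + 1) =ᶠ[nhds k₁] fun k =>
      rieszProjector (((e₁ + μ)⁻¹ : ℝ) : ℂ) R (T k) := by
    filter_upwards [hev] with k hk
    refine hT.ext_eigenspaces k fun e u hu => ?_
    by_cases hb : eigenspace a V k e = ⊥
    · rw [hb, Submodule.mem_bot] at hu
      rw [hu, map_zero, map_zero]
    obtain ⟨i, rfl⟩ := hT.exists_band_eq hb
    by_cases hi : band a V i k = band a V (n + 1) k
    · rw [hi] at hu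
      rw [eigenprojector_apply_of_mem hu, hT.rieszProjector_apply_of_lt (hsph k hk)
        ((hR _ (hT.one_le_band_add _ _)).1 hk.1) hu]
    · rw [hT.eigenprojector_apply_of_ne hi hu, hT.rieszProjector_apply_of_gt hR0.le (hsph k hk)
        ((hR _ (hT.one_le_band_add _ _)).2 (hk.2 i fun h => hi (h ▸ rfl))) hu]
  exact (contDiffAt_rieszProjector_comp hR0.le hT.contDiff.contDiffAt
    (hsph k₁ hev.self_of_nhds)).congr_of_eventuallyEq heq

/-- Near a crossing of two bands, the spectral projector onto both of them is smooth. -/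
theorem exists_contDiffAt_crossing (hT : IsResolventFamily a V μ T) {n : ℕ} {k₀ : Plane} {g : ℝ}
    (hg : 0 < g) (hgap : ∀ k, ∀ i, i ≠ n + 1 → i ≠ n → g ≤ |band a V (n + 1) k - band a V i k|)
    (heq : band a V (n + 1) k₀ = band a V n k₀) :
    ∃ Q : Plane → Fibre a →L[ℂ] Fibre a, ∀ᶠ k in nhds k₀,
      ContDiffAt ℝ ∞ Q k ∧ (band a V (n + 1) k ≠ band a V n k →
        Q k = eigenprojector a V (n + 1) k + eigenprojector a V n k) := by
  set e₁ := band a V (n + 1) k₀ with he₁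
  have h₁ : 1 ≤ e₁ + μ := hT.one_le_band_add _ _
  obtain ⟨R, hR0, hRt, hR⟩ := exists_separating_radius h₁ (half_pos hg)
  have hev : ∀ᶠ k in nhds k₀, |band a V (n + 1) k - e₁| < R ∧ |band a V n k - e₁| < R ∧
      ∀ i, i ≠ n + 1 → i ≠ n → g / 2 ≤ |band a V i k - e₁| := by
    have hn1 := Metric.tendsto_nhds.1 ((hT.continuous_band (n + 1)).tendsto k₀) (min R (g / 2))
      (lt_min hR0 (half_pos hg))
    have hn2 := Metric.tendsto_nhds.1 ((hT.continuous_band n).tendsto k₀) R hR0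
    filter_upwards [hn1, hn2] with k hk1 hk2
    rw [Real.dist_eq] at hk1 hk2
    rw [← heq] at hk2
    refine ⟨hk1.trans_le (min_le_left _ _), hk2, fun i hi hin => ?_⟩
    have hk1' := hk1.trans_le (min_le_right R (g / 2))
    have := abs_sub_le (band a V (n + 1) k) e₁ (band a V i k)
    rw [abs_sub_comm e₁ (band a V i k)] at this
    linarith [hgap k i hi hin]
  -- A circle about the common value encloses both bands and, by the gap, nothing else; no
  -- separation of the two is required.
  refine ⟨fun k => rieszProjector (((e₁ + μ)⁻¹ : ℝ) : ℂ) R (T k), ?_⟩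
  filter_upwards [hev] with k hk
  have hsph : Metric.sphere (((e₁ + μ)⁻¹ : ℝ) : ℂ) R ⊆ resolventSet ℂ (T k) :=
    hT.sphere_subset_resolventSet hR0.le hRt fun i => by
      by_cases hi : i = n + 1
      · exact hi ▸ ((hR _ (hT.one_le_band_add _ _)).1 hk.1).ne
      by_cases hi' : i = n
      · exact hi' ▸ ((hR _ (hT.one_le_band_add _ _)).1 hk.2.1).ne
      · exact ((hR _ (hT.one_le_band_add _ _)).2 (hk.2.2 i hi hi')).ne'
  refine ⟨contDiffAt_rieszProjector_comp hR0.le hT.contDiff.contDiffAt hsph, fun hne => ?_⟩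
  refine hT.ext_eigenspaces k fun e u hu => ?_
  by_cases hb : eigenspace a V k e = ⊥
  · rw [hb, Submodule.mem_bot] at hu
    rw [hu, map_zero, map_zero]
  obtain ⟨i, rfl⟩ := hT.exists_band_eq hb
  rw [_root_.add_apply]
  by_cases hi : band a V i k = band a V (n + 1) k
  · rw [hi] at hu
    rw [eigenprojector_apply_of_mem hu, hT.eigenprojector_apply_of_ne hne hu, add_zero,
      hT.rieszProjector_apply_of_lt hsph ((hR _ (hT.one_le_band_add _ _)).1 hk.1) hu]
  by_cases hi' : band a V i k = band a V n k
  · rw [hi'] at hu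
    rw [eigenprojector_apply_of_mem hu, hT.eigenprojector_apply_of_ne hne.symm hu, zero_add,
      hT.rieszProjector_apply_of_lt hsph ((hR _ (hT.one_le_band_add _ _)).1 hk.2.1) hu]
  · rw [hT.eigenprojector_apply_of_ne hi hu, hT.eigenprojector_apply_of_ne hi' hu, add_zero,
      hT.rieszProjector_apply_of_gt hR0.le hsph ((hR _ (hT.one_le_band_add _ _)).2
        (hk.2.2 i (fun h => hi (h ▸ rfl)) fun h => hi' (h ▸ rfl))) hu]

end IsResolventFamily

/-! ### Blow-up of a band crossing. -/

section Crossing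

variable {H : Type*} [NormedAddCommGroup H] [NormedSpace ℂ H]

/-- Two bounded projectors which annihilate each other. -/
structure IsProjectorPair (P Q : H →L[ℂ] H) : Prop where
  mul_self_left : P * P = P
  mul_self_right : Q * Q = Q
  mul_eq_zero : P * Q = 0
  mul_eq_zero' : Q * P = 0
  norm_left : ‖P‖ ≤ 1
  norm_right : ‖Q‖ ≤ 1

namespace IsProjectorPair

variable {P Q : H →L[ℂ] H}

/-- Every vector splits as `P w + Q w + (w - P w - Q w)`, with eigenvalues `s`, `t` and `0`; only
`s` lies inside the circle. -/
theorem rieszProjector_eq [CompleteSpace H] (h : IsProjectorPair P Q) {s t c : ℂ} {R : ℝ}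
    (hs : ‖s - c‖ < R) (ht : R < ‖t - c‖) (h0 : R < ‖c‖)
    (hres : Metric.sphere c R ⊆ resolventSet ℂ (s • P + t • Q)) :
    rieszProjector c R (s • P + t • Q) = P := by
  have hR : 0 ≤ R := (norm_nonneg _).trans hs.le
  have hPP : ∀ w, P (P w) = P w := fun w => congrArg (fun B : H →L[ℂ] H => B w) h.mul_self_left
  have hQQ : ∀ w, Q (Q w) = Q w := fun w => congrArg (fun B : H →L[ℂ] H => B w) h.mul_self_right
  have hPQ : ∀ w, P (Q w) = 0 := fun w => congrArg (fun B : H →L[ℂ] H => B w) h.mul_eq_zero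
  have hQP : ∀ w, Q (P w) = 0 := fun w => congrArg (fun B : H →L[ℂ] H => B w) h.mul_eq_zero'
  have happ : ∀ w, (s • P + t • Q) w = s • P w + t • Q w := fun w => rfl
  ext1 w
  have h1 := rieszProjector_apply_of_lt hres (t := s) (u := P w)
    (by rw [happ, hPP, hQP, smul_zero, add_zero]) hs
  have h2 := rieszProjector_apply_of_gt hR hres (t := t) (u := Q w)
    (by rw [happ, hQQ, hPQ, smul_zero, zero_add]) ht
  have h3 := rieszProjector_apply_of_gt hR hres (t := 0) (u := w - P w - Q w)
    (by simp [happ, hPP, hQQ, hPQ, hQP]) (by simpa using h0)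
  rw [map_sub, map_sub, h1, h2, sub_zero, sub_eq_zero] at h3
  exact h3

/-- The eigenvalues lie among `0`, `s`, `t`. Stated as a polynomial identity, this passes to the
limit at a crossing, where convergence of `P` and `Q` themselves is not yet known. -/
theorem cubic_eq_zero (h : IsProjectorPair P Q) (s t : ℂ) :
    (s • P + t • Q) * ((s • P + t • Q) - s • 1) * ((s • P + t • Q) - t • 1) = 0 := by
  have h1 : (s • P + t • Q) * ((s • P + t • Q) - s • 1) = (t * (t - s)) • Q := by
    simp only [mul_sub, add_mul, mul_add, smul_mul_smul_comm, h.mul_self_left, h.mul_self_right,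
      h.mul_eq_zero, h.mul_eq_zero', smul_zero, mul_one, mul_smul]
    module
  rw [h1]
  simp only [mul_sub, mul_add, smul_mul_smul_comm, h.mul_self_right, h.mul_eq_zero', smul_zero,
    mul_one]
  module

theorem norm_smul_add_smul_le (h : IsProjectorPair P Q) (s t : ℂ) :
    ‖s • P + t • Q‖ ≤ ‖s‖ + ‖t‖ := by
  refine (norm_add_le _ _).trans (add_le_add ?_ ?_)
  · rw [norm_smul]
    exact mul_le_of_le_one_right (norm_nonneg _) h.norm_left
  · rw [norm_smul]
    exact mul_le_of_le_one_right (norm_nonneg _) h.norm_right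

end IsProjectorPair

/-- By spectral mapping the spectrum lies in `{0, s, t}`, and the circle about `s` avoids all three
points. -/
theorem sphere_subset_resolventSet_of_cubic {A : H →L[ℂ] H} {s t : ℂ} {R : ℝ} (hR : 0 < R)
    (h0 : R < ‖s‖) (ht : R < ‖t - s‖) (hA : A * (A - s • 1) * (A - t • 1) = 0) :
    Metric.sphere s R ⊆ resolventSet ℂ A := by
  intro z hz
  rw [mem_sphere_iff_norm] at hz
  rcases subsingleton_or_nontrivial (H →L[ℂ] H) with hsub | hnt
  · exact isUnit_of_subsingleton _
  by_contra hcon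
  have h1 : z ∈ spectrum ℂ A := hcon
  have h2 := spectrum.subset_polynomial_aeval A
    (Polynomial.X * (Polynomial.X - Polynomial.C s) * (Polynomial.X - Polynomial.C t))
    ⟨z, h1, rfl⟩
  have h3 : Polynomial.aeval A
      (Polynomial.X * (Polynomial.X - Polynomial.C s) * (Polynomial.X - Polynomial.C t)) = 0 := by
    simp only [map_mul, map_sub, Polynomial.aeval_X, Polynomial.aeval_C, Algebra.algebraMap_eq_smul_one]
    exact hA
  rw [h3, spectrum.zero_eq, Set.mem_singleton_iff] at h2
  simp only [Polynomial.eval_mul, Polynomial.eval_sub, Polynomial.eval_X, Polynomial.eval_C,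
    mul_eq_zero] at h2
  rcases h2 with (h2 | h2) | h2
  · rw [h2, zero_sub, norm_neg] at hz
    exact h0.ne' hz
  · rw [h2, norm_zero] at hz
    exact hR.ne hz
  · rw [sub_eq_zero.1 h2] at hz
    exact ht.ne' hz

/-- A function which is smooth near a point agrees near this point with a smooth function. -/
theorem exists_contDiff_eventuallyEq {X : Type*} [NormedAddCommGroup X] [NormedSpace ℝ X]
    {B : Plane → X} {k₀ : Plane} (hB : ∀ᶠ k in nhds k₀, ContDiffAt ℝ ∞ B k) :
    ∃ B' : Plane → X, ContDiff ℝ ∞ B' ∧ B' =ᶠ[nhds k₀] B := by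
  obtain ⟨ε, hε, hball⟩ := Metric.eventually_nhds_iff.1 hB
  let χ : ContDiffBump k₀ := ⟨ε / 4, ε / 2, by positivity, by linarith⟩
  refine ⟨fun k => χ k • B k, contDiff_iff_contDiffAt.2 fun k => ?_, ?_⟩
  · by_cases hk : dist k k₀ < ε
    · exact χ.contDiff.contDiffAt.smul (hball hk)
    · have h1 : ∀ᶠ k' in nhds k, ε / 2 < dist k' k₀ :=
        (continuous_id.dist continuous_const).continuousAt.eventually (lt_mem_nhds (by
          simp only [id_eq]
          linarith [not_lt.1 hk]))
      have h2 : (fun k => χ k • B k) =ᶠ[nhds k] fun _ => 0 := by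
        filter_upwards [h1] with k' hk'
        rw [χ.zero_of_le_dist hk'.le, zero_smul]
      exact contDiffAt_const.congr_of_eventuallyEq h2
  · filter_upwards [χ.eventuallyEq_one] with k hk
    rw [hk, Pi.one_apply, one_smul]

theorem tendsto_smul_punctured {v : Plane} (hv : v ∈ Metric.sphere (0 : Plane) 1) :
    Filter.Tendsto (fun x : ℝ × Plane => x.1 • x.2) (nhdsWithin 0 (Set.Ioi 0) ×ˢ nhds v)
      (nhdsWithin 0 {0}ᶜ) := by
  have hv0 : v ≠ 0 := by
    rintro rfl
    simp at hv
  refine tendsto_nhdsWithin_iff.2 ⟨?_, ?_⟩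
  · have h1 : Continuous fun x : ℝ × Plane => x.1 • x.2 := by fun_prop
    have h2 := h1.tendsto (0, v)
    rw [zero_smul, nhds_prod_eq] at h2
    exact h2.mono_left (Filter.prod_mono nhdsWithin_le_nhds le_rfl)
  · have h1 : ∀ᶠ w in nhds v, w ≠ 0 := isOpen_ne.mem_nhds hv0
    filter_upwards [Filter.Eventually.prod_mk
      (self_mem_nhdsWithin : ∀ᶠ t in nhdsWithin (0 : ℝ) (Set.Ioi 0), t ∈ Set.Ioi 0) h1] with x hx
    exact smul_ne_zero (ne_of_gt hx.1) hx.2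

theorem eventually_nhds_of_prod {v : Plane} {φ : ℝ × Plane → Prop}
    (h : ∀ᶠ x in nhdsWithin (0 : ℝ) (Set.Ioi 0) ×ˢ nhds v, φ x) :
    ∀ᶠ x in nhds ((0 : ℝ), v), 0 < x.1 → φ x := by
  rw [← nhdsWithin_univ v, ← nhdsWithin_prod_eq, eventually_nhdsWithin_iff] at h
  filter_upwards [h] with x hx hx0
  exact hx ⟨hx0, Set.mem_univ _⟩

/-- The spectral projector of a family of operators with an eigenvalue crossing of order `m` extends
smoothly up to the crossing in polar coordinates. -/
theorem exists_polar_extension [CompleteSpace H] {B P Q : Plane → H →L[ℂ] H} {b c : Plane → ℝ} {k₀ : Plane} {m : ℕ}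
    {τ σ : ℝ} (hτ : τ ≠ 0) (hτσ : τ ≠ σ)
    (hB : ∀ᶠ k in nhds k₀, ContDiffAt ℝ ∞ B k)
    (hBe : ∀ᶠ q in nhdsWithin (0 : Plane) {0}ᶜ, IsProjectorPair (P (k₀ + q)) (Q (k₀ + q)) ∧
      B (k₀ + q) = (b (k₀ + q) : ℂ) • P (k₀ + q) + (c (k₀ + q) : ℂ) • Q (k₀ + q))
    (hb : Filter.Tendsto (fun q => b (k₀ + q) / ‖q‖ ^ m) (nhdsWithin 0 {0}ᶜ) (nhds τ))
    (hc : Filter.Tendsto (fun q => c (k₀ + q) / ‖q‖ ^ m) (nhdsWithin 0 {0}ᶜ) (nhds σ)) :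
    ∃ p : ℝ × Plane → H →L[ℂ] H, ∀ v ∈ Metric.sphere (0 : Plane) 1, ∀ᶠ x in nhds ((0 : ℝ), v),
      ContDiffAt ℝ ∞ p x ∧ (0 < x.1 → P (k₀ + x.1 • x.2) = p x) := by
  obtain ⟨B', hB', hBB'⟩ := exists_contDiff_eventuallyEq hB
  have hadd : Filter.Tendsto (fun q => k₀ + q) (nhdsWithin (0 : Plane) {0}ᶜ) (nhds k₀) := by
    have h1 : Continuous fun q : Plane => k₀ + q := by fun_prop
    have h2 := h1.tendsto 0
    rw [add_zero] at h2
    exact h2.mono_left nhdsWithin_le_nhds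
  have hBe' : ∀ᶠ q in nhdsWithin (0 : Plane) {0}ᶜ, IsProjectorPair (P (k₀ + q)) (Q (k₀ + q)) ∧
      B' (k₀ + q) = (b (k₀ + q) : ℂ) • P (k₀ + q) + (c (k₀ + q) : ℂ) • Q (k₀ + q) := by
    filter_upwards [hBe, hadd.eventually hBB'] with q hq hq'
    exact ⟨hq.1, hq'.trans hq.2⟩
  set C := |τ| + 1 + (|σ| + 1) with hC
  have hbound : ∀ᶠ q in nhdsWithin (0 : Plane) {0}ᶜ, ‖B' (k₀ + q)‖ ≤ C * ‖q‖ ^ m := by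
    filter_upwards [hBe', hb.abs.eventually (gt_mem_nhds (lt_add_one _)),
      hc.abs.eventually (gt_mem_nhds (lt_add_one _)), self_mem_nhdsWithin] with q hq hbq hcq hq0
    have hq0' : 0 < ‖q‖ ^ m := pow_pos (norm_pos_iff.2 hq0) m
    rw [abs_div, abs_of_pos hq0', div_lt_iff₀ hq0'] at hbq hcq
    rw [hq.2]
    refine (hq.1.norm_smul_add_smul_le _ _).trans ?_
    rw [Complex.norm_real, Complex.norm_real, Real.norm_eq_abs, Real.norm_eq_abs, hC, add_mul]
    exact add_le_add hbq.le hcq.le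
  -- Hadamard division is applied for every `v`, including `v = 0`, so the estimate is needed at `q
  -- = 0` too; it follows by continuity.
  have hbound0 : ‖B' k₀‖ ≤ C * ‖(0 : Plane)‖ ^ m := by
    have h1 : Filter.Tendsto (fun q => ‖B' (k₀ + q)‖) (nhdsWithin (0 : Plane) {0}ᶜ) (nhds ‖B' k₀‖) :=
      ((hB'.continuous.tendsto k₀).comp hadd).norm
    have h2 : Continuous fun q : Plane => C * ‖q‖ ^ m := by fun_prop
    exact le_of_tendsto_of_tendsto h1 ((h2.tendsto 0).mono_left nhdsWithin_le_nhds) hbound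
  have hbound' : ∀ᶠ q in nhds (0 : Plane), ‖B' (k₀ + q)‖ ≤ C * ‖q‖ ^ m := by
    filter_upwards [eventually_nhdsWithin_iff.1 hbound] with q hq
    by_cases hq0 : q = 0
    · rw [hq0, add_zero]
      exact hbound0
    · exact hq hq0
  obtain ⟨G, hG, hBG⟩ := exists_eq_pow_smul m (f := fun x : ℝ × Plane => B' (k₀ + x.1 • x.2))
    (hB'.comp (by fun_prop)) fun v => ⟨C * ‖v‖ ^ m, by
      have h1 : Filter.Tendsto (fun t : ℝ => t • v) (nhdsWithin 0 (Set.Ioi 0)) (nhds 0) := by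
        have h2 : Continuous fun t : ℝ => t • v := by fun_prop
        have h3 := h2.tendsto 0
        rw [zero_smul] at h3
        exact h3.mono_left nhdsWithin_le_nhds
      filter_upwards [h1.eventually hbound', self_mem_nhdsWithin] with t ht ht0
      rw [norm_smul, Real.norm_of_nonneg (le_of_lt ht0), mul_pow] at ht
      refine ht.trans_eq (by ring)⟩
  -- Half the distance from `τ` to the other possible spectral points `0` and `σ` of the limit.
  set R := min |τ| |σ - τ| / 2 with hR
  have hR0 : 0 < R := half_pos (lt_min (abs_pos.2 hτ) (abs_pos.2 (sub_ne_zero.2 hτσ.symm)))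
  have hR1 : R < |τ| := (half_lt_self (by linarith)).trans_le (min_le_left _ _)
  have hR2 : R < |σ - τ| := (half_lt_self (by linarith)).trans_le (min_le_right _ _)
  refine ⟨fun x => rieszProjector (τ : ℂ) R (G x), fun v hv => ?_⟩
  have hv1 : ‖v‖ = 1 := mem_sphere_zero_iff_norm.1 hv
  set L := nhdsWithin (0 : ℝ) (Set.Ioi 0) ×ˢ nhds v with hL
  have hLnhds : L ≤ nhds ((0 : ℝ), v) := by
    rw [nhds_prod_eq]
    exact Filter.prod_mono nhdsWithin_le_nhds le_rfl
  have hsm := tendsto_smul_punctured hv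
  -- For `x.1 > 0` and `x.2 ≠ 0` this is `b / x.1 ^ m`, the eigenvalue of `G x`. The factor `‖x.2‖ ^
  -- m` tends to `1`, so the limit along each direction is the given one.
  let S : (Plane → ℝ) → ℝ × Plane → ℝ := fun b x =>
    b (k₀ + x.1 • x.2) / ‖x.1 • x.2‖ ^ m * ‖x.2‖ ^ m
  have hS : ∀ {b : Plane → ℝ} {τ : ℝ},
      Filter.Tendsto (fun q => b (k₀ + q) / ‖q‖ ^ m) (nhdsWithin 0 {0}ᶜ) (nhds τ) →
      Filter.Tendsto (S b) L (nhds τ) := fun {b τ} h => by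
    have h1 : Continuous fun x : ℝ × Plane => ‖x.2‖ ^ m := by fun_prop
    have h2 := (h1.tendsto (0, v)).mono_left hLnhds
    simp only [hv1, one_pow] at h2
    simpa using (h.comp hsm).mul h2
  have hGe : ∀ᶠ x in L, IsProjectorPair (P (k₀ + x.1 • x.2)) (Q (k₀ + x.1 • x.2)) ∧
      G x = (S b x : ℂ) • P (k₀ + x.1 • x.2) + (S c x : ℂ) • Q (k₀ + x.1 • x.2) := by
    have hpos : ∀ᶠ x in L, 0 < x.1 ∧ x.2 ≠ 0 :=
      Filter.Eventually.prod_mk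
      (self_mem_nhdsWithin : ∀ᶠ t in nhdsWithin (0 : ℝ) (Set.Ioi 0), t ∈ Set.Ioi 0)
        (isOpen_ne.mem_nhds (by
          rintro rfl
          simp at hv1))
    filter_upwards [hsm.eventually hBe', hpos] with x hx hx0
    refine ⟨hx.1, ?_⟩
    have hx1 : (0 : ℝ) < x.1 ^ m := pow_pos hx0.1 m
    have hSx : ∀ b : Plane → ℝ, S b x = (x.1 ^ m)⁻¹ * b (k₀ + x.1 • x.2) := fun b => by
      have h2 : ‖x.2‖ ^ m ≠ 0 := pow_ne_zero _ (norm_ne_zero_iff.2 hx0.2)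
      simp only [S]
      rw [norm_smul, Real.norm_of_nonneg hx0.1.le, mul_pow]
      field_simp
    have h3 : G x = (x.1 ^ m)⁻¹ • B' (k₀ + x.1 • x.2) := by
      rw [hBG x, inv_smul_smul₀ hx1.ne']
    rw [h3, hx.2, hSx, hSx, smul_add, Complex.ofReal_mul, Complex.ofReal_mul, mul_smul, mul_smul]
    simp only [Complex.coe_smul]
  have hGt : Filter.Tendsto G L (nhds (G (0, v))) := (hG.continuous.tendsto _).mono_left hLnhds
  -- The cubic identities for `x.1 > 0` converge because `G` is continuous and the eigenvalues tend
  -- to `τ` and `σ`.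
  have hcub : G (0, v) * (G (0, v) - (τ : ℂ) • 1) * (G (0, v) - (σ : ℂ) • 1) = 0 := by
    have h1 := (Complex.continuous_ofReal.tendsto τ).comp (hS hb)
    have h2 := (Complex.continuous_ofReal.tendsto σ).comp (hS hc)
    have h3 := (hGt.mul (hGt.sub (h1.smul_const (1 : H →L[ℂ] H)))).mul
      (hGt.sub (h2.smul_const (1 : H →L[ℂ] H)))
    refine tendsto_nhds_unique h3 (tendsto_const_nhds.congr' ?_)
    filter_upwards [hGe] with x hx
    rw [hx.2]
    exact (hx.1.cubic_eq_zero _ _).symm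
  have hnorm : ∀ x y : ℝ, ‖(x : ℂ) - y‖ = |x - y| := fun x y => by
    rw [← Complex.ofReal_sub, Complex.norm_real, Real.norm_eq_abs]
  have hτn : ‖(τ : ℂ)‖ = |τ| := by rw [Complex.norm_real, Real.norm_eq_abs]
  have hres := sphere_subset_resolventSet_of_cubic hR0 (hR1.trans_eq hτn.symm)
    (hR2.trans_eq (hnorm _ _).symm) hcub
  have hresx : ∀ᶠ x in nhds ((0 : ℝ), v), Metric.sphere (τ : ℂ) R ⊆ resolventSet ℂ (G x) :=
    (hG.continuous.tendsto _).eventually (eventually_sphere_subset_resolventSet hres)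
  have hsmall : ∀ᶠ x in L, |S b x - τ| < R := by
    have := (((hS hb).sub_const τ).abs).eventually (gt_mem_nhds (show |τ - τ| < R by simpa using hR0))
    exact this
  have hlarge : ∀ᶠ x in L, R < |S c x - τ| :=
    (((hS hc).sub_const τ).abs).eventually (lt_mem_nhds hR2)
  have hfin : ∀ᶠ x in L, P (k₀ + x.1 • x.2) = rieszProjector (τ : ℂ) R (G x) := by
    filter_upwards [hGe, hsmall, hlarge, hLnhds hresx] with x hx h1 h2 h3
    have h3' : Metric.sphere (τ : ℂ) R ⊆ resolventSet ℂ (G x) := h3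
    rw [hx.2] at h3' ⊢
    exact (hx.1.rieszProjector_eq ((hnorm _ _).trans_lt h1) (h2.trans_eq (hnorm _ _).symm)
      (hR1.trans_eq hτn.symm) h3').symm
  filter_upwards [hresx, eventually_nhds_of_prod hfin] with x hx1 hx2
  exact ⟨contDiffAt_rieszProjector_comp hR0.le hG.contDiffAt hx1, hx2⟩

end Crossing

/-! ### A vector on which no limiting projector vanishes. -/

section RankOne

variable {H : Type*} [NormedAddCommGroup H] [InnerProductSpace ℂ H]

/-- Orthogonal projectors of rank one. -/
structure IsRankOneProjector (P : H →L[ℂ] H) : Prop where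
  mul_self : P * P = P
  symm : ∀ x y, inner ℂ (P x) y = inner ℂ x (P y)
  rank : ∀ x y z w, inner ℂ x (P y) * inner ℂ z (P w) = inner ℂ x (P w) * inner ℂ z (P y)
  norm : ‖P‖ = 1

namespace IsRankOneProjector

/-- All four conditions are closed under norm limits. This is why rank one is expressed by vanishing
minors of matrix elements and `‖P‖ = 1`. -/
theorem of_tendsto {ι : Type*} {L : Filter ι} [L.NeBot] {F : ι → H →L[ℂ] H} {P : H →L[ℂ] H}
    (hF : Filter.Tendsto F L (nhds P)) (h : ∀ᶠ i in L, IsRankOneProjector (F i)) :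
    IsRankOneProjector P := by
  have happ : ∀ x, Filter.Tendsto (fun i => F i x) L (nhds (P x)) := fun x =>
    ((ContinuousLinearMap.apply ℂ H x).continuous.tendsto P).comp hF
  have hin : ∀ x y, Filter.Tendsto (fun i => inner ℂ x (F i y)) L (nhds (inner ℂ x (P y))) :=
    fun x y => tendsto_const_nhds.inner (happ y)
  constructor
  · refine tendsto_nhds_unique (hF.mul hF) (hF.congr' ?_)
    filter_upwards [h] with i hi
    exact hi.mul_self.symm
  · intro x y
    refine tendsto_nhds_unique ((happ x).inner tendsto_const_nhds) ((hin x y).congr' ?_)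
    filter_upwards [h] with i hi
    exact (hi.symm x y).symm
  · intro x y z w
    refine tendsto_nhds_unique ((hin x y).mul (hin z w)) (((hin x w).mul (hin z y)).congr' ?_)
    filter_upwards [h] with i hi
    exact (hi.rank x y z w).symm
  · refine tendsto_nhds_unique hF.norm (tendsto_const_nhds.congr' ?_)
    filter_upwards [h] with i hi
    exact hi.norm.symm

variable {P Q : H →L[ℂ] H}

theorem apply_apply (h : IsRankOneProjector P) (x : H) : P (P x) = P x :=
  congrArg (fun B : H →L[ℂ] H => B x) h.mul_self

theorem exists_unit (h : IsRankOneProjector P) : ∃ f, ‖f‖ = 1 ∧ P f = f := by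
  obtain ⟨x, hx⟩ : ∃ x, P x ≠ 0 := by
    by_contra! hcon
    have h0 : P = 0 := ContinuousLinearMap.ext hcon
    have h1 := h.norm
    rw [h0, norm_zero] at h1
    exact zero_ne_one h1
  refine ⟨((‖P x‖⁻¹ : ℝ) : ℂ) • P x, ?_, ?_⟩
  · rw [norm_smul, Complex.norm_real, norm_inv, norm_norm, inv_mul_cancel₀ (norm_ne_zero_iff.2 hx)]
  · rw [map_smul, h.apply_apply]

/-- `w` is the affine coordinate of the range of `Q` in the projective line over `f₁`, `f₂`,
recovered from matrix elements of `Q` and therefore as smooth as `Q`. -/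
theorem eq_div_of_apply_eq (h : IsRankOneProjector Q) {f₁ f₂ : H} {w : ℂ}
    (h₁ : ‖f₁‖ = 1) (h₂ : ‖f₂‖ = 1) (h₁₂ : inner ℂ f₁ f₂ = 0) (hw : Q (f₁ + w • f₂) = f₁ + w • f₂) :
    inner ℂ f₁ (Q f₁) ≠ 0 ∧ inner ℂ f₂ (Q f₁) / inner ℂ f₁ (Q f₁) = w := by
  have h₂₁ : inner ℂ f₂ f₁ = 0 := by rw [← inner_conj_symm, h₁₂, map_zero]
  have h11 : inner ℂ f₁ f₁ = (1 : ℂ) := by rw [inner_self_eq_norm_sq_to_K, h₁]; simp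
  have h22 : inner ℂ f₂ f₂ = (1 : ℂ) := by rw [inner_self_eq_norm_sq_to_K, h₂]; simp
  have he1 : inner ℂ f₁ (f₁ + w • f₂) = (1 : ℂ) := by
    rw [inner_add_right, inner_smul_right, h11, h₁₂, mul_zero, add_zero]
  have hr : ∀ x, inner ℂ x (f₁ + w • f₂) * inner ℂ f₁ (Q f₁) = inner ℂ x (Q f₁) := fun x => by
    have := h.rank x (f₁ + w • f₂) f₁ f₁
    rw [hw, he1, mul_one] at this
    exact this
  have hne : inner ℂ f₁ (Q f₁) ≠ 0 := fun h0 => by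
    have h3 := hr (f₁ + w • f₂)
    rw [h0, mul_zero, ← h.symm, hw, ← inner_conj_symm, he1, map_one] at h3
    exact zero_ne_one h3
  refine ⟨hne, ?_⟩
  rw [div_eq_iff hne, ← hr f₂, inner_add_right, inner_smul_right, h₂₁, h22, mul_one, zero_add]

end IsRankOneProjector

/-- A `C¹` map does not raise Hausdorff dimension, so the image has dimension at most `1`, less than
that of `ℂ`. -/
theorem exists_notMem_image_of_contDiffAt {h : ℝ → ℂ} {S : Set ℝ}
    (hh : ∀ θ ∈ S, ContDiffAt ℝ 1 h θ) : ∃ w, w ∉ h '' S := by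
  have h1 : dimH (h '' S) ≤ dimH S := dimH_image_le_of_locally_lipschitzOn fun θ hθ => by
    obtain ⟨C, t, ht, hC⟩ := (hh θ hθ).exists_lipschitzOnWith
    exact ⟨C, t, mem_nhdsWithin_of_mem_nhds ht, hC⟩
  have h2 : dimH (h '' S) < Module.finrank ℝ ℂ := by
    refine (h1.trans (dimH_mono (Set.subset_univ S))).trans_lt ?_
    rw [Real.dimH_univ, Complex.finrank_real_complex]
    norm_num
  exact (dense_compl_of_dimH_lt_finrank h2).nonempty

theorem exists_cos_sin_eq {v : Plane} (hv : ‖v‖ = 1) :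
    ∃ θ : ℝ, v = !₂[Real.cos θ, Real.sin θ] := by
  have hsq : v 0 ^ 2 + v 1 ^ 2 = 1 := by
    have := EuclideanSpace.real_norm_sq_eq v
    rw [hv, Fin.sum_univ_two] at this
    linarith
  set z : ℂ := ⟨v 0, v 1⟩ with hz
  have hzn : ‖z‖ = 1 := by
    rw [Complex.norm_def, Complex.normSq_apply, Real.sqrt_eq_one]
    change v 0 * v 0 + v 1 * v 1 = 1
    linarith
  have hz0 : z ≠ 0 := fun h => by simp [h] at hzn
  refine ⟨z.arg, ?_⟩
  rw [Complex.cos_arg hz0, Complex.sin_arg, hzn, div_one, div_one]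
  ext i
  fin_cases i <;> rfl

theorem contDiff_cos_sin : ContDiff ℝ ∞ fun θ : ℝ => (!₂[Real.cos θ, Real.sin θ] : Plane) := by
  rw [contDiff_euclidean]
  intro i
  fin_cases i
  · exact Real.contDiff_cos
  · exact Real.contDiff_sin

theorem norm_cos_sin (θ : ℝ) : ‖(!₂[Real.cos θ, Real.sin θ] : Plane)‖ = 1 := by
  rw [EuclideanSpace.norm_eq, Fin.sum_univ_two, Real.sqrt_eq_one]
  simp

theorem tendsto_of_polar_extension {X : Type*} [TopologicalSpace X] {P : Plane → X}
    {p : ℝ × Plane → X} {k₀ v : Plane} (hc : ContinuousAt p (0, v))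
    (hp : ∀ᶠ x in nhds ((0 : ℝ), v), 0 < x.1 → P (k₀ + x.1 • x.2) = p x) :
    Filter.Tendsto (fun x : ℝ × Plane => P (k₀ + x.1 • x.2))
      (nhdsWithin 0 (Set.Ioi 0) ×ˢ nhds v) (nhds (p (0, v))) := by
  have hL : nhdsWithin (0 : ℝ) (Set.Ioi 0) ×ˢ nhds v ≤ nhds ((0 : ℝ), v) := by
    rw [nhds_prod_eq]
    exact Filter.prod_mono nhdsWithin_le_nhds le_rfl
  refine (hc.tendsto.mono_left hL).congr' ?_
  filter_upwards [hL hp, (Filter.Eventually.prod_inl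
    (self_mem_nhdsWithin : ∀ᶠ t in nhdsWithin (0 : ℝ) (Set.Ioi 0), t ∈ Set.Ioi 0) (nhds v))]
    with x hx hx0
  exact (hx hx0).symm

/-- A vector on which the limiting projectors of one band vanish in no direction. -/
theorem exists_forall_apply_ne_zero {P Q S : Plane → H →L[ℂ] H} {p q : ℝ × Plane → H →L[ℂ] H}
    {k₀ : Plane}
    (hp : ∀ v ∈ Metric.sphere (0 : Plane) 1, ∀ᶠ x in nhds ((0 : ℝ), v),
      ContDiffAt ℝ ∞ p x ∧ (0 < x.1 → P (k₀ + x.1 • x.2) = p x))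
    (hq : ∀ v ∈ Metric.sphere (0 : Plane) 1, ∀ᶠ x in nhds ((0 : ℝ), v),
      ContDiffAt ℝ ∞ q x ∧ (0 < x.1 → Q (k₀ + x.1 • x.2) = q x))
    (hPQ : ∀ᶠ k in nhdsWithin (0 : Plane) {0}ᶜ, IsRankOneProjector (P (k₀ + k)) ∧
      IsRankOneProjector (Q (k₀ + k)) ∧ P (k₀ + k) * Q (k₀ + k) = 0 ∧
      S (k₀ + k) = P (k₀ + k) + Q (k₀ + k))
    (hS : ContinuousAt S k₀) :
    ∃ e, ∀ v ∈ Metric.sphere (0 : Plane) 1, p (0, v) e ≠ 0 := by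
  -- The limits in all directions are complementary rank-one projectors with the same sum `S k₀`, by
  -- continuity of `S`.
  have key : ∀ v ∈ Metric.sphere (0 : Plane) 1, IsRankOneProjector (p (0, v)) ∧
      IsRankOneProjector (q (0, v)) ∧ p (0, v) * q (0, v) = 0 ∧ S k₀ = p (0, v) + q (0, v) := by
    intro v hv
    have hPt := tendsto_of_polar_extension (hp v hv).self_of_nhds.1.continuousAt
      ((hp v hv).mono fun x hx => hx.2)
    have hQt := tendsto_of_polar_extension (hq v hv).self_of_nhds.1.continuousAt
      ((hq v hv).mono fun x hx => hx.2)
    have hsm := tendsto_smul_punctured hv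
    have hev := hsm.eventually hPQ
    have hSt : Filter.Tendsto (fun x : ℝ × Plane => S (k₀ + x.1 • x.2))
        (nhdsWithin 0 (Set.Ioi 0) ×ˢ nhds v) (nhds (S k₀)) := by
      have h1 : Filter.Tendsto (fun k : Plane => k₀ + k) (nhds 0) (nhds k₀) := by
        have h2 : Continuous fun k : Plane => k₀ + k := by fun_prop
        simpa using h2.tendsto 0
      exact hS.tendsto.comp (h1.comp (hsm.mono_right nhdsWithin_le_nhds))
    refine ⟨.of_tendsto hPt (hev.mono fun x hx => hx.1), .of_tendsto hQt (hev.mono fun x hx => hx.2.1),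
      ?_, ?_⟩
    · exact tendsto_nhds_unique (hPt.mul hQt)
        (tendsto_const_nhds.congr' (hev.mono fun x hx => hx.2.2.1.symm))
    · exact tendsto_nhds_unique hSt
        ((hPt.add hQt).congr' (hev.mono fun x hx => hx.2.2.2.symm))
  obtain ⟨v₀, hv₀⟩ : ∃ v₀, v₀ ∈ Metric.sphere (0 : Plane) 1 :=
    ⟨_, mem_sphere_zero_iff_norm.2 (norm_cos_sin 0)⟩
  obtain ⟨hp₀, hq₀, hpq₀, hS₀⟩ := key v₀ hv₀
  obtain ⟨f₁, hf₁, hpf₁⟩ := hp₀.exists_unit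
  obtain ⟨f₂, hf₂, hqf₂⟩ := hq₀.exists_unit
  have hpf₂ : p (0, v₀) f₂ = 0 := by
    rw [← hqf₂]
    exact congrArg (fun B : H →L[ℂ] H => B f₂) hpq₀
  have h₁₂ : inner ℂ f₁ f₂ = 0 := by
    rw [← hpf₁, hp₀.symm, hpf₂, inner_zero_right]
  have hqf₁ : q (0, v₀) f₁ = 0 := by
    refine ext_inner_left ℂ fun x => ?_
    rw [← hq₀.symm, ← hpf₁, ← hp₀.symm, inner_zero_right]
    rw [show p (0, v₀) (q (0, v₀) x) = 0 from congrArg (fun B : H →L[ℂ] H => B x) hpq₀,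
      inner_zero_left]
  have hSe : ∀ w : ℂ, S k₀ (f₁ + w • f₂) = f₁ + w • f₂ := fun w => by
    rw [hS₀, _root_.add_apply, map_add, map_add, map_smul, map_smul, hpf₁, hpf₂, hqf₁, hqf₂]
    simp
  -- The coordinate, in the basis `f₁`, `f₂`, of the range of the lower limiting projector in
  -- direction `θ`. Only angles with nonzero denominator matter.
  let h : ℝ → ℂ := fun θ => inner ℂ f₂ (q (0, !₂[Real.cos θ, Real.sin θ]) f₁) /
    inner ℂ f₁ (q (0, !₂[Real.cos θ, Real.sin θ]) f₁)
  obtain ⟨w, hw⟩ := exists_notMem_image_of_contDiffAt (h := h)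
    (S := {θ | inner ℂ f₁ (q (0, !₂[Real.cos θ, Real.sin θ]) f₁) ≠ 0}) fun θ hθ => by
      have h1 : ContDiffAt ℝ 1 q (0, !₂[Real.cos θ, Real.sin θ]) :=
        (hq _ (mem_sphere_zero_iff_norm.2 (norm_cos_sin θ))).self_of_nhds.1.of_le (by exact_mod_cast le_top)
      have h2 : ContDiffAt ℝ 1 (fun θ : ℝ => ((0 : ℝ), (!₂[Real.cos θ, Real.sin θ] : Plane))) θ :=
        contDiffAt_const.prodMk (contDiff_cos_sin.contDiffAt.of_le (by exact_mod_cast le_top))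
      have h3 : ContDiffAt ℝ 1 (fun θ : ℝ => q (0, !₂[Real.cos θ, Real.sin θ])) θ :=
        ContDiffAt.comp θ h1 h2
      have h4 : ∀ f : H, ContDiffAt ℝ 1
          (fun θ : ℝ => (inner ℂ f (q (0, !₂[Real.cos θ, Real.sin θ]) f₁) : ℂ)) θ := fun f =>
        (((innerSL ℂ f).comp (ContinuousLinearMap.apply ℂ H f₁)).restrictScalars
          ℝ).contDiff.contDiffAt.comp θ h3
      have h5 := (h4 f₂).mul ((h4 f₁).inv hθ)
      exact h5.congr_of_eventuallyEq (Filter.Eventually.of_forall fun θ' => div_eq_mul_inv _ _)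
  -- If the upper projector killed this vector, the lower one would fix it, since `S k₀` does; then
  -- `w` would be a value of `h`.
  refine ⟨f₁ + w • f₂, fun v hv h0 => hw ?_⟩
  obtain ⟨-, hqv, -, hSv⟩ := key v hv
  have hqe : q (0, v) (f₁ + w • f₂) = f₁ + w • f₂ := by
    have := hSe w
    rwa [hSv, _root_.add_apply, h0, zero_add] at this
  obtain ⟨θ, rfl⟩ := exists_cos_sin_eq (mem_sphere_zero_iff_norm.1 hv)
  obtain ⟨h1, h2⟩ := hqv.eq_div_of_apply_eq hf₁ hf₂ h₁₂ hqe
  exact ⟨θ, h1, h2⟩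

end RankOne

/-! ### Extension of a normalised section to a larger disc. -/

section Section

variable {H : Type*} [NormedAddCommGroup H] [InnerProductSpace ℂ H]

theorem contDiffAt_inv_norm_smul {E : Type*} [NormedAddCommGroup E] [NormedSpace ℝ E] {f : E → H}
    {x : E} (hf : ContDiffAt ℝ ∞ f x) (h0 : f x ≠ 0) :
    ContDiffAt ℝ ∞ (fun y => ‖f y‖⁻¹ • f y) x :=
  letI : InnerProductSpace ℝ H := InnerProductSpace.complexToReal
  ((hf.norm ℝ h0).inv (norm_ne_zero_iff.2 h0)).smul hf

theorem eventually_punctured_of_polar {φ : Plane → Prop}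
    (h : ∀ v ∈ Metric.sphere (0 : Plane) 1, ∀ᶠ x in nhds ((0 : ℝ), v), 0 < x.1 → φ (x.1 • x.2)) :
    ∀ᶠ q in nhdsWithin (0 : Plane) {0}ᶜ, φ q := by
  have h1 := (isCompact_sphere (0 : Plane) 1).eventually_forall_of_forall_eventually
    (P := fun t v => 0 < t → φ (t • v)) h
  have h2 : Filter.Tendsto (fun q : Plane => ‖q‖) (nhdsWithin 0 {0}ᶜ) (nhds 0) := by
    have := (continuous_norm (E := Plane)).tendsto 0
    rw [norm_zero] at this
    exact this.mono_left nhdsWithin_le_nhds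
  filter_upwards [h2.eventually h1, self_mem_nhdsWithin] with q hq hq0
  have hq1 : 0 < ‖q‖ := norm_pos_iff.2 hq0
  have h3 := hq (‖q‖⁻¹ • q) (by
    rw [mem_sphere_zero_iff_norm, norm_smul, norm_inv, norm_norm, inv_mul_cancel₀ hq1.ne']) hq1
  rwa [smul_inv_smul₀ hq1.ne'] at h3

/-- `u` is a smooth normalised section of the ranges of `P` on the punctured disc of radius `s`. -/
def IsSectionOn (P : Plane → H →L[ℂ] H) (k₀ : Plane) (s : ℝ) (u : Plane → H) : Prop :=
  ∀ k, 0 < dist k k₀ → dist k k₀ < s → ContDiffAt ℝ ∞ u k ∧ ‖u k‖ = 1 ∧ P k (u k) = u k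

theorem isSectionOn_inv_norm_smul {P : Plane → H →L[ℂ] H} {k₀ : Plane} {s : ℝ} {w : Plane → H}
    (hw : ∀ k, 0 < dist k k₀ → dist k k₀ < s → ContDiffAt ℝ ∞ w k ∧ w k ≠ 0 ∧ P k (w k) = w k) :
    IsSectionOn P k₀ s fun k => ‖w k‖⁻¹ • w k := fun k hk0 hk => by
  obtain ⟨h1, h2, h3⟩ := hw k hk0 hk
  refine ⟨contDiffAt_inv_norm_smul h1 h2, ?_, ?_⟩
  · rw [norm_smul, norm_inv, norm_norm, inv_mul_cancel₀ (norm_ne_zero_iff.2 h2)]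
  · dsimp only
    rw [← Complex.coe_smul, map_smul, h3]

/-- The section is pulled back by a radial contraction `g`, the identity near `k₀`, and then
projected. `P` is uniformly continuous on the annulus, so `‖P k - P (g k)‖ < 1` there and `P k (u (g
k))` cannot vanish. The admissible step `d` does not depend on `s`, so finitely many steps suffice.
-/
theorem exists_isSectionOn_step {P : Plane → H →L[ℂ] H} {k₀ : Plane} {r ρ : ℝ} (hρ : 0 < ρ)
    (hP : ∀ k, 0 < dist k k₀ → dist k k₀ ≤ r → ContDiffAt ℝ ∞ P k ∧ P k * P k = P k) :
    ∃ d, 0 < d ∧ ∀ d' s u, 0 < d' → d' ≤ d → ρ ≤ s → s + d' ≤ r → IsSectionOn P k₀ s u →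
      ∃ u', IsSectionOn P k₀ (s + d') u' ∧ ∀ k, 0 < dist k k₀ → dist k k₀ < ρ / 2 → u' k = u k := by
  have hA : IsCompact (Metric.closedBall k₀ r \ Metric.ball k₀ (ρ / 4)) :=
    (isCompact_closedBall k₀ r).diff Metric.isOpen_ball
  have hmemA : ∀ k, ρ / 4 ≤ dist k k₀ → dist k k₀ ≤ r →
      k ∈ Metric.closedBall k₀ r \ Metric.ball k₀ (ρ / 4) := fun k h1 h2 =>
    ⟨h2, fun h3 => not_lt.2 h1 h3⟩
  have hPc : ContinuousOn P (Metric.closedBall k₀ r \ Metric.ball k₀ (ρ / 4)) := fun k hk =>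
    (hP k ((by positivity : 0 < ρ / 4).trans_le (not_lt.1 hk.2)) hk.1).1.continuousAt.continuousWithinAt
  obtain ⟨d, hd, hPd⟩ := Metric.uniformContinuousOn_iff.1 (hA.uniformContinuousOn_of_continuous hPc)
    1 one_pos
  refine ⟨min (d / 2) ρ, lt_min (half_pos hd) hρ, fun d' s u hd'0 hd' hρs hsr hu => ?_⟩
  have hd'1 : d' < d := (hd'.trans (min_le_left _ _)).trans_lt (half_lt_self hd)
  have hd'2 : d' ≤ ρ := hd'.trans (min_le_right _ _)
  have hs0 : 0 < s := hρ.trans_le hρs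
  let χ : ContDiffBump k₀ := ⟨ρ / 2, ρ, half_pos hρ, half_lt_self hρ⟩
  -- This ratio shrinks radius `s + d'` to `s`. Since `d' ≤ ρ ≤ s` it is at least `1/2`, so points
  -- outside radius `ρ / 2` stay outside `ρ / 4`, where uniform continuity holds.
  obtain ⟨κ, hκ⟩ : ∃ κ, κ = s / (s + d') := ⟨_, rfl⟩
  have hκs : κ * (s + d') = s := by rw [hκ, div_mul_cancel₀ _ (by positivity)]
  have hκ0 : 1 / 2 ≤ κ := by
    rw [hκ, div_le_div_iff₀ two_pos (by positivity)]
    linarith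
  have hκ1 : κ ≤ 1 := by
    rw [hκ, div_le_one (by positivity)]
    linarith
  let l : Plane → ℝ := fun k => κ + (1 - κ) * χ k
  let g : Plane → Plane := fun k => k₀ + l k • (k - k₀)
  have hl1 : ∀ k, l k ≤ 1 := fun k => by
    have := χ.le_one (x := k)
    simp only [l]
    nlinarith
  have hlκ : ∀ k, κ ≤ l k := fun k => by
    have := χ.nonneg (x := k)
    simp only [l]
    nlinarith
  have hgdist : ∀ k, dist (g k) k₀ = l k * dist k k₀ := fun k => by
    rw [dist_eq_norm, dist_eq_norm, add_sub_cancel_left, norm_smul,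
      Real.norm_of_nonneg (by linarith [hlκ k])]
  have hgdist' : ∀ k, dist k (g k) = (1 - l k) * dist k k₀ := fun k => by
    have h1 : k - g k = (1 - l k) • (k - k₀) := by
      simp only [g]
      module
    rw [dist_eq_norm, h1, norm_smul, Real.norm_of_nonneg (by linarith [hl1 k]), dist_eq_norm]
  have hg : ContDiff ℝ ∞ g := by
    have h1 : ContDiff ℝ ∞ l := contDiff_const.add (contDiff_const.mul χ.contDiff)
    exact contDiff_const.add (h1.smul (contDiff_id.sub contDiff_const))
  have hgid : ∀ k, dist k k₀ < ρ / 2 → g k = k := fun k hk => by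
    have h1 : χ k = 1 := χ.one_of_mem_closedBall (Metric.mem_closedBall.2 hk.le)
    simp only [g, l, h1]
    module
  have hwn : ∀ k, 0 < dist k k₀ → dist k k₀ < s + d' → 0 < dist (g k) k₀ ∧ dist (g k) k₀ < s := by
    intro k hk0 hk
    rw [hgdist]
    refine ⟨mul_pos (by linarith [hlκ k]) hk0, ?_⟩
    rcases lt_or_ge (dist k k₀) ρ with h1 | h1
    · exact (mul_le_of_le_one_left hk0.le (hl1 k)).trans_lt (h1.trans_le hρs)
    · have h2 : l k = κ := by
        simp only [l, χ.zero_of_le_dist h1, mul_zero, add_zero]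
      rw [h2, ← hκs]
      exact mul_lt_mul_of_pos_left hk (by linarith)
  refine ⟨fun k => ‖P k (u (g k))‖⁻¹ • P k (u (g k)), isSectionOn_inv_norm_smul fun k hk0 hk => ?_,
    fun k hk0 hk => ?_⟩
  · obtain ⟨hg1, hg2⟩ := hwn k hk0 hk
    obtain ⟨hu1, hu2, hu3⟩ := hu (g k) hg1 hg2
    obtain ⟨hP1, hP2⟩ := hP k hk0 (hk.le.trans hsr)
    have hug : ContDiffAt ℝ ∞ (fun k => u (g k)) k := hu1.comp k hg.contDiffAt
    refine ⟨?_, fun h0 => ?_, congrArg (fun B : H →L[ℂ] H => B (u (g k))) hP2⟩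
    · exact ContDiffAt.clm_apply (f := fun k => ContinuousLinearMap.restrictScalarsL ℂ H H ℝ ℝ (P k))
        ((ContinuousLinearMap.contDiff _).contDiffAt.comp k hP1) hug
    · rcases lt_or_ge (dist k k₀) (ρ / 2) with h1 | h1
      · rw [hgid k h1] at h0 hu3 hu2
        rw [← hu3, h0, norm_zero] at hu2
        exact zero_ne_one hu2
      · have h2 : dist (P k) (P (g k)) < 1 := by
          refine hPd k (hmemA k (by linarith) (hk.le.trans hsr)) (g k) (hmemA _ ?_ ?_) ?_
          · rw [hgdist]
            nlinarith [hlκ k]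
          · linarith
          · rw [hgdist']
            refine lt_of_le_of_lt ?_ hd'1
            have h3 : (1 - l k) * dist k k₀ ≤ (1 - κ) * (s + d') :=
              mul_le_mul (by linarith [hlκ k]) hk.le hk0.le (by linarith)
            linarith
        have h4 : ‖(P k - P (g k)) (u (g k))‖ < 1 := by
          refine ((P k - P (g k)).le_opNorm _).trans_lt ?_
          rwa [hu2, mul_one, ← dist_eq_norm]
        rw [_root_.sub_apply, h0, hu3, zero_sub, norm_neg, hu2] at h4
        exact lt_irrefl _ h4
  · obtain ⟨hu1, hu2, hu3⟩ := hu k hk0 (by linarith)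
    simp only [hgid k hk, hu3, hu2, inv_one, one_smul]

theorem exists_isSectionOn_extension {P : Plane → H →L[ℂ] H} {k₀ : Plane} {r ρ : ℝ} (hρ : 0 < ρ)
    (hρr : ρ < r) (hP : ∀ k, 0 < dist k k₀ → dist k k₀ ≤ r → ContDiffAt ℝ ∞ P k ∧ P k * P k = P k)
    {u₀ : Plane → H} (hu₀ : IsSectionOn P k₀ ρ u₀) :
    ∃ u, IsSectionOn P k₀ r u ∧ ∀ k, 0 < dist k k₀ → dist k k₀ < ρ / 2 → u k = u₀ k := by
  obtain ⟨d, hd, hstep⟩ := exists_isSectionOn_step hρ hP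
  obtain ⟨J, hJ⟩ := exists_nat_gt ((r - ρ) / d)
  have hJ0 : (0 : ℝ) < J := (div_pos (sub_pos.2 hρr) hd).trans hJ
  obtain ⟨d', hd'⟩ : ∃ d', d' = (r - ρ) / J := ⟨_, rfl⟩
  have hJd : J * d' = r - ρ := by rw [hd', mul_div_cancel₀ _ hJ0.ne']
  have hd'0 : 0 < d' := by
    rw [hd']
    exact div_pos (sub_pos.2 hρr) hJ0
  have hd'd : d' ≤ d := by
    rw [hd', div_le_iff₀ hJ0]
    rw [div_lt_iff₀ hd] at hJ
    linarith
  have key : ∀ j : ℕ, j ≤ J → ∃ u, IsSectionOn P k₀ (ρ + j * d') u ∧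
      ∀ k, 0 < dist k k₀ → dist k k₀ < ρ / 2 → u k = u₀ k := by
    intro j
    induction j with
    | zero => exact fun _ => ⟨u₀, by simpa using hu₀, fun _ _ _ => rfl⟩
    | succ j ih =>
      intro hj
      obtain ⟨u, hu, huu⟩ := ih (by omega)
      have hj' : ((j : ℝ) + 1) ≤ J := by exact_mod_cast hj
      have hle : ((j : ℝ) + 1) * d' ≤ J * d' := mul_le_mul_of_nonneg_right hj' hd'0.le
      have hj0 : 0 ≤ (j : ℝ) * d' := by positivity
      obtain ⟨u', hu', huu'⟩ := hstep d' (ρ + j * d') u hd'0 hd'd (by linarith) (by linarith) hu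
      refine ⟨u', ?_, fun k h1 h2 => (huu' k h1 h2).trans (huu k h1 h2)⟩
      have : ρ + ((j + 1 : ℕ) : ℝ) * d' = ρ + j * d' + d' := by push_cast; ring
      rwa [this]
  obtain ⟨u, hu, huu⟩ := key J le_rfl
  refine ⟨u, ?_, huu⟩
  have : ρ + J * d' = r := by linarith
  rwa [this] at hu

end Section

/-! ### Bounds on the punctured disc and asymptotics of the eigenvalues. -/

theorem norm_partialDeriv_le {X : Type*} [NormedAddCommGroup X] [NormedSpace ℝ X] {N : ℕ}
    (I : Fin N → Fin 2) (F : Plane → X) (k : Plane) :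
    ‖partialDeriv I F k‖ ≤ ‖iteratedFDeriv ℝ N F k‖ := by
  refine (ContinuousMultilinearMap.le_opNorm _ _).trans_eq ?_
  simp

/-- A bound near the origin of the puncture, together with smoothness up to the outer boundary,
gives a bound on the whole punctured disc. -/
theorem exists_partialDeriv_bound {X : Type*} [NormedAddCommGroup X] [NormedSpace ℝ X]
    {F : Plane → X} {k₀ : Plane} {r ρ C₀ : ℝ} {m N : ℕ} (hm : 1 ≤ m) (hr : 0 < r)
    (hF : ∀ k, 0 < dist k k₀ → dist k k₀ ≤ r → ContDiffAt ℝ ∞ F k) (hρ : 0 < ρ)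
    (hb : ∀ q : Plane, 0 < ‖q‖ → ‖q‖ ≤ ρ → ‖iteratedFDeriv ℝ N F (k₀ + q)‖ ≤ C₀ / ‖q‖ ^ N) :
    ∃ C : ℝ, 0 < C ∧ ∀ I : Fin N → Fin 2, ∀ q : Plane, 0 < ‖q‖ → ‖q‖ < r →
      ‖partialDeriv I F (k₀ + q)‖ ≤ C / ‖q‖ ^ (N * m) := by
  have hA : IsCompact (Metric.closedBall k₀ r \ Metric.ball k₀ ρ) :=
    (isCompact_closedBall k₀ r).diff Metric.isOpen_ball
  have hcont : ContinuousOn (fun k => ‖iteratedFDeriv ℝ N F k‖)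
      (Metric.closedBall k₀ r \ Metric.ball k₀ ρ) := fun k hk => by
    have h1 := hF k (hρ.trans_le (not_lt.1 hk.2)) hk.1
    exact ((h1.iteratedFDeriv_right (m := 0) (i := N) (by
      rw [zero_add]
      exact_mod_cast le_top)).continuousAt.norm).continuousWithinAt
  obtain ⟨C₁, hC₁⟩ := hA.bddAbove_image hcont
  -- Near the puncture `|q|^{-N} = |q|^{-Nm} |q|^{Nm - N}`, and the last factor is at most `r ^ (N *
  -- m - N)`. Farther out `|q|^{Nm} ≤ r^{Nm}`. The `1` ensures positivity.
  refine ⟨|C₀| * r ^ (N * m - N) + |C₁| * r ^ (N * m) + 1, by positivity, fun I q hq0 hqr => ?_⟩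
  refine (norm_partialDeriv_le I F _).trans ?_
  have hNm : N ≤ N * m := Nat.le_mul_of_pos_right N hm
  rw [le_div_iff₀ (pow_pos hq0 _)]
  have e1 : 0 ≤ |C₁| * r ^ (N * m) := by positivity
  have e0 : 0 ≤ |C₀| * r ^ (N * m - N) := by positivity
  rcases le_or_gt ‖q‖ ρ with h | h
  · have h1 : ‖iteratedFDeriv ℝ N F (k₀ + q)‖ * ‖q‖ ^ N ≤ |C₀| :=
      ((le_div_iff₀ (pow_pos hq0 _)).1 (hb q hq0 h)).trans (le_abs_self _)
    have h2 : ‖q‖ ^ (N * m) = ‖q‖ ^ N * ‖q‖ ^ (N * m - N) := by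
      rw [← pow_add, Nat.add_sub_cancel' hNm]
    have h3 : ‖q‖ ^ (N * m - N) ≤ r ^ (N * m - N) := pow_le_pow_left₀ hq0.le hqr.le _
    have h4 : ‖iteratedFDeriv ℝ N F (k₀ + q)‖ * ‖q‖ ^ (N * m) ≤ |C₀| * r ^ (N * m - N) := by
      rw [h2, ← mul_assoc]
      exact mul_le_mul h1 h3 (by positivity) (abs_nonneg _)
    linarith
  · have hmem : k₀ + q ∈ Metric.closedBall k₀ r \ Metric.ball k₀ ρ := by
      simp only [Set.mem_sdiff, Metric.mem_closedBall, Metric.mem_ball, dist_self_add_left]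
      exact ⟨hqr.le, not_lt.2 h.le⟩
    have h1 : ‖iteratedFDeriv ℝ N F (k₀ + q)‖ ≤ |C₁| := (hC₁ ⟨_, hmem, rfl⟩).trans (le_abs_self _)
    have h3 : ‖q‖ ^ (N * m) ≤ r ^ (N * m) := pow_le_pow_left₀ hq0.le hqr.le _
    have h4 : ‖iteratedFDeriv ℝ N F (k₀ + q)‖ * ‖q‖ ^ (N * m) ≤ |C₁| * r ^ (N * m) :=
      mul_le_mul h1 h3 (by positivity) (abs_nonneg _)
    linarith

theorem tendsto_of_expansion {E : Plane → ℝ} {k₀ : Plane} {ε v C : ℝ} {m : ℕ} (hε : 0 < ε)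
    (h : ∀ q : Plane, ‖q‖ < ε → |E (k₀ + q) - E k₀ - v * ‖q‖ ^ m| ≤ C * ‖q‖ ^ (m + 1)) :
    Filter.Tendsto (fun q => (E (k₀ + q) - E k₀) / ‖q‖ ^ m) (nhdsWithin 0 {0}ᶜ) (nhds v) := by
  rw [tendsto_iff_norm_sub_tendsto_zero]
  have h1 : Filter.Tendsto (fun q : Plane => C * ‖q‖) (nhdsWithin 0 {0}ᶜ) (nhds 0) := by
    have h2 : Continuous fun q : Plane => C * ‖q‖ := by fun_prop
    have h3 := h2.tendsto 0
    rw [norm_zero, mul_zero] at h3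
    exact h3.mono_left nhdsWithin_le_nhds
  refine squeeze_zero' (Filter.Eventually.of_forall fun q => norm_nonneg _) ?_ h1
  filter_upwards [self_mem_nhdsWithin, nhdsWithin_le_nhds (Metric.ball_mem_nhds (0 : Plane) hε)]
    with q hq0 hq
  rw [mem_ball_zero_iff] at hq
  have hq1 : 0 < ‖q‖ := norm_pos_iff.2 hq0
  have hqm : 0 < ‖q‖ ^ m := pow_pos hq1 m
  have h4 : (E (k₀ + q) - E k₀) / ‖q‖ ^ m - v = (E (k₀ + q) - E k₀ - v * ‖q‖ ^ m) / ‖q‖ ^ m := by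
    field_simp
  rw [h4, Real.norm_eq_abs, abs_div, abs_of_pos hqm, div_le_iff₀ hqm]
  refine (h q hq).trans_eq ?_
  ring

namespace IsResolventFamily

variable {a : Module.Basis (Fin 2) ℝ Plane} {V : Plane → ℝ} {μ : ℝ}
  {T : Plane → Fibre a →L[ℂ] Fibre a}

/-- The derivative of `e ↦ (e + μ)⁻¹` is `-(e + μ)⁻²`. The sign reverses, so the upper band receives
a negative limit and the lower one a positive limit. -/
theorem tendsto_inv_band (hT : IsResolventFamily a V μ T) {i : ℕ} {k₀ : Plane} {ε v C : ℝ} {m : ℕ}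
    (hε : 0 < ε) (h : ∀ q : Plane, ‖q‖ < ε →
      |band a V i (k₀ + q) - band a V i k₀ - v * ‖q‖ ^ m| ≤ C * ‖q‖ ^ (m + 1)) :
    Filter.Tendsto (fun q => ((band a V i (k₀ + q) + μ)⁻¹ - (band a V i k₀ + μ)⁻¹) / ‖q‖ ^ m)
      (nhdsWithin 0 {0}ᶜ) (nhds (-v / (band a V i k₀ + μ) ^ 2)) := by
  have h1 := tendsto_of_expansion hε h
  have hpos : ∀ k, 0 < band a V i k + μ := fun k => by linarith [hT.one_le_band_add i k]
  have h2 : Filter.Tendsto (fun q => (band a V i (k₀ + q) + μ)⁻¹) (nhdsWithin 0 {0}ᶜ)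
      (nhds (band a V i k₀ + μ)⁻¹) := by
    have h3 : Continuous fun q => (band a V i (k₀ + q) + μ)⁻¹ :=
      (((hT.continuous_band i).comp (continuous_const.add continuous_id)).add
        continuous_const).inv₀ fun q => (hpos _).ne'
    have h4 := h3.tendsto 0
    rw [add_zero] at h4
    exact h4.mono_left nhdsWithin_le_nhds
  have h5 := (h1.neg.mul h2).mul_const (band a V i k₀ + μ)⁻¹
  have h6 : -v * (band a V i k₀ + μ)⁻¹ * (band a V i k₀ + μ)⁻¹ = -v / (band a V i k₀ + μ) ^ 2 := by
    have := (hpos k₀).ne'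
    field_simp
  rw [h6] at h5
  refine h5.congr fun q => ?_
  have := (hpos k₀).ne'
  have := (hpos (k₀ + q)).ne'
  by_cases hq : ‖q‖ ^ m = 0
  · simp [hq]
  · field_simp
    ring

theorem eigenprojector_mul_self (hT : IsResolventFamily a V μ T) (i : ℕ) (k : Plane) :
    eigenprojector a V i k * eigenprojector a V i k = eigenprojector a V i k :=
  ContinuousLinearMap.ext fun u => eigenprojector_apply_of_mem (hT.eigenprojector_apply_mem i k u)

theorem eigenprojector_mul_of_ne (hT : IsResolventFamily a V μ T) {i j : ℕ} {k : Plane}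
    (h : band a V i k ≠ band a V j k) : eigenprojector a V i k * eigenprojector a V j k = 0 :=
  ContinuousLinearMap.ext fun u =>
    hT.eigenprojector_apply_of_ne h.symm (hT.eigenprojector_apply_mem j k u)

theorem isProjectorPair (hT : IsResolventFamily a V μ T) {i j : ℕ} {k : Plane}
    (h : band a V i k ≠ band a V j k) :
    IsProjectorPair (eigenprojector a V i k) (eigenprojector a V j k) :=
  ⟨hT.eigenprojector_mul_self i k, hT.eigenprojector_mul_self j k, hT.eigenprojector_mul_of_ne h,
    hT.eigenprojector_mul_of_ne h.symm, Submodule.starProjection_norm_le _,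
    Submodule.starProjection_norm_le _⟩

theorem isRankOneProjector (hT : IsResolventFamily a V μ T) {i : ℕ} {k : Plane}
    (h : Module.finrank ℂ (eigenspace a V k (band a V i k)) = 1) :
    IsRankOneProjector (eigenprojector a V i k) := by
  obtain ⟨⟨v, hv⟩, hv0, hspan⟩ := finrank_eq_one_iff'.1 h
  have hv0' : v ≠ 0 := fun h => hv0 (Subtype.ext h)
  have hc : ∀ u, ∃ c : ℂ, eigenprojector a V i k u = c • v := fun u => by
    obtain ⟨c, hc⟩ := hspan ⟨_, hT.eigenprojector_apply_mem i k u⟩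
    exact ⟨c, (congrArg Subtype.val hc).symm⟩
  choose c hc using hc
  refine ⟨hT.eigenprojector_mul_self i k, fun x y => Submodule.inner_starProjection_left_eq_right _ x y,
    fun x y z w => ?_, le_antisymm (Submodule.starProjection_norm_le _) ?_⟩
  · rw [hc, hc, inner_smul_right, inner_smul_right, inner_smul_right, inner_smul_right]
    ring
  · have h1 := (eigenprojector a V i k).le_opNorm v
    rw [eigenprojector_apply_of_mem hv] at h1
    exact le_of_mul_le_mul_right (by rwa [one_mul]) (norm_pos_iff.2 hv0')

theorem mul_eigenprojector (hT : IsResolventFamily a V μ T) (i : ℕ) (k : Plane) (t : ℝ) :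
    (T k - (t : ℂ) • 1) * eigenprojector a V i k =
      (((band a V i k + μ)⁻¹ - t : ℝ) : ℂ) • eigenprojector a V i k := by
  ext1 u
  change T k (eigenprojector a V i k u) - (t : ℂ) • eigenprojector a V i k u =
    (((band a V i k + μ)⁻¹ - t : ℝ) : ℂ) • eigenprojector a V i k u
  rw [hT.apply_of_mem (hT.eigenprojector_apply_mem i k u), Complex.ofReal_sub, sub_smul]

end IsResolventFamily

variable {a : Module.Basis (Fin 2) ℝ Plane} {V : Plane → ℝ} {n : ℕ} {K : Finset Plane}
  {m : Plane → ℕ}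

/-- Being distinct is an open condition and holds up to the boundary of the compact disc. The room
gained gives smoothness on the closed outer boundary, hence bounds that do not degenerate as `|q| →
r`. -/
theorem exists_bands_ne_of_larger_radius {E E' : Plane → ℝ} (hE : Continuous E)
    (hE' : Continuous E') {k₀ : Plane} {r : ℝ} (hr : 0 < r)
    (h : ∀ k ∈ Metric.closedBall k₀ r, E k = E' k → k = k₀) :
    ∃ r', r < r' ∧ ∀ k, 0 < dist k k₀ → dist k k₀ ≤ r' → E k ≠ E' k := by
  have hU : IsOpen ({k | E k ≠ E' k} ∪ Metric.ball k₀ r) :=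
    (isOpen_ne_fun hE hE').union Metric.isOpen_ball
  have hsub : Metric.closedBall k₀ r ⊆ {k | E k ≠ E' k} ∪ Metric.ball k₀ r := fun k hk => by
    by_cases hk0 : k = k₀
    · exact Or.inr (hk0 ▸ Metric.mem_ball_self hr)
    · exact Or.inl fun heq => hk0 (h k hk heq)
  obtain ⟨δ, hδ, hsubδ⟩ := (isCompact_closedBall k₀ r).exists_cthickening_subset_open hU hsub
  refine ⟨r + δ, by linarith, fun k hk0 hk heq => ?_⟩
  have hk1 : k ∈ Metric.cthickening δ (Metric.closedBall k₀ r) := by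
    rw [cthickening_closedBall hδ.le hr.le, add_comm]
    exact hk
  rcases hsubδ hk1 with h1 | h1
  · exact h1 heq
  · exact dist_pos.1 hk0 (h k (Metric.ball_subset_closedBall h1) heq)

/-! ### Application to the two touching bands. -/

namespace IsSemimetal

theorem one_le_order (h : IsSemimetal a V n K m) {k₀ : Plane} (hk₀ : k₀ ∈ K) : 1 ≤ m k₀ := by
  rcases h.order k₀ hk₀ with h1 | h1 <;> omega

theorem band_eq_band (h : IsSemimetal a V n K m) {k₀ : Plane} (hk₀ : k₀ ∈ K) :
    band a V (n + 1) k₀ = band a V n k₀ :=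
  (h.intersection k₀).2 ⟨k₀, hk₀, by rw [sub_self]; exact (dualLattice a).zero_mem⟩

/-- Near a crossing the eigenprojectors are smooth in polar coordinates, and some vector is
annihilated by none of the limits of the upper one. -/
theorem exists_polar (h : IsSemimetal a V n K m) {μ : ℝ} {T : Plane → Fibre a →L[ℂ] Fibre a}
    (hT : IsResolventFamily a V μ T) {k₀ : Plane} (hk₀ : k₀ ∈ K) {r : ℝ} (hr : 0 < r)
    (hne : ∀ k, 0 < dist k k₀ → dist k k₀ ≤ r → band a V (n + 1) k ≠ band a V n k) :
    ∃ p : ℝ × Plane → Fibre a →L[ℂ] Fibre a,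
      (∀ v ∈ Metric.sphere (0 : Plane) 1, ∀ᶠ x in nhds ((0 : ℝ), v),
        ContDiffAt ℝ ∞ p x ∧ (0 < x.1 → eigenprojector a V (n + 1) (k₀ + x.1 • x.2) = p x)) ∧
      ∃ e, ∀ v ∈ Metric.sphere (0 : Plane) 1, p (0, v) e ≠ 0 := by
  obtain ⟨g, hg, hgap⟩ := h.gap
  obtain ⟨ε, vp, vm, C, hε, hvp, hvm, hexp⟩ := h.expansion k₀ hk₀
  have heq := h.band_eq_band hk₀
  obtain ⟨S, hS⟩ := hT.exists_contDiffAt_crossing hg hgap heq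
  have hpos : 0 < band a V (n + 1) k₀ + μ := by linarith [hT.one_le_band_add (n + 1) k₀]
  have hne' : ∀ᶠ q in nhdsWithin (0 : Plane) {0}ᶜ,
      band a V (n + 1) (k₀ + q) ≠ band a V n (k₀ + q) := by
    filter_upwards [self_mem_nhdsWithin, nhdsWithin_le_nhds (Metric.ball_mem_nhds (0 : Plane) hr)]
      with q hq0 hq
    rw [mem_ball_zero_iff] at hq
    refine hne _ ?_ ?_
    · rw [dist_self_add_left]
      exact norm_pos_iff.2 hq0
    · rw [dist_self_add_left]
      exact hq.le
  have hS' : ∀ᶠ q in nhdsWithin (0 : Plane) {0}ᶜ,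
      S (k₀ + q) = eigenprojector a V (n + 1) (k₀ + q) + eigenprojector a V n (k₀ + q) := by
    have h1 : Filter.Tendsto (fun q : Plane => k₀ + q) (nhdsWithin 0 {0}ᶜ) (nhds k₀) := by
      have h2 : Continuous fun q : Plane => k₀ + q := by fun_prop
      have h3 := h2.tendsto 0
      rw [add_zero] at h3
      exact h3.mono_left nhdsWithin_le_nhds
    filter_upwards [h1.eventually hS, hne'] with q hq hq'
    exact hq.2 hq'
  obtain ⟨t, ht⟩ : ∃ t, t = (band a V (n + 1) k₀ + μ)⁻¹ := ⟨_, rfl⟩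
  -- Multiplying by `S` removes the rest of the spectrum; subtracting `t` makes the two remaining
  -- eigenvalues vanish to order `m` at `k₀`.
  have hB : ∀ᶠ k in nhds k₀, ContDiffAt ℝ ∞ (fun k => (T k - (t : ℂ) • 1) * S k) k := by
    filter_upwards [hS] with k hk
    exact (hT.contDiff.contDiffAt.sub contDiffAt_const).mul hk.1
  have hBe : ∀ᶠ q in nhdsWithin (0 : Plane) {0}ᶜ,
      (T (k₀ + q) - (t : ℂ) • 1) * S (k₀ + q) =
        (((band a V (n + 1) (k₀ + q) + μ)⁻¹ - t : ℝ) : ℂ) • eigenprojector a V (n + 1) (k₀ + q) +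
        (((band a V n (k₀ + q) + μ)⁻¹ - t : ℝ) : ℂ) • eigenprojector a V n (k₀ + q) := by
    filter_upwards [hS'] with q hq
    rw [hq, mul_add, hT.mul_eigenprojector, hT.mul_eigenprojector]
  have hb := hT.tendsto_inv_band (i := n + 1) hε fun q hq => (hexp q hq).1
  have hc := hT.tendsto_inv_band (i := n) (v := -vm) hε fun q hq => by
    have := (hexp q hq).2
    rwa [neg_mul, sub_neg_eq_add]
  rw [← heq, ← ht, neg_neg] at hc
  rw [← ht] at hb
  have hτ : -vp / (band a V (n + 1) k₀ + μ) ^ 2 < 0 := div_neg_of_neg_of_pos (by linarith) (by positivity)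
  have hσ : 0 < vm / (band a V (n + 1) k₀ + μ) ^ 2 := by positivity
  obtain ⟨p, hp⟩ := exists_polar_extension
    (b := fun k => (band a V (n + 1) k + μ)⁻¹ - t) (c := fun k => (band a V n k + μ)⁻¹ - t)
    hτ.ne (hτ.trans hσ).ne hB (by
      filter_upwards [hBe, hne'] with q hq hq'
      exact ⟨hT.isProjectorPair hq', hq⟩) hb hc
  -- The same operator with the bands exchanged, its circle now centred at the positive limit.
  obtain ⟨p', hp'⟩ := exists_polar_extension
    (b := fun k => (band a V n k + μ)⁻¹ - t) (c := fun k => (band a V (n + 1) k + μ)⁻¹ - t)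
    hσ.ne' (hτ.trans hσ).ne' hB (by
      filter_upwards [hBe, hne'] with q hq hq'
      exact ⟨hT.isProjectorPair hq'.symm, hq.trans (add_comm _ _)⟩) hc hb
  refine ⟨p, hp, exists_forall_apply_ne_zero hp hp' ?_ hS.self_of_nhds.1.continuousAt⟩
  filter_upwards [hS', hne'] with q hq hq'
  have hsimple := h.simple (k₀ + q) fun hex => hq' ((h.intersection _).2 hex)
  exact ⟨hT.isRankOneProjector hsimple.1, hT.isRankOneProjector hsimple.2,
    hT.eigenprojector_mul_of_ne hq', hq⟩

end IsSemimetal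

end Bloch

end

theorem mainTheorem10 (a : Module.Basis (Fin 2) ℝ Bloch.Plane) (V : Bloch.Plane → ℝ) (n : ℕ)
    (K : Finset Bloch.Plane) (m : Bloch.Plane → ℕ) (h : Bloch.IsSemimetal a V n K m)
    (k₀ : Bloch.Plane) (hk₀ : k₀ ∈ K) (r : ℝ) (hr : 0 < r)
    (hdisc : ∀ k ∈ Metric.closedBall k₀ r,
      Bloch.band a V (n + 1) k = Bloch.band a V n k → k = k₀) :
    (ContDiffOn ℝ ∞ (Bloch.eigenprojector a V (n + 1)) (Bloch.puncturedDisc k₀ r) ∧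
      ∀ N : ℕ, ∃ C : ℝ, 0 < C ∧ ∀ I : Fin N → Fin 2, ∀ q : Bloch.Plane, 0 < ‖q‖ → ‖q‖ < r →
        ‖Bloch.partialDeriv I (Bloch.eigenprojector a V (n + 1)) (k₀ + q)‖
          ≤ C / ‖q‖ ^ (N * m k₀)) ∧
    ∃ u : Bloch.Plane → Bloch.Fibre a,
      ContDiffOn ℝ ∞ u (Bloch.puncturedDisc k₀ r) ∧
      (∀ k ∈ Bloch.puncturedDisc k₀ r,
        ‖u k‖ = 1 ∧ Bloch.eigenprojector a V (n + 1) k (u k) = u k) ∧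
      ∀ N : ℕ, ∃ C : ℝ, 0 < C ∧ ∀ I : Fin N → Fin 2, ∀ q : Bloch.Plane, 0 < ‖q‖ → ‖q‖ < r →
        ‖Bloch.partialDeriv I u (k₀ + q)‖ ≤ C / ‖q‖ ^ (N * m k₀) := by
  obtain ⟨μ, T, hT⟩ := Bloch.exists_isResolventFamily h.aemeasurable h.bounded
  obtain ⟨g, hg, hgap⟩ := h.gap
  obtain ⟨r', hrr', hne⟩ := Bloch.exists_bands_ne_of_larger_radius
    (hT.continuous_band (n + 1)) (hT.continuous_band n) hr hdisc
  have hm := h.one_le_order hk₀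
  have hr' : 0 < r' := hr.trans hrr'
  have hP : ∀ k, 0 < dist k k₀ → dist k k₀ ≤ r' →
      ContDiffAt ℝ ∞ (Bloch.eigenprojector a V (n + 1)) k := fun k hk0 hk =>
    hT.contDiffAt_eigenprojector hg hgap (hne k hk0 hk)
  have hdist : ∀ k ∈ Bloch.puncturedDisc k₀ r, 0 < dist k k₀ ∧ dist k k₀ < r := fun k hk =>
    ⟨dist_pos.2 hk.2, hk.1⟩
  obtain ⟨p, hp, e, he⟩ := h.exists_polar hT hk₀ hr' hne
  obtain ⟨ρ, hρ, hPb⟩ := Bloch.exists_polar_bound hp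
  refine ⟨⟨fun k hk => (hP k (hdist k hk).1 ((hdist k hk).2.le.trans hrr'.le)).contDiffWithinAt,
    fun N => ?_⟩, ?_⟩
  · obtain ⟨C, hC⟩ := hPb N
    exact Bloch.exists_partialDeriv_bound hm hr (fun k hk0 hk => hP k hk0 (hk.trans hrr'.le)) hρ hC
  have hw : ∀ v ∈ Metric.sphere (0 : Bloch.Plane) 1, ∀ᶠ x in nhds ((0 : ℝ), v),
      ContDiffAt ℝ ∞ (fun x => p x e) x ∧ p x e ≠ 0 ∧
        (0 < x.1 → Bloch.eigenprojector a V (n + 1) (k₀ + x.1 • x.2) = p x) := fun v hv => by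
    have hcd : ∀ x, ContDiffAt ℝ ∞ p x → ContDiffAt ℝ ∞ (fun x => p x e) x := fun x hx =>
      ((ContinuousLinearMap.apply ℂ (Bloch.Fibre a) e).restrictScalars ℝ).contDiff.contDiffAt.comp x hx
    have hcont := (hcd _ (hp v hv).self_of_nhds.1).continuousAt
    filter_upwards [hp v hv, hcont.eventually_ne (he v hv)] with x hx hx'
    exact ⟨hcd x hx.1, hx', hx.2⟩
  -- The normalised projection of `e` is smooth in polar coordinates because `p x e` is nonzero up
  -- to `x.1 = 0`.
  obtain ⟨u₀, hu₀⟩ : ∃ u₀ : Bloch.Plane → Bloch.Fibre a, u₀ = fun k =>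
      ‖Bloch.eigenprojector a V (n + 1) k e‖⁻¹ • Bloch.eigenprojector a V (n + 1) k e := ⟨_, rfl⟩
  obtain ⟨ρ₁, hρ₁, hub⟩ := Bloch.exists_polar_bound (f := u₀) (x₀ := k₀)
    (g := fun x => ‖p x e‖⁻¹ • p x e) fun v hv => by
      filter_upwards [hw v hv] with x hx
      refine ⟨Bloch.contDiffAt_inv_norm_smul hx.1 hx.2.1, fun hx0 => ?_⟩
      simp only [hu₀, hx.2.2 hx0]
  have hnz : ∀ᶠ q in nhdsWithin (0 : Bloch.Plane) {0}ᶜ,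
      Bloch.eigenprojector a V (n + 1) (k₀ + q) e ≠ 0 :=
    Bloch.eventually_punctured_of_polar fun v hv => by
      filter_upwards [hw v hv] with x hx hx0
      rw [hx.2.2 hx0]
      exact hx.2.1
  obtain ⟨ρ₂, hρ₂, hnz₂⟩ := Metric.eventually_nhds_iff.1 (eventually_nhdsWithin_iff.1 hnz)
  obtain ⟨ρ₃, hρ₃⟩ : ∃ ρ₃, ρ₃ = min ρ₂ r := ⟨_, rfl⟩
  have hρ₃0 : 0 < ρ₃ := by
    rw [hρ₃]
    exact lt_min hρ₂ hr
  have hρ₃2 : ρ₃ ≤ ρ₂ := hρ₃ ▸ min_le_left _ _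
  have hρ₃r : ρ₃ ≤ r := hρ₃ ▸ min_le_right _ _
  have hsec : Bloch.IsSectionOn (Bloch.eigenprojector a V (n + 1)) k₀ ρ₃ u₀ := by
    rw [hu₀]
    refine Bloch.isSectionOn_inv_norm_smul fun k hk0 hk => ⟨?_, ?_, ?_⟩
    · exact ((ContinuousLinearMap.apply ℂ (Bloch.Fibre a) e).restrictScalars
        ℝ).contDiff.contDiffAt.comp k (hP k hk0 (hk.le.trans (hρ₃r.trans hrr'.le)))
    · have h1 := hnz₂ (y := k - k₀) (by
        rw [dist_zero_right, ← dist_eq_norm]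
        exact hk.trans_le hρ₃2) (sub_ne_zero.2 (dist_pos.1 hk0))
      rwa [add_sub_cancel] at h1
    · exact congrArg (fun B : Bloch.Fibre a →L[ℂ] Bloch.Fibre a => B e)
        (hT.eigenprojector_mul_self (n + 1) k)
  -- Extending to `r' > r` rather than `r` makes `u` smooth up to the outer boundary, as the
  -- compactness bound requires.
  obtain ⟨u, hu, huu⟩ := Bloch.exists_isSectionOn_extension hρ₃0 (hρ₃r.trans_lt hrr')
    (fun k hk0 hk => ⟨hP k hk0 hk, hT.eigenprojector_mul_self (n + 1) k⟩) hsec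
  have hu' : ∀ k, 0 < dist k k₀ → dist k k₀ ≤ r → ContDiffAt ℝ ∞ u k := fun k hk0 hk =>
    (hu k hk0 (hk.trans_lt hrr')).1
  refine ⟨u, fun k hk => (hu' k (hdist k hk).1 (hdist k hk).2.le).contDiffWithinAt,
    fun k hk => (hu k (hdist k hk).1 ((hdist k hk).2.trans hrr')).2, fun N => ?_⟩
  obtain ⟨C, hC⟩ := hub N
  -- `u` and `u₀` agree at radii below `ρ₃ / 2`; with `ρ₃ / 4` they agree on a neighbourhood of `k₀
  -- + q`, hence so do their derivatives.
  refine Bloch.exists_partialDeriv_bound hm hr hu' (ρ := min ρ₁ (ρ₃ / 4))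
    (lt_min hρ₁ (by positivity)) (C₀ := C) fun q hq0 hq => ?_
  have hq3 : ‖q‖ ≤ ρ₃ / 4 := hq.trans (min_le_right _ _)
  have hloc : u =ᶠ[nhds (k₀ + q)] u₀ := by
    have h1 : Continuous fun k : Bloch.Plane => dist k k₀ := by fun_prop
    have h2 : ∀ᶠ k in nhds (k₀ + q), 0 < dist k k₀ :=
      (h1.tendsto _).eventually (lt_mem_nhds (by rwa [dist_self_add_left]))
    have h3 : ∀ᶠ k in nhds (k₀ + q), dist k k₀ < ρ₃ / 2 :=
      (h1.tendsto _).eventually (gt_mem_nhds (by rw [dist_self_add_left]; linarith))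
    filter_upwards [h2, h3] with k hk2 hk3
    exact huu k hk2 hk3
  rw [(hloc.iteratedFDeriv ℝ N).self_of_nhds]
  exact hC q hq0 (hq.trans (min_le_left _ _))
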